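/- Let $\mathbf B$ be the first-order theory in the language $\{\in\}$ with the axioms Extensionality, Pair, Union, Infinity (there is a limit ordinal), the scheme of $\Delta_0$ Separation, Regularity (every nonempty set has an $\in$-minimal element), Transitive Closure (every set has a transitive closure), and Finite Powerset (for every set $x$ the set of all finite subsets of $x$ exists). A tree is a set $T\subseteq X^{<\omega}$ of finite sequences, for some set $X$, that is closed under initial segments; $T$ is well founded if every nonempty subset $Y\subseteq T$ has an element with no immediate successor $\sigma^\frown(x)$ in $Y$. A bisimulation on a well founded tree $T$ is a relation $B\subseteq T\times T$ such that for all $\sigma,\tau\in T$: $\sigma\,B\,\tau$ if and only if for every immediate successor $\rho_0\in T$ of $\sigma$ there is an immediate successor $\rho_1\in T$ of $\tau$ with $\rho_0\,B\,\rho_1$, and for every immediate successor $\rho_1\in T$ of $\tau$ there is an immediate successor $\rho_0\in T$ of $\sigma$ with $\rho_0\,B\,\rho_1$. The Bisimulation Axiom is the sentence: every well founded tree has a bisimulation. $\Delta_0\text{-}\mathbf{TR}$ is the scheme consisting, for every $\Delta_0$ formula $\psi(u,v,p_0,\dots,p_{m-1})$ in which the variable $v$ occurs only in atomic formulas $x\in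 v$ with $x$ a variable other than $v$, of the sentence: for all sets $p_0,\dots,p_{m-1}$, every set $a$ and every well founded relation $\prec$ on a set $X$ (not necessarily transitive; well founded means that every nonempty subset of $X$ has a $\prec$-minimal element) there is a set $H\subseteq a\times X$ such that for all $s\in X$ and $c\in a$ $$\langle c,s\rangle\in H\iff \psi(c,H_{\prec s},p_0,\dots,p_{m-1}),\qquad\text{where } H_{\prec s}=\{\langle u,t\rangle\in H: t\prec s\}.$$ Then the Bisimulation Axiom and the scheme $\Delta_0\text{-}\mathbf{TR}$ are equivalent over $\mathbf B$: every instance of $\Delta_0\text{-}\mathbf{TR}$ is a logical consequence of $\mathbf B+\text{Bisimulation Axiom}$, and the Bisimulation Axiom is a logical consequence of $\mathbf B+\Delta_0\text{-}\mathbf{TR}$. -/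

import Mathlib

open FirstOrder

namespace WeakSet

open FirstOrder.Language

/-- The only non-logical symbol of the language of set theory: the binary symbol for membership. -/
inductive MemRel : ℕ → Type
  | mem : MemRel 2

/-- The first-order language of set theory. -/
def Lset : FirstOrder.Language.{0, 0} := ⟨fun _ => Empty, MemRel⟩

/-- Formulas of set theory whose free variables are `0, …, n - 1`. A quantifier binds the
variable with the next index: in the scope of one quantifier over an `Fml n`, the new variable is
`Fin.last n` and an old variable `x` is written `x↟`. -/
abbrev Fml (n : ℕ) := Lset.BoundedFormula Empty n

postfix:max "↟" => Fin.castSucc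

section Basic

variable {n : ℕ}

/-- `x ∈ y` -/
def mem (x y : Fin n) : Fml n :=
  Relations.boundedFormula₂ (L := Lset) (MemRel.mem : Lset.Relations 2) (&x) (&y)

/-- `x = y` -/
def eq (x y : Fin n) : Fml n := Term.bdEqual (&x) (&y)

/-- `∀ w, φ w` -/
def all (φ : Fin (n + 1) → Fml (n + 1)) : Fml n := ∀' (φ (Fin.last n))

/-- `∃ w, φ w` -/
def ex (φ : Fin (n + 1) → Fml (n + 1)) : Fml n := ∃' (φ (Fin.last n))

/-- `∀ w ∈ x, φ w` -/
def allIn (x : Fin n) (φ : Fin (n + 1) → Fml (n + 1)) : Fml n :=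
  all fun w => mem w x↟ ⟹ φ w

/-- `∃ w ∈ x, φ w` -/
def exIn (x : Fin n) (φ : Fin (n + 1) → Fml (n + 1)) : Fml n :=
  ex fun w => mem w x↟ ⊓ φ w

/-- `ψ` with its free variables `i` replaced by the variables `g i`. -/
def subst {k : ℕ} (ψ : Lset.Formula (Fin k)) (g : Fin k → Fin n) : Fml n :=
  BoundedFormula.relabel (n := n) (k := 0) (fun i => (Sum.inr (g i) : Empty ⊕ Fin n)) ψ

/-! ### Elementary notions -/

/-- `x ⊆ y` -/
def subset (x y : Fin n) : Fml n := allIn x fun w => mem w y↟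

/-- `x` has an element. -/
def nonempty (x : Fin n) : Fml n := ex fun w => mem w x↟

/-- `z = {x, y}` -/
def isUPair (z x y : Fin n) : Fml n :=
  all fun w => mem w z↟ ⇔ (eq w x↟ ⊔ eq w y↟)

/-- `z = ⟨x, y⟩ = {{x}, {x, y}}`, the Kuratowski pair. -/
def isPair (z x y : Fin n) : Fml n :=
  ex fun p => ex fun q =>
    isUPair p↟ x↟↟ x↟↟ ⊓ isUPair q x↟↟ y↟↟ ⊓ isUPair z↟↟ p↟ q

/-- `⟨x, y⟩ ∈ r` -/
def pairMem (x y r : Fin n) : Fml n := exIn r fun z => isPair z x↟ y↟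

/-- `r ⊆ x × y` -/
def relBetween (r x y : Fin n) : Fml n :=
  allIn r fun z => exIn x↟ fun u => exIn y↟↟ fun w => isPair z↟↟ u↟ w

/-- `x` is transitive. -/
def isTrans (x : Fin n) : Fml n := allIn x fun y => subset y x↟

/-- `x` is an ordinal: a transitive set of transitive sets. -/
def isOrd (x : Fin n) : Fml n := isTrans x ⊓ allIn x fun y => isTrans y

/-- `y = x ∪ {x}` -/
def isSucc (y x : Fin n) : Fml n := all fun w => mem w y↟ ⇔ (mem w x↟ ⊔ eq w x↟)

/-- `x` is a limit ordinal: a nonempty ordinal closed under successor. -/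
def isLimit (x : Fin n) : Fml n :=
  isOrd x ⊓ nonempty x ⊓ allIn x fun y => exIn x↟ fun z => isSucc z y↟

/-- `x` is a natural number (`x ∈ ω`): an ordinal such that neither it nor any smaller ordinal
is a limit. -/
def isNat (x : Fin n) : Fml n :=
  isOrd x ⊓ ∼(isLimit x) ⊓ allIn x fun y => ∼(isLimit y)

/-- `f` is a function from `x` to `y`. -/
def isFun (f x y : Fin n) : Fml n :=
  relBetween f x y ⊓
    allIn x fun u => exIn y↟ fun v => pairMem u↟ v f↟↟ ⊓
      allIn y↟↟ fun w => pairMem u↟↟ w f↟↟↟ ⟹ eq w v↟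

/-- `f` is a bijection from `x` to `y`. -/
def isBij (f x y : Fin n) : Fml n :=
  isFun f x y ⊓
    (allIn x fun u => allIn x↟ fun u' => allIn y↟↟ fun v =>
      (pairMem u↟↟ v f↟↟↟ ⊓ pairMem u'↟ v f↟↟↟) ⟹ eq u↟↟ u'↟) ⊓
    (allIn y fun v => exIn x↟ fun u => pairMem u v↟ f↟↟)

/-- `|y| < ω` -/
def isFinite (y : Fin n) : Fml n :=
  ex fun k => isNat k ⊓ ex fun f => isBij f k↟ y↟↟

/-! ### Trees and bisimulations -/

/-- `s ∈ X^{<ω}`: `s` is a function from a natural number to `X`. -/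
def isFinSeq (s X : Fin n) : Fml n :=
  ex fun k => isNat k ⊓ isFun s↟ k X↟

/-- `T` is a tree: for some `X`, `T ⊆ X^{<ω}` and `T` is closed under initial segments
(for finite sequences, being an initial segment is inclusion). -/
def isTree (T : Fin n) : Fml n :=
  ex fun X => allIn T↟ fun s => isFinSeq s X↟ ⊓
    all fun r => (isFinSeq r X↟↟ ⊓ subset r s↟) ⟹ mem r T↟↟↟

/-- `t` is an immediate successor of `s`: `t = s ∪ {⟨|s|, x⟩}` for some `x`, where
`|s|` is the domain of `s`. -/
def immSucc (t s : Fin n) : Fml n :=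
  ex fun k => ex fun x => ex fun p =>
    (all fun i => mem i k↟↟↟ ⇔ ex fun y => pairMem i↟ y s↟↟↟↟↟) ⊓
    isPair p k↟↟ x↟ ⊓
    (all fun z => mem z t↟↟↟↟ ⇔ (mem z s↟↟↟↟ ⊔ eq z p↟))

/-- The tree `T` is well founded: every nonempty subset has a node without immediate successors
in that subset. -/
def isWFTree (T : Fin n) : Fml n :=
  all fun Y => (subset Y T↟ ⊓ nonempty Y) ⟹
    exIn Y fun s => allIn Y↟ fun t => ∼(immSucc t s↟)

/-- For all immediate successors `s'` of `s` in `T` there is an immediate successor `t'` of `t`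
in `T` with `φ s' t'`. -/
def forth (T s t : Fin n) (φ : Fin (n + 2) → Fin (n + 2) → Fml (n + 2)) : Fml n :=
  allIn T fun s' => immSucc s' s↟ ⟹
    exIn T↟ fun t' => immSucc t' t↟↟ ⊓ φ s'↟ t'

/-- `B` is a bisimulation on the tree `T`. -/
def isBisim (B T : Fin n) : Fml n :=
  relBetween B T T ⊓
    allIn T fun s => allIn T↟ fun t => pairMem s↟ t B↟↟ ⇔
      (forth T↟↟ s↟ t (fun s' t' => pairMem s' t' B↟↟↟↟) ⊓
       forth T↟↟ t s↟ (fun t' s' => pairMem s' t' B↟↟↟↟))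

/-- `r` is a well founded relation on `X`. -/
def isWFRel (r X : Fin n) : Fml n :=
  relBetween r X X ⊓
    all fun Y => (subset Y X↟ ⊓ nonempty Y) ⟹
      exIn Y fun m => allIn Y↟ fun y => ∼(pairMem y m↟ r↟↟↟)

end Basic

/-! ### `Δ₀` formulas -/

/-- `Δ₀` formulas: built from atomic formulas by connectives and bounded quantifiers
`∀ w ∈ x` and `∃ w ∈ x`, where `x` is a (free or bound) variable different from `w`. -/
inductive IsDelta0 {α : Type} : ∀ {n : ℕ}, Lset.BoundedFormula α n → Prop
  | falsum {n : ℕ} : IsDelta0 (BoundedFormula.falsum (n := n))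
  | equal {n : ℕ} (t₁ t₂ : Lset.Term (α ⊕ Fin n)) : IsDelta0 (BoundedFormula.equal t₁ t₂)
  | rel {n l : ℕ} (R : Lset.Relations l) (ts : Fin l → Lset.Term (α ⊕ Fin n)) :
      IsDelta0 (BoundedFormula.rel R ts)
  | imp {n : ℕ} {φ ψ : Lset.BoundedFormula α n} :
      IsDelta0 φ → IsDelta0 ψ → IsDelta0 (φ ⟹ ψ)
  | ball {n : ℕ} (x : α ⊕ Fin n) {φ : Lset.BoundedFormula α (n + 1)} : IsDelta0 φ →
      IsDelta0 (∀' (Relations.boundedFormula₂ (L := Lset) (MemRel.mem : Lset.Relations 2)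
        (&(Fin.last n)) (Term.var (Sum.map id Fin.castSucc x)) ⟹ φ))
  | bex {n : ℕ} (x : α ⊕ Fin n) {φ : Lset.BoundedFormula α (n + 1)} : IsDelta0 φ →
      IsDelta0 (∃' (Relations.boundedFormula₂ (L := Lset) (MemRel.mem : Lset.Relations 2)
        (&(Fin.last n)) (Term.var (Sum.map id Fin.castSucc x)) ⊓ φ))

/-- The free variable `v` occurs in `φ` only in atomic formulas `x ∈ v` with `x` a variable
other than `v`. -/
def OnlyAsContainer {α : Type} (v : α) : ∀ {n : ℕ}, Lset.BoundedFormula α n → Prop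
  | _, .falsum => True
  | _, .equal t₁ t₂ => t₁ ≠ Term.var (Sum.inl v) ∧ t₂ ≠ Term.var (Sum.inl v)
  | _, .rel _ ts => ∀ i, i.val = 0 → ts i ≠ Term.var (Sum.inl v)
  | _, .imp φ ψ => OnlyAsContainer v φ ∧ OnlyAsContainer v ψ
  | _, .all φ => OnlyAsContainer v φ

/-! ### The theory `B` -/

def extensionality : Lset.Sentence :=
  (all fun x => all fun y => (all fun z => mem z x↟↟ ⇔ mem z y↟) ⟹ eq x↟ y : Fml 0)

def pairing : Lset.Sentence :=
  (all fun x => all fun y => ex fun z => isUPair z x↟↟ y↟ : Fml 0)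

def union : Lset.Sentence :=
  (all fun x => ex fun y => all fun z => mem z y↟ ⇔ exIn x↟↟ fun w => mem z↟ w : Fml 0)

def infinity : Lset.Sentence := (ex fun x => isLimit x : Fml 0)

/-- Separation for the formula `ψ(z, p₀, …, p_{m-1})`:
`∀ p₀ … p_{m-1} ∀ x ∃ y ∀ z, z ∈ y ↔ z ∈ x ∧ ψ(z, p₀, …, p_{m-1})`. -/
def separation {m : ℕ} (ψ : Lset.Formula (Fin (m + 1))) : Lset.Sentence :=
  BoundedFormula.alls (n := m) <|
    all fun x => ex fun y => all fun z => mem z y↟ ⇔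
      (mem z x↟↟ ⊓ subst ψ (Fin.cons z fun i : Fin m => i↟↟↟))

def regularity : Lset.Sentence :=
  (all fun x => nonempty x ⟹ exIn x fun y => allIn x↟ fun z => ∼(mem z y↟) : Fml 0)

/-- Every set `x` has a transitive closure: a least transitive set that includes `x`. -/
def transitiveClosure : Lset.Sentence :=
  (all fun x => ex fun y => subset x↟ y ⊓ isTrans y ⊓
    all fun z => (subset x↟↟ z ⊓ isTrans z) ⟹ subset y↟ z : Fml 0)

/-- For every `x` there is the set of all finite subsets of `x`. -/
def finitePowerset : Lset.Sentence :=
  (all fun x => ex fun p => all fun y => mem y p↟ ⇔ (subset y x↟↟ ⊓ isFinite y) : Fml 0)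

/-- The base theory `B`. -/
def B : Lset.Theory :=
  {extensionality, pairing, union, infinity, regularity, transitiveClosure, finitePowerset} ∪
    {φ | ∃ (m : ℕ) (ψ : Lset.Formula (Fin (m + 1))), IsDelta0 ψ ∧ φ = separation ψ}

/-! ### The two principles -/

/-- Every well founded tree has a bisimulation. -/
def bisimulationAxiom : Lset.Sentence :=
  (all fun T => (isTree T ⊓ isWFTree T) ⟹ ex fun b => isBisim b T↟ : Fml 0)

/-- `h = H_{≺s} = ⋃_{t ≺ s} (H_t × {t})`, where `r` is the relation `≺` and
`H_t = {u : ⟨u, t⟩ ∈ H}`. -/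
def isRestr {n : ℕ} (h H r s : Fin n) : Fml n :=
  all fun z => mem z h↟ ⇔
    ex fun t => pairMem t s↟↟ r↟↟ ⊓ ex fun u => pairMem u t↟ H↟↟↟ ⊓ isPair z↟↟ u t↟

/-- Transfinite recursion for the formula `ψ(u, v, p₀, …, p_{m-1})`: for all
`p₀, …, p_{m-1}`, all sets `a` and all well founded relations `r` on a set `X`, there is
`H ⊆ a × X` with `c ∈ H_s ↔ ψ(c, H_{≺s}, p₀, …, p_{m-1})` for all `s ∈ X` and `c ∈ a`. -/
def transRec {m : ℕ} (ψ : Lset.Formula (Fin (m + 2))) : Lset.Sentence :=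
  BoundedFormula.alls (n := m) <|
    all fun a => all fun X => all fun r => isWFRel r X↟ ⟹
      ex fun H => relBetween H a↟↟↟ X↟↟ ⊓
        allIn X↟↟ fun s => ex fun h => isRestr h H↟↟ r↟↟↟ s↟ ⊓
          allIn a↟↟↟↟↟ fun c => pairMem c s↟↟ H↟↟↟ ⇔
            subst ψ (Fin.cons c (Fin.cons h↟ fun i : Fin m => i↟↟↟↟↟↟↟))

/-- The scheme `Δ₀`-TR. -/
def Delta0TR : Lset.Theory :=
  {φ | ∃ (m : ℕ) (ψ : Lset.Formula (Fin (m + 2))),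
    IsDelta0 ψ ∧ OnlyAsContainer 1 ψ ∧ φ = transRec ψ}

end WeakSet

/-! Both implications are proved inside an arbitrary model `M` of `B`.

From recursion to bisimulations: recurse along immediate succession in the tree `T`, on the second
coordinate `t` of the pairs `⟨s, t⟩`. The recursion clause sees only the restriction of `H` to the
immediate successors of `t`, not `t` itself, so these successors have to be read off as the range of
that restriction. They all occur there because `H` turns out to be reflexive
(`exists_bisim_of_transRec`).

From bisimulations to recursion there are three stages. Graphs: a well founded relation unfolds into
the tree of its descending paths. A bisimulation of this tree depends only on the last entries of
paths, hence descends to the relation (`exists_graphBisim`). It behaves like equality of Mostowski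
collapses, although the collapses need not exist in `M` (`exists_collapse`). Games: equality of
collapses can simulate negation and infinite disjunction. A suitable graph has, for each position
`n` of a well founded game, two inequivalent nodes `a n` and `b n` standing for the two outcomes,
and a node `v n` that is bisimilar to the correct one. So the set of winning positions exists
(`exists_kernel`), that is, every well founded circuit of infinitary NAND gates can be evaluated.
Circuits: with quantifiers relativized to a sufficiently large transitive set, a `Δ₀` formula is
computed by such a circuit. The set `v` enters as a collection of inputs, which is possible because
`v` occurs only in the form `x ∈ v` (`exists_computes_formula`). One copy of the circuit for each `s
∈ X`, wired along the given relation, is again a well founded circuit, and its evaluation yields `H`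
(`Circuit.exists_iterate`).

Only `Δ₀` Separation is available, so each set that is formed and each induction needs a `Δ₀`
condition with parameters. The classes `D` and `Tm` carry out this verification. -/

namespace WeakSet

open FirstOrder.Language

set_option synthInstance.maxHeartbeats 400000
set_option synthInstance.maxSize 100000

/-! ### Renaming of variables -/

section Rename

variable {α β : Type}

lemma term_eq_var (t : Lset.Term α) : ∃ a, t = Term.var a := by
  cases t with
  | var a => exact ⟨a, rfl⟩
  | func f _ => exact f.elim

/-- Extend a renaming of variables below a quantifier. -/
def liftRen {n k : ℕ} (σ : α ⊕ Fin n → β ⊕ Fin k) : α ⊕ Fin (n + 1) → β ⊕ Fin (k + 1) :=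
  Sum.elim (fun a => Sum.map id Fin.castSucc (σ (Sum.inl a)))
    (Fin.snoc (α := fun _ => β ⊕ Fin (k + 1))
      (fun i => Sum.map id Fin.castSucc (σ (Sum.inr i))) (Sum.inr (Fin.last k)))

/-- Rename the free and bound variables of a formula. -/
def rename : ∀ {n k : ℕ}, (α ⊕ Fin n → β ⊕ Fin k) → Lset.BoundedFormula α n →
    Lset.BoundedFormula β k
  | _, _, _, .falsum => .falsum
  | _, _, σ, .equal t s => .equal (t.relabel σ) (s.relabel σ)
  | _, _, σ, .rel R ts => .rel R fun i => (ts i).relabel σ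
  | _, _, σ, .imp φ ψ => .imp (rename σ φ) (rename σ ψ)
  | _, _, σ, .all φ => .all (rename (liftRen σ) φ)

lemma liftRen_castSucc {n k : ℕ} (σ : α ⊕ Fin n → β ⊕ Fin k) (x : α ⊕ Fin n) :
    liftRen σ (Sum.map id Fin.castSucc x) = Sum.map id Fin.castSucc (σ x) := by
  cases x <;> simp [liftRen]

lemma liftRen_last {n k : ℕ} (σ : α ⊕ Fin n → β ⊕ Fin k) :
    liftRen σ (Sum.inr (Fin.last n)) = Sum.inr (Fin.last k) := by
  simp [liftRen]

/-- A lifted renaming fixes the newly bound variable and commutes with weakening, so the guard `w ∈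
x` of a bounded quantifier becomes the guard `w ∈ σ x`. -/
lemma IsDelta0.rename {n : ℕ} {φ : Lset.BoundedFormula α n} (h : IsDelta0 φ) :
    ∀ {k : ℕ} (σ : α ⊕ Fin n → β ⊕ Fin k), IsDelta0 (rename σ φ) := by
  have aux : ∀ {n k : ℕ} (σ : α ⊕ Fin n → β ⊕ Fin k) (x : α ⊕ Fin n),
      WeakSet.rename (liftRen σ) (Relations.boundedFormula₂ (L := Lset)
        (MemRel.mem : Lset.Relations 2) (&(Fin.last n)) (Term.var (Sum.map id Fin.castSucc x)))
      = Relations.boundedFormula₂ (L := Lset)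
        (MemRel.mem : Lset.Relations 2) (&(Fin.last k))
          (Term.var (Sum.map id Fin.castSucc (σ x))) := by
    intro n k σ x
    simp only [Relations.boundedFormula₂, Relations.boundedFormula, WeakSet.rename]
    congr 1
    funext i
    fin_cases i
    · simp [liftRen_last]
    · simp [liftRen_castSucc]
  induction h with
  | falsum => exact fun σ => .falsum
  | equal t s => exact fun σ => .equal _ _
  | rel R ts => exact fun σ => .rel _ _
  | imp _ _ h1 h2 => exact fun σ => .imp (h1 σ) (h2 σ)
  | ball x _ ih =>
    intro k σ
    have := IsDelta0.ball (σ x) (ih (liftRen σ))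
    rw [← aux] at this
    exact this
  | bex x _ ih =>
    intro k σ
    have := IsDelta0.bex (σ x) (ih (liftRen σ))
    rw [← aux] at this
    exact this

lemma realize_rename {M : Type} [Lset.Structure M] {n : ℕ} (φ : Lset.BoundedFormula α n) :
    ∀ {k : ℕ} (σ : α ⊕ Fin n → β ⊕ Fin k) (e : β → M) (xs : Fin k → M),
      (rename σ φ).Realize e xs ↔
        φ.Realize (fun a => Sum.elim e xs (σ (Sum.inl a)))
          (fun i => Sum.elim e xs (σ (Sum.inr i))) := by
  have aux : ∀ {n k : ℕ} (σ : α ⊕ Fin n → β ⊕ Fin k) (e : β → M) (xs : Fin k → M),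
      (Sum.elim e xs) ∘ σ = Sum.elim (fun a => Sum.elim e xs (σ (Sum.inl a)))
          (fun i => Sum.elim e xs (σ (Sum.inr i))) := by
    intro n k σ e xs
    funext x
    cases x <;> rfl
  induction φ with
  | falsum => exact fun σ e xs => Iff.rfl
  | equal t s =>
    intro k σ e xs
    simp only [rename, BoundedFormula.Realize, Term.realize_relabel, aux]
  | rel R ts =>
    intro k σ e xs
    simp only [rename, BoundedFormula.Realize, Term.realize_relabel, aux]
  | imp _ _ h1 h2 =>
    intro k σ e xs
    simp only [rename, BoundedFormula.Realize, h1, h2]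
  | all φ ih =>
    intro k σ e xs
    simp only [rename, BoundedFormula.Realize, ih]
    refine forall_congr' fun x => ?_
    have h1 : ∀ y : β ⊕ Fin k, Sum.elim e (Fin.snoc xs x : Fin (k + 1) → M)
        (Sum.map id Fin.castSucc y) = Sum.elim e xs y := by
      intro y
      cases y <;> simp
    have h2 : (fun a => Sum.elim e (Fin.snoc xs x : Fin (k + 1) → M) (liftRen σ (Sum.inl a)))
        = fun a => Sum.elim e xs (σ (Sum.inl a)) := by
      funext a
      exact h1 _
    have h3 : (fun i => Sum.elim e (Fin.snoc xs x : Fin (k + 1) → M) (liftRen σ (Sum.inr i)))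
        = Fin.snoc (fun i => Sum.elim e xs (σ (Sum.inr i))) x := by
      funext i
      refine Fin.lastCases ?_ (fun i => ?_) i
      · simp [liftRen]
      · simp [liftRen, h1]
    rw [h2, h3]

end Rename

/-! ### Finitely many parameters in a formula -/

section Support

variable {M : Type} [Lset.Structure M]

/-- Only finitely many constants occur in a formula. This lets a formula with parameters from `M` be
turned into an instance of the Separation scheme. -/
lemma exists_support {n : ℕ} (φ : Lset.BoundedFormula M n) :
    ∃ F : Finset M, ∀ e : M → M, (∀ c ∈ F, e c = c) →
      ∀ xs, φ.Realize e xs ↔ φ.Realize id xs := by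
  classical
  have aux : ∀ {n : ℕ} (t : Lset.Term (M ⊕ Fin n)), ∃ F : Finset M, ∀ e : M → M,
      (∀ c ∈ F, e c = c) → ∀ xs, t.realize (Sum.elim e xs) = t.realize (Sum.elim id xs) := by
    intro n t
    obtain ⟨a, rfl⟩ := term_eq_var t
    cases a with
    | inl c => exact ⟨{c}, fun e h xs => by simpa using h c⟩
    | inr i => exact ⟨∅, fun e h xs => by simp⟩
  induction φ with
  | falsum => exact ⟨∅, fun e _ xs => Iff.rfl⟩
  | equal t s =>
    obtain ⟨F, hF⟩ := aux t
    obtain ⟨G, hG⟩ := aux s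
    refine ⟨F ∪ G, fun e h xs => ?_⟩
    simp only [BoundedFormula.Realize]
    rw [hF e (fun c hc => h c (by simp [hc])), hG e (fun c hc => h c (by simp [hc]))]
  | rel R ts =>
    choose F hF using fun i => aux (ts i)
    refine ⟨Finset.univ.biUnion F, fun e h xs => ?_⟩
    simp only [BoundedFormula.Realize]
    have : (fun i => (ts i).realize (Sum.elim e xs)) =
        fun i => (ts i).realize (Sum.elim id xs) := by
      funext i
      exact hF i e (fun c hc => h c (by simpa using ⟨i, hc⟩)) xs
    rw [this]
  | imp _ _ h1 h2 =>
    obtain ⟨F, hF⟩ := h1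
    obtain ⟨G, hG⟩ := h2
    refine ⟨F ∪ G, fun e h xs => ?_⟩
    simp only [BoundedFormula.Realize]
    rw [hF e (fun c hc => h c (by simp [hc])), hG e (fun c hc => h c (by simp [hc]))]
  | all φ ih =>
    obtain ⟨F, hF⟩ := ih
    refine ⟨F, fun e h xs => ?_⟩
    simp only [BoundedFormula.Realize, hF e h]

end Support

/-! ### Semantics of the defined notions -/

section Semantics

variable {M : Type} [Lset.Structure M]

instance : Membership M M :=
  ⟨fun y x => Structure.RelMap (L := Lset) (MemRel.mem : Lset.Relations 2) ![x, y]⟩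

lemma relMap_mem (ts : Fin 2 → M) :
    Structure.RelMap (L := Lset) (MemRel.mem : Lset.Relations 2) ts ↔ ts 0 ∈ ts 1 := by
  have : ts = ![ts 0, ts 1] := by funext i; fin_cases i <;> rfl
  rw [this]
  rfl

/-- This and the following predicates copy the formulas even in the bracketing of conjunctions, so
that the realization lemmas hold by unfolding. -/
def IsUPair (z x y : M) : Prop := ∀ w, w ∈ z ↔ w = x ∨ w = y
def IsPr (z x y : M) : Prop := ∃ p q, (IsUPair p x x ∧ IsUPair q x y) ∧ IsUPair z p q
def PairMem (x y r : M) : Prop := ∃ z, z ∈ r ∧ IsPr z x y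
def RelBetween (r x y : M) : Prop := ∀ z, z ∈ r → ∃ u, u ∈ x ∧ ∃ w, w ∈ y ∧ IsPr z u w
def Sub (x y : M) : Prop := ∀ w, w ∈ x → w ∈ y
def Tran (x : M) : Prop := ∀ y, y ∈ x → Sub y x
def Ord (x : M) : Prop := Tran x ∧ ∀ y, y ∈ x → Tran y
def IsSc (y x : M) : Prop := ∀ w, w ∈ y ↔ w ∈ x ∨ w = x
def Lim (x : M) : Prop := (Ord x ∧ ∃ w, w ∈ x) ∧ ∀ y, y ∈ x → ∃ z, z ∈ x ∧ IsSc z y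
def IsNum (x : M) : Prop := (Ord x ∧ ¬ Lim x) ∧ ∀ y, y ∈ x → ¬ Lim y
def Fun (f x y : M) : Prop := RelBetween f x y ∧
  ∀ u, u ∈ x → ∃ v, v ∈ y ∧ PairMem u v f ∧ ∀ w, w ∈ y → PairMem u w f → w = v
def Bij (f x y : M) : Prop := (Fun f x y ∧
  ∀ u, u ∈ x → ∀ u', u' ∈ x → ∀ v, v ∈ y → PairMem u v f ∧ PairMem u' v f → u = u') ∧
  ∀ v, v ∈ y → ∃ u, u ∈ x ∧ PairMem u v f
def Fnt (y : M) : Prop := ∃ k, IsNum k ∧ ∃ f, Bij f k y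
def FinSeq (s X : M) : Prop := ∃ k, IsNum k ∧ Fun s k X
def Tree (T : M) : Prop := ∃ X, ∀ s, s ∈ T → FinSeq s X ∧ ∀ r, FinSeq r X ∧ Sub r s → r ∈ T
def ImmSucc (t s : M) : Prop := ∃ k x p, ((∀ i, i ∈ k ↔ ∃ y, PairMem i y s) ∧ IsPr p k x) ∧
  ∀ z, z ∈ t ↔ z ∈ s ∨ z = p
def WFTree (T : M) : Prop := ∀ Y, (Sub Y T ∧ ∃ w, w ∈ Y) →
  ∃ s, s ∈ Y ∧ ∀ t, t ∈ Y → ¬ ImmSucc t s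
def Bisim (B T : M) : Prop := RelBetween B T T ∧
  ∀ s, s ∈ T → ∀ t, t ∈ T → (PairMem s t B ↔
    (∀ s', s' ∈ T → ImmSucc s' s → ∃ t', t' ∈ T ∧ ImmSucc t' t ∧ PairMem s' t' B) ∧
    (∀ t', t' ∈ T → ImmSucc t' t → ∃ s', s' ∈ T ∧ ImmSucc s' s ∧ PairMem s' t' B))
def WFRel (r X : M) : Prop := RelBetween r X X ∧
  ∀ Y, (Sub Y X ∧ ∃ w, w ∈ Y) → ∃ m, m ∈ Y ∧ ∀ y, y ∈ Y → ¬ PairMem y m r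
def IsRestr (h H r s : M) : Prop := ∀ z, z ∈ h ↔
  ∃ t, PairMem t s r ∧ ∃ u, PairMem u t H ∧ IsPr z u t

variable {n : ℕ} {e : Empty → M} {xs : Fin n → M}

@[simp] lemma realize_mem' (x y : Fin n) : (mem x y).Realize e xs ↔ xs x ∈ xs y := by
  simp only [mem]
  exact BoundedFormula.realize_rel₂

@[simp] lemma realize_eq' (x y : Fin n) : (eq x y).Realize e xs ↔ xs x = xs y := by
  simp only [eq, BoundedFormula.realize_bdEqual]
  rfl

@[simp] lemma realize_all' (φ : Fin (n + 1) → Fml (n + 1)) :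
    (all φ).Realize e xs ↔ ∀ a : M, (φ (Fin.last n)).Realize e (Fin.snoc xs a) := by
  simp [all]

@[simp] lemma realize_ex' (φ : Fin (n + 1) → Fml (n + 1)) :
    (ex φ).Realize e xs ↔ ∃ a : M, (φ (Fin.last n)).Realize e (Fin.snoc xs a) := by
  simp [ex]

@[simp] lemma realize_allIn (x : Fin n) (φ : Fin (n + 1) → Fml (n + 1)) :
    (allIn x φ).Realize e xs ↔
      ∀ a : M, a ∈ xs x → (φ (Fin.last n)).Realize e (Fin.snoc xs a) := by
  simp [allIn]

@[simp] lemma realize_exIn (x : Fin n) (φ : Fin (n + 1) → Fml (n + 1)) :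
    (exIn x φ).Realize e xs ↔
      ∃ a : M, a ∈ xs x ∧ (φ (Fin.last n)).Realize e (Fin.snoc xs a) := by
  simp [exIn]

@[simp] lemma realize_subst' {k : ℕ} (ψ : Lset.Formula (Fin k)) (g : Fin k → Fin n) :
    (subst ψ g).Realize e xs ↔ ψ.Realize (fun i => xs (g i)) := by
  rw [subst, BoundedFormula.realize_relabel, Formula.Realize]
  have h1 : (Sum.elim e (xs ∘ Fin.castAdd 0) ∘ fun i => Sum.inr (g i)) = fun i => xs (g i) := by
    funext i
    rfl
  have h2 : (xs ∘ Fin.natAdd n : Fin 0 → M) = default := by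
    funext i
    exact i.elim0
  rw [h1, h2]

@[simp] lemma realize_subset (x y : Fin n) :
    (subset x y).Realize e xs ↔ Sub (xs x) (xs y) := by simp [subset, Sub]
@[simp] lemma realize_nonempty (x : Fin n) :
    (nonempty x).Realize e xs ↔ ∃ w, w ∈ xs x := by simp [nonempty]
@[simp] lemma realize_isUPair (x y z : Fin n) :
    (isUPair x y z).Realize e xs ↔ IsUPair (xs x) (xs y) (xs z) := by simp [isUPair, IsUPair]
@[simp] lemma realize_isPair (x y z : Fin n) :
    (isPair x y z).Realize e xs ↔ IsPr (xs x) (xs y) (xs z) := by simp [isPair, IsPr]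
@[simp] lemma realize_pairMem (x y z : Fin n) :
    (pairMem x y z).Realize e xs ↔ PairMem (xs x) (xs y) (xs z) := by simp [pairMem, PairMem]
@[simp] lemma realize_relBetween (x y z : Fin n) :
    (relBetween x y z).Realize e xs ↔ RelBetween (xs x) (xs y) (xs z) := by
  simp [relBetween, RelBetween]
@[simp] lemma realize_isTrans (x : Fin n) :
    (isTrans x).Realize e xs ↔ Tran (xs x) := by simp [isTrans, Tran]
@[simp] lemma realize_isOrd (x : Fin n) :
    (isOrd x).Realize e xs ↔ Ord (xs x) := by simp [isOrd, Ord]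
@[simp] lemma realize_isSucc (x y : Fin n) :
    (isSucc x y).Realize e xs ↔ IsSc (xs x) (xs y) := by simp [isSucc, IsSc]
@[simp] lemma realize_isLimit (x : Fin n) :
    (isLimit x).Realize e xs ↔ Lim (xs x) := by simp [isLimit, Lim]
@[simp] lemma realize_isNat (x : Fin n) :
    (isNat x).Realize e xs ↔ IsNum (xs x) := by simp [isNat, IsNum]
@[simp] lemma realize_isFun (f x y : Fin n) :
    (isFun f x y).Realize e xs ↔ Fun (xs f) (xs x) (xs y) := by simp [isFun, Fun]
@[simp] lemma realize_isBij (f x y : Fin n) :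
    (isBij f x y).Realize e xs ↔ Bij (xs f) (xs x) (xs y) := by simp [isBij, Bij]
@[simp] lemma realize_isFinite (x : Fin n) :
    (isFinite x).Realize e xs ↔ Fnt (xs x) := by simp [isFinite, Fnt]
@[simp] lemma realize_isFinSeq (x y : Fin n) :
    (isFinSeq x y).Realize e xs ↔ FinSeq (xs x) (xs y) := by simp [isFinSeq, FinSeq]
@[simp] lemma realize_isTree (x : Fin n) :
    (isTree x).Realize e xs ↔ Tree (xs x) := by simp [isTree, Tree]
@[simp] lemma realize_immSucc (x y : Fin n) :
    (immSucc x y).Realize e xs ↔ ImmSucc (xs x) (xs y) := by simp [immSucc, ImmSucc]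
@[simp] lemma realize_isWFTree (x : Fin n) :
    (isWFTree x).Realize e xs ↔ WFTree (xs x) := by simp [isWFTree, WFTree]
@[simp] lemma realize_isBisim (x y : Fin n) :
    (isBisim x y).Realize e xs ↔ Bisim (xs x) (xs y) := by simp [isBisim, Bisim, forth]
@[simp] lemma realize_isWFRel (x y : Fin n) :
    (isWFRel x y).Realize e xs ↔ WFRel (xs x) (xs y) := by simp [isWFRel, WFRel]
@[simp] lemma realize_isRestr (h H r s : Fin n) :
    (isRestr h H r s).Realize e xs ↔ IsRestr (xs h) (xs H) (xs r) (xs s) := by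
  simp [isRestr, IsRestr]

lemma models_bisimulationAxiom :
    M ⊨ bisimulationAxiom ↔ ∀ T : M, Tree T → WFTree T → ∃ b, Bisim b T := by
  have : M ⊨ bisimulationAxiom ↔
      BoundedFormula.Realize bisimulationAxiom (default : Empty → M) default := Iff.rfl
  have h0 : ∀ a : M, (Fin.snoc default a : Fin 1 → M) 0 = a := fun a => rfl
  have h1 : ∀ a b : M, (Fin.snoc (Fin.snoc default a : Fin 1 → M) b : Fin 2 → M) 1 = b :=
    fun a b => rfl
  rw [this, bisimulationAxiom]
  simp [h0, h1]

lemma models_transRec {m : ℕ} (ψ : Lset.Formula (Fin (m + 2))) :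
    M ⊨ transRec ψ ↔ ∀ (p : Fin m → M) (a X r : M), WFRel r X →
      ∃ H, RelBetween H a X ∧ ∀ s, s ∈ X → ∃ h, IsRestr h H r s ∧
        ∀ c, c ∈ a → (PairMem c s H ↔ ψ.Realize (Fin.cons c (Fin.cons h p))) := by
  have : M ⊨ transRec ψ ↔ Formula.Realize (transRec ψ) (default : Empty → M) := Iff.rfl
  have h1 : ∀ {k : ℕ} (q : Fin k → M) (a b : Fin k) (g : Fin m → Fin k),
    (fun i => q ((Fin.cons a (Fin.cons b g) : Fin (m + 2) → Fin k) i)) =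
      Fin.cons (q a) (Fin.cons (q b) fun i => q (g i)) := by
    intro k q a b g
    funext i
    refine Fin.cases rfl (fun i => Fin.cases rfl (fun i => rfl) i) i
  rw [this, transRec, BoundedFormula.realize_alls]
  simp [h1]

lemma models_separation {m : ℕ} (ψ : Lset.Formula (Fin (m + 1))) :
    M ⊨ separation ψ ↔ ∀ (p : Fin m → M) (x : M), ∃ y : M, ∀ z : M, z ∈ y ↔
      z ∈ x ∧ ψ.Realize (Fin.cons z p) := by
  have : M ⊨ separation ψ ↔ Formula.Realize (separation ψ) (default : Empty → M) := Iff.rfl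
  have h1 : ∀ {k : ℕ} (q : Fin k → M) (a : Fin k) (g : Fin m → Fin k),
    (fun i => q ((Fin.cons a g : Fin (m + 1) → Fin k) i)) =
      Fin.cons (q a) (fun i => q (g i)) := by
    intro k q a g
    funext i
    refine Fin.cases rfl (fun i => rfl) i
  rw [this, separation, BoundedFormula.realize_alls]
  simp [h1]

end Semantics

/-! ### Definability by `Δ₀` formulas with parameters -/

section Definability

variable {M : Type}

/-- A context: a type that codes assignments of elements of `M` to finitely many variables. -/
class Cx (M Γ : Type) where
  n : ℕ
  e : Γ → Fin n → M

/-- Contexts `((Unit × M) × ⋯) × M` are de Bruijn contexts: each bounded quantifier adds a factor.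
With the instances below, instance search proves that a predicate is `Δ₀` by recursion on its shape.
-/
instance : Cx M Unit := ⟨0, fun _ => Fin.elim0⟩

instance {Γ : Type} [c : Cx M Γ] : Cx M (Γ × M) := ⟨c.n + 1, fun γ => Fin.snoc (c.e γ.1) γ.2⟩

variable (M) in
/-- A map of contexts that only drops and renames variables. -/
class Pr {Γ Δ : Type} [Cx M Γ] [Cx M Δ] (f : Γ → Δ) : Prop where
  out : ∃ j : Fin (Cx.n M Δ) → Fin (Cx.n M Γ), ∀ γ i, Cx.e (f γ) i = (Cx.e γ (j i) : M)

lemma Pr.comp {M Γ Δ Θ : Type} [Cx M Γ] [Cx M Δ] [Cx M Θ] {g : Δ → Θ} {f : Γ → Δ} (hg : Pr M g) (hf : Pr M f) :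
    Pr M fun γ => g (f γ) := by
  obtain ⟨j, hj⟩ := hf
  obtain ⟨k, hk⟩ := hg
  exact ⟨fun i => j (k i), fun γ i => by rw [hk, hj]⟩

variable [Lset.Structure M]

variable (M) in
/-- `P` is defined by a `Δ₀` formula with parameters from `M`. -/
class D {Γ : Type} [Cx M Γ] (P : Γ → Prop) : Prop where
  out : ∃ φ : Lset.BoundedFormula M (Cx.n M Γ), IsDelta0 φ ∧
    ∀ γ, φ.Realize id (Cx.e γ) ↔ P γ

/-- A function `f` such that quantification over the elements of `f γ` preserves definability. -/
class Tm {Γ : Type} [Cx M Γ] (f : Γ → M) : Prop where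
  out : ∀ {Δ : Type} [Cx M Δ] (π : Δ → Γ), Pr M π → ∀ P : Δ × M → Prop, D M P →
    D M fun δ => ∀ z, z ∈ f (π δ) → P (δ, z)

variable {Γ Δ : Type} [Cx M Γ] [Cx M Δ]

instance Pr.id : Pr M fun γ : Γ => γ := ⟨fun i => i, fun _ _ => rfl⟩

instance Pr.fst (f : Γ → Δ × M) [h : Pr M f] : Pr M fun γ => (f γ).1 := by
  obtain ⟨j, hj⟩ := h
  refine ⟨fun i => j i.castSucc, fun γ i => ?_⟩
  rw [← hj]
  simp [Cx.e]

/-- Immediate because `Tm` speaks of all contexts lying over `Γ`. This is what allows a bound to be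
used below further quantifiers. -/
lemma Tm.comp {f : Δ → M} {π : Γ → Δ} (hf : Tm f) (hπ : Pr M π) : Tm fun γ => f (π γ) :=
  ⟨fun ρ hρ P hP => hf.out (fun δ => π (ρ δ)) (hπ.comp hρ) P hP⟩

lemma D.congr {P Q : Γ → Prop} (hP : D M P) (h : ∀ γ, Q γ ↔ P γ) : D M Q := by
  have : Q = P := funext fun γ => propext (h γ)
  rwa [this]

lemma D.comp {P : Δ → Prop} {π : Γ → Δ} (hP : D M P) (hπ : Pr M π) : D M fun γ => P (π γ) := by
  obtain ⟨φ, hφ, h⟩ := hP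
  obtain ⟨j, hj⟩ := hπ
  refine ⟨rename (Sum.map (fun c => c) j) φ, hφ.rename _, fun γ => ?_⟩
  rw [realize_rename, ← h]
  have : Cx.e (π γ) = fun i => Sum.elim _root_.id (Cx.e γ) (Sum.map (fun c : M => c) j (Sum.inr i))
    := funext fun i => hj γ i
  rw [this]
  rfl

instance D.false : D M fun _ : Γ => False := ⟨.falsum, .falsum, fun _ => Iff.rfl⟩

instance D.imp (P Q : Γ → Prop) [hP : D M P] [hQ : D M Q] : D M fun γ => P γ → Q γ := by
  obtain ⟨φ, hφ, h⟩ := hP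
  obtain ⟨ψ, hψ, h'⟩ := hQ
  exact ⟨φ.imp ψ, .imp hφ hψ, fun γ => by simp [h, h']⟩

instance D.not (P : Γ → Prop) [hP : D M P] : D M fun γ => ¬ P γ := D.imp P _

instance D.and (P Q : Γ → Prop) [hP : D M P] [hQ : D M Q] : D M fun γ => P γ ∧ Q γ :=
  (D.not fun γ => P γ → ¬ Q γ).congr fun γ => by tauto

instance D.or (P Q : Γ → Prop) [hP : D M P] [hQ : D M Q] : D M fun γ => P γ ∨ Q γ :=
  (D.imp (fun γ => ¬ P γ) Q).congr fun γ => by tauto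

instance D.ball (f : Γ → M) (P : Γ → M → Prop) [hf : Tm f] [hP : D M fun γ : Γ × M => P γ.1 γ.2] :
    D M fun γ => ∀ z, z ∈ f γ → P γ z := hf.out (fun γ => γ) Pr.id _ hP

instance D.bex (f : Γ → M) (P : Γ → M → Prop) [hf : Tm f] [hP : D M fun γ : Γ × M => P γ.1 γ.2] :
    D M fun γ => ∃ z, z ∈ f γ ∧ P γ z :=
  (D.not fun γ => ∀ z, z ∈ f γ → ¬ P γ z).congr fun γ => by simp

lemma realize_ball {α : Type} {n : ℕ} (x : α ⊕ Fin n) (φ : Lset.BoundedFormula α (n + 1))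
    (e : α → M) (xs : Fin n → M) :
    (∀' (Relations.boundedFormula₂ (L := Lset) (MemRel.mem : Lset.Relations 2)
        (&(Fin.last n)) (Term.var (Sum.map id Fin.castSucc x)) ⟹ φ)).Realize e xs ↔
      ∀ z, z ∈ Sum.elim e xs x → φ.Realize e (Fin.snoc xs z) := by
  rw [BoundedFormula.realize_all]
  refine forall_congr' fun z => ?_
  rw [BoundedFormula.realize_imp]
  refine imp_congr (BoundedFormula.realize_rel₂.trans (relMap_mem _)) Iff.rfl |>.trans ?_
  have : Sum.elim e (Fin.snoc xs z : Fin (n + 1) → M) (Sum.map id Fin.castSucc x) =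
      Sum.elim e xs x := by cases x <;> simp
  simp [this]

lemma D.ball_var (x : M ⊕ Fin (Cx.n M Γ)) {P : Γ × M → Prop} (hP : D M P) :
    D M fun γ => ∀ z, z ∈ Sum.elim id (Cx.e γ) x → P (γ, z) := by
  obtain ⟨φ, hφ, h⟩ := hP
  exact ⟨_, .ball x hφ, fun γ => by rw [realize_ball]; simp only [← h]; rfl⟩

instance Tm.const (c : M) : Tm fun _ : Γ => c :=
  ⟨fun _ _ _ hP => D.ball_var (Sum.inl c) hP⟩

lemma Tm.var (i : Fin (Cx.n M Γ)) : Tm fun γ : Γ => (Cx.e γ i : M) := by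
  refine ⟨fun π hπ P hP => ?_⟩
  obtain ⟨j, hj⟩ := hπ
  refine (D.ball_var (Sum.inr (j i)) hP).congr fun γ => ?_
  rw [hj]
  rfl

instance Tm.snd (f : Γ → Δ × M) [h : Pr M f] : Tm fun γ => (f γ).2 := by
  have := (Tm.var (M := M) (Γ := Δ × M) (Fin.last _)).comp h
  simpa [Cx.e] using this

lemma D.eq_var (i j : Fin (Cx.n M Γ)) : D M fun γ : Γ => (Cx.e γ i : M) = Cx.e γ j :=
  ⟨.equal (&i) (&j), .equal _ _, fun _ => Iff.rfl⟩

variable (M) in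
def Extensional : Prop := ∀ x y : M, (∀ z, z ∈ x ↔ z ∈ y) → x = y

/-- Extensionality turns the equation into two bounded quantifiers. Membership of `y` in `t γ` is
expressed as `∃ z ∈ t γ, y = z`, so that only equality of variables is needed as an atomic formula.
-/
lemma D.eq_of_ext (hM : Extensional M) {s t : Γ → M} (hs : Tm s) (ht : Tm t) :
    D M fun γ => s γ = t γ := by
  have h : D M fun γ : (Γ × M) × M => γ.1.2 = γ.2 := by
    have := D.eq_var (M := M) (Γ := (Γ × M) × M) (Fin.last _).castSucc (Fin.last _)
    simpa [Cx.e] using this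
  have hs' : Tm fun γ : Γ × M => s γ.1 := hs.comp inferInstance
  have ht' : Tm fun γ : Γ × M => t γ.1 := ht.comp inferInstance
  have h2 : D M fun γ : Γ × M => ∃ z, z ∈ s γ.1 ∧ γ.2 = z := D.bex (fun γ : Γ × M => s γ.1) _
  have h3 : D M fun γ : Γ × M => ∃ z, z ∈ t γ.1 ∧ γ.2 = z := D.bex (fun γ : Γ × M => t γ.1) _
  have h4 : D M fun γ => (∀ y, y ∈ s γ → ∃ z, z ∈ t γ ∧ y = z) ∧
      (∀ y, y ∈ t γ → ∃ z, z ∈ s γ ∧ y = z) := inferInstance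
  refine h4.congr fun γ => ?_
  constructor
  · intro h
    simp [h]
  · rintro ⟨h, h'⟩
    refine hM _ _ fun z => ⟨fun hz => ?_, fun hz => ?_⟩
    · obtain ⟨w, hw, rfl⟩ := h z hz
      exact hw
    · obtain ⟨w, hw, rfl⟩ := h' z hz
      exact hw

lemma D.mem_of_ext (hM : Extensional M) {s t : Γ → M} (hs : Tm s) (ht : Tm t) :
    D M fun γ => s γ ∈ t γ := by
  have h : D M fun γ : Γ × M => s γ.1 = γ.2 :=
    D.eq_of_ext hM (hs.comp inferInstance) inferInstance
  have : D M fun γ => ∃ z, z ∈ t γ ∧ s γ = z := inferInstance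
  exact this.congr fun γ => by simp

/-- Substitution of terms into a `Δ₀` formula: the two preceding lemmas settle atomic formulas, and
a substituted term is an admissible bound by the definition of `Tm`. -/
lemma D.realize_of_ext (hM : Extensional M) {n : ℕ} {φ : Lset.BoundedFormula M n}
    (hφ : IsDelta0 φ) : ∀ {Γ : Type} [Cx M Γ] (t : Fin n → Γ → M), (∀ i, Tm (t i)) →
      D M fun γ => φ.Realize id fun i => t i γ := by
  have aux : ∀ {n : ℕ} {Γ : Type} [Cx M Γ] (t : Fin n → Γ → M), (∀ i, Tm (t i)) →
      ∀ s : Lset.Term (M ⊕ Fin n), Tm fun γ => s.realize (Sum.elim id fun i => t i γ) := by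
    intro n Γ _ t ht s
    obtain ⟨a, rfl⟩ := term_eq_var s
    cases a with
    | inl c => exact Tm.const c
    | inr i => exact ht i
  have auxb : ∀ {n : ℕ} (x : M ⊕ Fin n) {φ : Lset.BoundedFormula M (n + 1)},
      (∀ {Γ : Type} [Cx M Γ] (t : Fin (n + 1) → Γ → M), (∀ i, Tm (t i)) →
        D M fun γ => φ.Realize id fun i => t i γ) →
      ∀ {Γ : Type} [Cx M Γ] (t : Fin n → Γ → M), (∀ i, Tm (t i)) →
      D M fun γ => ∀ z, z ∈ Sum.elim id (fun i => t i γ) x →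
        φ.Realize id (Fin.snoc (fun i => t i γ) z) := by
    intro n x φ ih Γ _ t ht
    have h1 : Tm fun γ => Sum.elim id (fun i => t i γ) x := aux t ht (Term.var x)
    have h2 := ih (Γ := Γ × M) (Fin.snoc (α := fun _ => Γ × M → M) (fun i γ => t i γ.1)
      fun γ => γ.2) (fun i => by
        refine Fin.lastCases ?_ (fun i => ?_) i
        · simp only [Fin.snoc_last]
          infer_instance
        · simp only [Fin.snoc_castSucc]
          exact (ht i).comp inferInstance)
    have h3 : D M fun γ : Γ × M => φ.Realize id (Fin.snoc (fun i => t i γ.1) γ.2) := by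
      refine h2.congr fun γ => ?_
      have : (Fin.snoc (fun i => t i γ.1) γ.2 : Fin (n + 1) → M) = fun i =>
          (Fin.snoc (α := fun _ => Γ × M → M) (fun i γ => t i γ.1) fun γ => γ.2 :
            Fin (n + 1) → Γ × M → M) i γ := by
        funext i
        refine Fin.lastCases ?_ (fun i => ?_) i <;> simp
      rw [this]
    exact D.ball _ _
  induction hφ with
  | falsum => exact fun t ht => D.false
  | equal t₁ t₂ => exact fun t ht => D.eq_of_ext hM (aux t ht t₁) (aux t ht t₂)
  | rel R ts =>
    intro Γ _ t ht
    cases R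
    refine (D.mem_of_ext hM (aux t ht (ts 0)) (aux t ht (ts 1))).congr fun γ => ?_
    exact relMap_mem _
  | imp _ _ h1 h2 =>
    intro Γ _ t ht
    have := h1 t ht
    have := h2 t ht
    exact D.imp _ _
  | ball x _ ih =>
    intro Γ _ t ht
    exact (auxb x ih t ht).congr fun γ => realize_ball _ _ _ _
  | @bex _ x φ h ih =>
    intro Γ _ t ht
    have h1 := auxb x (φ := φ.imp .falsum) (fun t ht => by
      have := ih t ht
      exact D.imp _ _ (hQ := D.false)) t ht
    refine (D.not (hP := h1)).congr fun γ => ?_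
    rw [← realize_ball]
    simp [BoundedFormula.Realize]

lemma D.sub_of_ext (hM : Extensional M) {P : Γ × M → Prop} (hP : D M P) {s : Γ → M} (hs : Tm s) :
    D M fun γ => P (γ, s γ) := by
  obtain ⟨φ, hφ, h⟩ := hP
  have := D.realize_of_ext hM hφ (Fin.snoc (α := fun _ => Γ → M) (fun i γ => Cx.e γ i) s)
    (fun i => by
      refine Fin.lastCases ?_ (fun i => ?_) i
      · simpa using hs
      · simpa using Tm.var i)
  refine this.congr fun γ => ?_
  rw [← h]
  have : (Cx.e (γ, s γ) : Fin (Cx.n M (Γ × M)) → M) = fun i =>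
    (Fin.snoc (α := fun _ => Γ → M) (fun i γ => Cx.e γ i) s :
      Fin (Cx.n M Γ + 1) → Γ → M) i γ := by
    funext i
    refine Fin.lastCases ?_ (fun i => ?_) i <;> simp [Cx.e]
  rw [this]
  exact Iff.rfl

end Definability

/-! ### Basic set theory in models of `B` -/

section Models

variable {M : Type}

lemma snoc0 (a : M) : (Fin.snoc default a : Fin 1 → M) 0 = a := rfl

lemma snoc1 (a b : M) : (Fin.snoc (Fin.snoc default a : Fin 1 → M) b : Fin 2 → M) 1 = b := rfl

lemma snoc2 (a b c : M) : (Fin.snoc (Fin.snoc (Fin.snoc default a : Fin 1 → M) b : Fin 2 → M) c :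
  Fin 3 → M) 2 = c := rfl

lemma snoc3 (a b c : M) : (Fin.snoc (Fin.snoc (Fin.snoc default a : Fin 1 → M) b : Fin 2 → M) c :
  Fin 3 → M) 1 = b := rfl

variable [Lset.Structure M]

lemma realize_default {φ : Lset.Sentence} (h : M ⊨ φ) :
    BoundedFormula.Realize φ (default : Empty → M) default := h

/-- An operation is an admissible bound as soon as quantification over its elements can be rewritten
as a condition `Q` that preserves definability. -/
lemma Tm.of_congr {Γ : Type} [Cx M Γ] {f : Γ → M}
    (Q : {Δ : Type} → [Cx M Δ] → (Δ → Γ) → (Δ × M → Prop) → Δ → Prop)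
    (h : ∀ {Δ : Type} [Cx M Δ] (π : Δ → Γ) (P : Δ × M → Prop) (δ : Δ),
      (∀ z, z ∈ f (π δ) → P (δ, z)) ↔ Q π P δ)
    (hQ : ∀ {Δ : Type} [Cx M Δ] (π : Δ → Γ) (P : Δ × M → Prop), Pr M π → D M P → D M (Q π P)) :
    Tm f := ⟨fun π hπ P hP => (hQ π P hπ hP).congr fun δ => h π P δ⟩

lemma Tm.weaken {Γ : Type} [Cx M Γ] (s : Γ → M) [hs : Tm s] {Δ : Type} [Cx M Δ] (π : Δ → Γ)
    [hπ : Pr M π] : Tm fun δ => s (π δ) := hs.comp hπ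

instance D.nonempty {Γ : Type} [Cx M Γ] (s : Γ → M) [Tm s] : D M fun γ => ∃ w, w ∈ s γ := by
  have : D M fun γ => ∃ w, w ∈ s γ ∧ ¬ False := inferInstance
  exact this.congr fun γ => by simp

lemma Ord.mem {x y : M} (hx : Ord x) (hy : y ∈ x) : Ord y :=
  ⟨hx.2 y hy, fun z hz => hx.2 z (hx.1 y hy z hz)⟩

lemma IsNum.mem {x y : M} (hx : IsNum x) (hy : y ∈ x) : IsNum y :=
  ⟨⟨hx.1.1.mem hy, hx.2 y hy⟩, fun z hz => hx.2 z (hx.1.1.1 y hy z hz)⟩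

variable [hB : Theory.Model M B]

lemma realize_axiom {φ : Lset.Sentence} (h : φ ∈ B) : M ⊨ φ :=
  Theory.realize_sentence_of_mem B h

lemma ext_axiom : Extensional M := by
  have := realize_default (M := M) (realize_axiom (φ := extensionality) (by simp [B]))
  simpa [Extensional, extensionality, snoc0, snoc1, snoc2, snoc3] using this

lemma ext {x y : M} (h : ∀ z, z ∈ x ↔ z ∈ y) : x = y := ext_axiom x y h

lemma exists_upair (x y : M) : ∃ z, IsUPair z x y := by
  have := realize_default (M := M) (realize_axiom (φ := pairing) (by simp [B]))
  simp [pairing, snoc0] at this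
  exact this x y

lemma exists_sUnion (x : M) : ∃ y : M, ∀ z, z ∈ y ↔ ∃ w, w ∈ x ∧ z ∈ w := by
  have := realize_default (M := M) (realize_axiom (φ := union) (by simp [B]))
  simp [union, snoc0] at this
  exact this x

lemma exists_lim : ∃ x : M, Lim x := by
  have := realize_default (M := M) (realize_axiom (φ := infinity) (by simp [B]))
  simpa [infinity, snoc0] using this

lemma exists_min' (x : M) (h : ∃ w, w ∈ x) : ∃ y, y ∈ x ∧ ∀ z, z ∈ x → z ∉ y := by
  have := realize_default (M := M) (realize_axiom (φ := regularity) (by simp [B]))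
  simp [regularity, snoc0] at this
  exact this x _ h.choose_spec

lemma exists_tc (x : M) : ∃ y, Sub x y ∧ Tran y := by
  have := realize_default (M := M) (realize_axiom (φ := transitiveClosure) (by simp [B]))
  simp [transitiveClosure, snoc0, snoc1] at this
  obtain ⟨y, h, _⟩ := this x
  exact ⟨y, h⟩

lemma exists_fpow (x : M) : ∃ p : M, ∀ y, y ∈ p ↔ Sub y x ∧ Fnt y := by
  have := realize_default (M := M) (realize_axiom (φ := finitePowerset) (by simp [B]))
  simp [finitePowerset, snoc0] at this
  exact this x

lemma exists_sep (P : M → Prop) [hP : D M fun γ : Unit × M => P γ.2] (x : M) :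
    ∃ y : M, ∀ z, z ∈ y ↔ z ∈ x ∧ P z := by
  classical
  obtain ⟨φ, hφ, h⟩ := hP
  obtain ⟨F, hF⟩ := exists_support φ
  let p : Fin F.card → M := fun i => F.equivFin.symm i
  -- Index `0` is the separated element and the successors are the parameters. Constants outside the
  -- support `F` also go to `0`, a junk value that does not affect truth.
  let σ : M ⊕ Fin 1 → Fin (F.card + 1) ⊕ Fin 0 :=
    Sum.elim (fun c => Sum.inl (if hc : c ∈ F then (F.equivFin ⟨c, hc⟩).succ else 0))
      fun _ => Sum.inl 0
  have h1 := models_separation (M := M) (rename σ φ)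
  have h2 : M ⊨ separation (rename σ φ) :=
    realize_axiom (Or.inr ⟨_, _, hφ.rename σ, rfl⟩)
  obtain ⟨y, hy⟩ := h1.1 h2 p x
  refine ⟨y, fun z => ?_⟩
  have h3 : (rename σ φ).Realize (Fin.cons z p : Fin (F.card + 1) → M) default ↔ P z := by
    rw [realize_rename, hF, ← h ((), z)]
    · have : (fun i => Sum.elim (Fin.cons z p : Fin (F.card + 1) → M) default (σ (Sum.inr i))) =
          (Cx.e (M := M) ((), z) : Fin 1 → M) := by
        funext i
        have : i = Fin.last 0 := Subsingleton.elim _ _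
        subst this
        simp only [Cx.e, σ, Sum.elim_inr, Sum.elim_inl, Fin.cons_zero]
        rfl
      rw [this]
    · intro c hc
      simp [σ, hc, p]
  rw [hy z, ← h3]
  exact Iff.rfl

section Instances

variable {Γ : Type} [Cx M Γ]

instance D.eq (s t : Γ → M) [hs : Tm s] [ht : Tm t] : D M fun γ => s γ = t γ :=
  D.eq_of_ext ext_axiom hs ht

instance D.mem (s t : Γ → M) [hs : Tm s] [ht : Tm t] : D M fun γ => s γ ∈ t γ :=
  D.mem_of_ext ext_axiom hs ht

lemma D.sub (P : Γ → M → Prop) [hP : D M fun γ : Γ × M => P γ.1 γ.2] {s : Γ → M} (hs : Tm s) :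
    D M fun γ => P γ (s γ) := D.sub_of_ext ext_axiom hP hs

end Instances

/-- `{z ∈ x | P z}` -/
noncomputable def sep (x : M) (P : M → Prop) [D M fun γ : Unit × M => P γ.2] : M :=
  (exists_sep P x).choose

@[simp] lemma mem_sep {x : M} {P : M → Prop} [D M fun γ : Unit × M => P γ.2] {z : M} :
    z ∈ sep x P ↔ z ∈ x ∧ P z := (exists_sep P x).choose_spec z

variable (M) in
noncomputable def emp : M := sep (exists_lim (M := M)).choose fun _ => False

@[simp] lemma not_mem_emp (x : M) : x ∉ emp M := by simp [emp]

noncomputable def upair (x y : M) : M := (exists_upair x y).choose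

@[simp] lemma mem_upair {x y z : M} : z ∈ upair x y ↔ z = x ∨ z = y :=
  (exists_upair x y).choose_spec z

noncomputable def sing (x : M) : M := upair x x

@[simp] lemma mem_sing {x z : M} : z ∈ sing x ↔ z = x := by simp [sing]

noncomputable def sUn (x : M) : M := (exists_sUnion x).choose

@[simp] lemma mem_sUn {x z : M} : z ∈ sUn x ↔ ∃ w, w ∈ x ∧ z ∈ w :=
  (exists_sUnion x).choose_spec z

noncomputable def un (x y : M) : M := sUn (upair x y)

@[simp] lemma mem_un {x y z : M} : z ∈ un x y ↔ z ∈ x ∨ z ∈ y := by simp [un]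

/-- The Kuratowski pair. -/
noncomputable def pr (x y : M) : M := upair (sing x) (upair x y)

/-- `x ∪ {x}` -/
noncomputable def sc (x : M) : M := un x (sing x)

@[simp] lemma mem_sc {x z : M} : z ∈ sc x ↔ z ∈ x ∨ z = x := by simp [sc]

lemma isUPair_iff {x y z : M} : IsUPair z x y ↔ z = upair x y := by
  constructor
  · intro h
    exact ext fun w => by simp [h w]
  · rintro rfl w
    simp

@[simp] lemma isPr_iff {x y z : M} : IsPr z x y ↔ z = pr x y := by
  simp [IsPr, isUPair_iff, pr, sing]

@[simp] lemma pairMem_iff {x y r : M} : PairMem x y r ↔ pr x y ∈ r := by simp [PairMem]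

@[simp] lemma isSc_iff {x y : M} : IsSc y x ↔ y = sc x := by
  constructor
  · intro h
    exact ext fun w => by simp [h w]
  · rintro rfl w
    simp

lemma upair_inj_right {x y z : M} (h : upair x y = upair x z) : y = z := by
  have h1 : y ∈ upair x z := by simp [← h]
  have h2 : z ∈ upair x y := by simp [h]
  simp only [mem_upair] at h1 h2
  grind

@[simp] lemma pr_inj {x y x' y' : M} : pr x y = pr x' y' ↔ x = x' ∧ y = y' := by
  constructor
  · intro h
    have h1 : sing x ∈ pr x' y' := h ▸ by simp [pr]
    have hx : x = x' := by
      simp only [pr, mem_upair] at h1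
      rcases h1 with h1 | h1
      · have : x ∈ sing x' := by simp [← h1]
        simpa using this
      · have : x' ∈ sing x := by simp [h1]
        exact (mem_sing.1 this).symm
    subst hx
    exact ⟨rfl, upair_inj_right (upair_inj_right h)⟩
  · rintro ⟨rfl, rfl⟩
    rfl

section Instances

variable {Γ : Type} [Cx M Γ]

instance Tm.upair (s t : Γ → M) [hs : Tm s] [ht : Tm t] : Tm fun γ => upair (s γ) (t γ) := by
  refine Tm.of_congr (fun π P δ => P (δ, s (π δ)) ∧ P (δ, t (π δ))) (fun π P δ => by simp)
    fun π P hπ hP => ?_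
  have h1 := D.sub_of_ext ext_axiom hP (hs.comp hπ)
  have h2 := D.sub_of_ext ext_axiom hP (ht.comp hπ)
  infer_instance

instance Tm.sUn (s : Γ → M) [hs : Tm s] : Tm fun γ => sUn (s γ) := by
  refine Tm.of_congr (fun π P δ => ∀ y, y ∈ s (π δ) → ∀ z, z ∈ y → P (δ, z))
    (fun π P δ => by simp; grind) fun π P hπ hP => ?_
  have h1 := hs.comp hπ
  have h2 : D M fun γ : (_ × M) × M => P (γ.1.1, γ.2) := by
    refine hP.comp (π := fun γ : (_ × M) × M => (γ.1.1, γ.2)) ?_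
    refine ⟨Fin.lastCases (Fin.last _) fun i => i.castSucc.castSucc, fun γ i => ?_⟩
    refine Fin.lastCases ?_ (fun i => ?_) i <;> simp [Cx.e]
  infer_instance

instance Tm.sing (s : Γ → M) [hs : Tm s] : Tm fun γ => sing (s γ) := Tm.upair s s

instance Tm.un (s t : Γ → M) [hs : Tm s] [ht : Tm t] : Tm fun γ => un (s γ) (t γ) := Tm.sUn _

instance Tm.pr (s t : Γ → M) [hs : Tm s] [ht : Tm t] : Tm fun γ => pr (s γ) (t γ) := Tm.upair _ _

instance Tm.sc (s : Γ → M) [hs : Tm s] : Tm fun γ => sc (s γ) := Tm.un _ _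

end Instances

/-! ### Well foundedness of membership -/

lemma exists_min (x : M) {P : M → Prop} [D M fun γ : Unit × M => P γ.2] (h : ∃ w, w ∈ x ∧ P w) :
    ∃ y, y ∈ x ∧ P y ∧ ∀ z, z ∈ x → P z → z ∉ y := by
  obtain ⟨w, hw⟩ := h
  obtain ⟨y, hy, h⟩ := exists_min' (sep x P) ⟨w, by simpa using hw⟩
  simp only [mem_sep] at hy h
  exact ⟨y, hy.1, hy.2, fun z hz hPz => h z ⟨hz, hPz⟩⟩

/-- Regularity speaks of sets, so a minimal counterexample is sought in a transitive set that
contains `x`; `Δ₀` Separation makes the counterexamples there a set. -/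
lemma mem_induction {P : M → Prop} [D M fun γ : Unit × M => P γ.2]
    (h : ∀ x, (∀ y, y ∈ x → P y) → P x) (x : M) : P x := by
  obtain ⟨t, ht, htr⟩ := exists_tc (sing x)
  by_contra hx
  obtain ⟨y, hy, hPy, hmin⟩ := exists_min t (P := fun z => ¬ P z) ⟨x, ht x (by simp), hx⟩
  exact hPy (h y fun z hz => by_contra fun hPz => hmin z (htr y hy z hz) hPz hz)

lemma mem_irrefl (x : M) : x ∉ x := by
  intro h
  obtain ⟨y, hy, hm⟩ := exists_min' (sing x) ⟨x, by simp⟩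
  simp only [mem_sing] at hy hm
  subst hy
  exact hm y rfl h

lemma mem_asymm {x y : M} (h : x ∈ y) : y ∉ x := by
  intro h'
  obtain ⟨z, hz, hm⟩ := exists_min' (upair x y) ⟨x, by simp⟩
  simp only [mem_upair] at hz hm
  rcases hz with rfl | rfl
  · exact hm y (Or.inr rfl) h'
  · exact hm x (Or.inl rfl) h

lemma sc_inj {x y : M} (h : sc x = sc y) : x = y := by
  have h1 : x ∈ sc y := by simp [← h]
  have h2 : y ∈ sc x := by simp [h]
  simp only [mem_sc] at h1 h2
  rcases h1 with h1 | h1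
  · rcases h2 with h2 | h2
    · exact absurd h2 (mem_asymm h1)
    · exact h2.symm
  · exact h1

/-! ### Natural numbers -/

/-- Choose `x` minimal among the elements incomparable with something, then `y` minimal among those
incomparable with `x`. Minimality forces `x` and `y` to have the same elements. -/
lemma Ord.trichotomy {α : M} (h : Ord α) {x y : M} (hx : x ∈ α) (hy : y ∈ α) :
    x ∈ y ∨ x = y ∨ y ∈ x := by
  by_contra hne
  obtain ⟨x, hx, ⟨y', hy', hne'⟩, hmx⟩ := exists_min α
    (P := fun x => ∃ y, y ∈ α ∧ ¬ (x ∈ y ∨ x = y ∨ y ∈ x)) ⟨x, hx, y, hy, hne⟩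
  obtain ⟨y, hy, hxy, hmy⟩ := exists_min α
    (P := fun y => ¬ (x ∈ y ∨ x = y ∨ y ∈ x)) ⟨y', hy', hne'⟩
  refine hxy (Or.inr (Or.inl (ext fun z => ⟨fun hz => ?_, fun hz => ?_⟩)))
  · have hzα := h.1 x hx z hz
    by_contra hzy
    refine hmx z hzα ⟨y, hy, ?_⟩ hz
    rintro (h1 | rfl | h1)
    · exact hzy h1
    · exact hxy (Or.inr (Or.inr hz))
    · exact hxy (Or.inr (Or.inr (h.2 x hx z hz y h1)))
  · have hzα := h.1 y hy z hz
    by_contra hzx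
    refine hmy z hzα ?_ hz
    rintro (h1 | rfl | h1)
    · exact hxy (Or.inl (h.2 y hy z hz x h1))
    · exact hxy (Or.inl hz)
    · exact hzx h1

/-- Otherwise a minimal element of `y` outside `sc u` would have exactly the elements of `sc u`, and
so `sc u` would belong to `y`. -/
lemma Ord.eq_sc {y u : M} (hy : Ord y) (hu : u ∈ y) (h : sc u ∉ y) : y = sc u := by
  have hsub : Sub (sc u) y := by
    intro w hw
    simp only [mem_sc] at hw
    rcases hw with hw | rfl
    · exact hy.1 u hu w hw
    · exact hu
  refine ext fun w => ⟨fun hw => ?_, fun hw => hsub w hw⟩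
  by_contra hwu
  obtain ⟨w, hw, hwu, hmin⟩ := exists_min y (P := fun w => w ∉ sc u) ⟨w, hw, hwu⟩
  refine h ?_
  have hwu' := hwu
  simp only [mem_sc, not_or] at hwu'
  have huw : u ∈ w := by
    rcases hy.trichotomy hw hu with h1 | h1 | h1
    · exact absurd h1 hwu'.1
    · exact absurd h1 hwu'.2
    · exact h1
  have : w = sc u := by
    refine ext fun z => ⟨fun hz => ?_, fun hz => ?_⟩
    · by_contra hzu
      exact hmin z (hy.1 w hw z hz) hzu hz
    · simp only [mem_sc] at hz
      rcases hz with hz | rfl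
      · exact hy.2 w hw u huw z hz
      · exact huw
  rwa [← this]

lemma Lim.sc_mem {l x : M} (hl : Lim l) (hx : x ∈ l) : sc x ∈ l := by
  obtain ⟨z, hz, h⟩ := hl.2 x hx
  simp only [isSc_iff] at h
  rwa [← h]

lemma isNum_emp : IsNum (emp M) := by
  simp [IsNum, Ord, Tran, Lim]

lemma IsNum.sc {x : M} (hx : IsNum x) : IsNum (sc x) := by
  obtain ⟨⟨hx1, hx2⟩, hx3⟩ := hx
  refine ⟨⟨⟨?_, ?_⟩, ?_⟩, ?_⟩
  · intro y hy z hz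
    simp only [mem_sc] at hy ⊢
    rcases hy with hy | rfl
    · exact Or.inl (hx1.1 y hy z hz)
    · exact Or.inl hz
  · intro y hy
    simp only [mem_sc] at hy
    rcases hy with hy | rfl
    · exact hx1.2 y hy
    · exact hx1.1
  · intro hl
    have := hl.sc_mem (x := x) (by simp)
    simp only [mem_sc] at this
    have hxx : x ∈ WeakSet.sc x := by simp
    rcases this with h | h
    · exact mem_asymm h hxx
    · rw [h] at hxx
      exact mem_irrefl _ hxx
  · intro y hy
    simp only [mem_sc] at hy
    rcases hy with hy | rfl
    · exact hx3 y hy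
    · exact hx2

instance D.isNum {Γ : Type} [Cx M Γ] (s : Γ → M) [Tm s] : D M fun γ => IsNum (s γ) := by
  have h : ∀ {Δ : Type} [Cx M Δ] (π : Δ → Γ) [Pr M π], Tm fun δ => s (π δ) :=
    fun π => Tm.weaken s π
  simp only [IsNum, Ord, Tran, Sub, Lim, isSc_iff]
  infer_instance

variable (M) in
/-- The set of natural numbers. -/
noncomputable def omega : M := sep (exists_lim (M := M)).choose IsNum

lemma Lim.emp_mem {l : M} (hl : Lim l) : emp M ∈ l := by
  obtain ⟨y, hy, h⟩ := exists_min' l hl.1.2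
  have : y = emp M := ext fun z => by
    simp only [not_mem_emp, iff_false]
    exact fun hz => h z (hl.1.1.1 y hy z hz) hz
  rwa [← this]

/-- Let `y` be minimal in `sc x` outside `l`. It is neither empty nor the successor of one of its
elements, since `l` contains all such sets; by `Ord.eq_sc` it is then a limit, which no number below
`sc x` is. -/
lemma Lim.num_mem {l : M} (hl : Lim l) {x : M} (hx : IsNum x) : x ∈ l := by
  by_contra hxl
  obtain ⟨y, hy, hyl, hmin⟩ := exists_min (sc x) (P := fun y => y ∉ l) ⟨x, by simp, hxl⟩
  have hyn : IsNum y := hx.sc.mem hy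
  have hsub : ∀ z, z ∈ y → z ∈ l := fun z hz => by
    by_contra hzl
    exact hmin z (hx.sc.1.1.1 y hy z hz) hzl hz
  by_cases hne : ∃ w, w ∈ y
  · refine hyn.1.2 ⟨⟨hyn.1.1, hne⟩, fun u hu => ⟨sc u, ?_, by simp⟩⟩
    by_contra hscu
    have := hyn.1.1.eq_sc hu hscu
    exact hyl (this ▸ hl.sc_mem (hsub u hu))
  · have : y = emp M := ext fun z => by
      simp only [not_mem_emp, iff_false]
      exact fun hz => hne ⟨z, hz⟩
    exact hyl (this ▸ hl.emp_mem)

@[simp] lemma mem_omega {x : M} : x ∈ omega M ↔ IsNum x := by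
  simp only [omega, mem_sep, and_iff_right_iff_imp]
  exact fun h => (exists_lim (M := M)).choose_spec.num_mem h

/-! ### Finite sets and products -/

lemma relBetween_iff {r x y : M} :
    RelBetween r x y ↔ ∀ z, z ∈ r → ∃ u, u ∈ x ∧ ∃ w, w ∈ y ∧ z = pr u w := by
  simp [RelBetween]

lemma RelBetween.mem {r x y u v : M} (h : RelBetween r x y) (huv : pr u v ∈ r) :
    u ∈ x ∧ v ∈ y := by
  obtain ⟨a, ha, b, hb, h⟩ := relBetween_iff.1 h _ huv
  simp only [pr_inj] at h
  rw [h.1, h.2]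
  exact ⟨ha, hb⟩

lemma Fun.unique {f x y u v w : M} (h : Fun f x y) (h1 : pr u v ∈ f) (h2 : pr u w ∈ f) :
    v = w := by
  obtain ⟨z, _, _, h'⟩ := h.2 u (h.1.mem h1).1
  simp only [pairMem_iff] at h'
  rw [h' v (h.1.mem h1).2 h1, h' w (h.1.mem h2).2 h2]

lemma Fun.exists {f x y u : M} (h : Fun f x y) (hu : u ∈ x) : ∃ v, pr u v ∈ f := by
  obtain ⟨z, _, hz, _⟩ := h.2 u hu
  exact ⟨z, by simpa using hz⟩

lemma Fun.mk {f x y : M} (h1 : ∀ z, z ∈ f → ∃ u, u ∈ x ∧ ∃ w, w ∈ y ∧ z = pr u w)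
    (h2 : ∀ u, u ∈ x → ∃ v, pr u v ∈ f) (h3 : ∀ u v w, pr u v ∈ f → pr u w ∈ f → v = w) :
    Fun f x y := by
  have h1 := relBetween_iff.2 h1
  refine ⟨h1, fun u hu => ?_⟩
  obtain ⟨v, hv⟩ := h2 u hu
  exact ⟨v, (h1.mem hv).2, by simpa using hv, fun w _ hw => h3 u w v (by simpa using hw) hv⟩

lemma Fun.snoc {f k y u y' : M} (h : Fun f k y) (hy : Sub y y') (hu : u ∈ y') :
    Fun (un f (sing (pr k u))) (sc k) y' := by
  have hf : ∀ i v, pr i v ∈ un f (sing (pr k u)) ↔ pr i v ∈ f ∨ (i = k ∧ v = u) := by simp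
  refine Fun.mk (fun z hz => ?_) (fun i hi => ?_) (fun i v w hv hw => ?_)
  · simp only [mem_un, mem_sing] at hz
    rcases hz with hz | rfl
    · obtain ⟨a, ha, b, hb, rfl⟩ := relBetween_iff.1 h.1 _ hz
      exact ⟨a, by simp [ha], b, hy b hb, rfl⟩
    · exact ⟨k, by simp, u, hu, rfl⟩
  · simp only [mem_sc] at hi
    rcases hi with hi | rfl
    · obtain ⟨v, hv⟩ := h.exists hi
      exact ⟨v, by simp [hv]⟩
    · exact ⟨u, by simp⟩
  · rw [hf] at hv hw
    rcases hv with hv | ⟨rfl, rfl⟩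
    · rcases hw with hw | ⟨rfl, rfl⟩
      · exact h.unique hv hw
      · exact absurd (h.1.mem hv).1 (mem_irrefl _)
    · rcases hw with hw | ⟨_, rfl⟩
      · exact absurd (h.1.mem hw).1 (mem_irrefl _)
      · rfl

lemma fnt_emp : Fnt (emp M) :=
  ⟨emp M, isNum_emp, emp M, by simp [Bij, Fun, RelBetween]⟩

lemma Fnt.insert {x u : M} (h : Fnt x) : Fnt (un x (sing u)) := by
  by_cases hu : u ∈ x
  · have : un x (sing u) = x := ext fun z => by
      simp only [mem_un, mem_sing, or_iff_left_iff_imp]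
      rintro rfl
      exact hu
    rwa [this]
  obtain ⟨k, hk, f, ⟨hf, hinj⟩, hsur⟩ := h
  simp only [pairMem_iff] at hinj hsur
  have hsub : Sub x (un x (sing u)) := fun w hw => by simp [hw]
  refine ⟨sc k, hk.sc, un f (sing (pr k u)), ⟨hf.snoc hsub (by simp), ?_⟩, ?_⟩
  · rintro i _ j _ v _ ⟨h1, h2⟩
    simp only [pairMem_iff, mem_un, mem_sing, pr_inj] at h1 h2
    rcases h1 with h1 | ⟨rfl, rfl⟩
    · rcases h2 with h2 | ⟨rfl, rfl⟩
      · exact hinj i (hf.1.mem h1).1 j (hf.1.mem h2).1 v (hf.1.mem h1).2 ⟨h1, h2⟩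
      · exact absurd (hf.1.mem h1).2 hu
    · rcases h2 with h2 | ⟨rfl, _⟩
      · exact absurd (hf.1.mem h2).2 hu
      · rfl
  · intro v hv
    simp only [mem_un, mem_sing] at hv
    rcases hv with hv | rfl
    · obtain ⟨i, hi, h⟩ := hsur v hv
      exact ⟨i, by simp [hi], by simp [h]⟩
    · exact ⟨k, by simp, by simp⟩

lemma fnt_upair (u v : M) : Fnt (upair u v) := by
  have : upair u v = un (un (emp M) (sing u)) (sing v) := ext fun z => by simp
  rw [this]
  exact fnt_emp.insert.insert

/-- The set of finite subsets. -/
noncomputable def fpow (x : M) : M := (exists_fpow x).choose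

@[simp] lemma mem_fpow {x y : M} : y ∈ fpow x ↔ Sub y x ∧ Fnt y := (exists_fpow x).choose_spec y

/-- The Cartesian product. -/
noncomputable def prod (x y : M) : M :=
  sep (fpow (fpow (un x y))) fun z => ∃ u, u ∈ x ∧ ∃ w, w ∈ y ∧ z = pr u w

/-- There is no power set axiom, but a Kuratowski pair is a finite set of finite sets, so two
applications of Finite Powerset provide a set from which the pairs can be separated. -/
lemma mem_prod {x y z : M} : z ∈ prod x y ↔ ∃ u, u ∈ x ∧ ∃ w, w ∈ y ∧ z = pr u w := by
  simp only [prod, mem_sep, and_iff_right_iff_imp]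
  rintro ⟨u, hu, w, hw, rfl⟩
  simp only [mem_fpow, pr]
  refine ⟨fun t ht => ?_, fnt_upair _ _⟩
  simp only [mem_upair, sing] at ht
  simp only [mem_fpow]
  rcases ht with rfl | rfl
  · exact ⟨fun s hs => by simp at hs; simp [hs, hu], fnt_upair _ _⟩
  · exact ⟨fun s hs => by simp at hs; rcases hs with rfl | rfl <;> simp [hu, hw], fnt_upair _ _⟩

@[simp] lemma pr_mem_prod {x y u w : M} : pr u w ∈ prod x y ↔ u ∈ x ∧ w ∈ y := by
  simp [mem_prod]

lemma relBetween_iff_sub {r x y : M} : RelBetween r x y ↔ Sub r (prod x y) := by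
  simp [relBetween_iff, Sub, mem_prod]

instance Tm.prod {Γ : Type} [Cx M Γ] (s t : Γ → M) [hs : Tm s] [ht : Tm t] :
    Tm fun γ => prod (s γ) (t γ) := by
  refine Tm.of_congr (fun π P δ => ∀ u, u ∈ s (π δ) → ∀ w, w ∈ t (π δ) → P (δ, WeakSet.pr u w))
    (fun π P δ => by simp only [mem_prod]; grind) fun {Δ} _ π P hπ hP => ?_
  have h1 := hs.comp hπ
  have h2 : Tm fun γ : Δ × M => t (π γ.1) := (ht.comp hπ).comp inferInstance
  have h3 : D M fun γ : ((Δ × M) × M) × M => P (γ.1.1.1, γ.2) := by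
    refine hP.comp (π := fun γ : ((Δ × M) × M) × M => (γ.1.1.1, γ.2)) ?_
    refine ⟨Fin.lastCases (Fin.last _) fun i => i.castSucc.castSucc.castSucc, fun γ i => ?_⟩
    refine Fin.lastCases ?_ (fun i => ?_) i <;> simp [Cx.e]
  have h4 : D M fun γ : (Δ × M) × M => P (γ.1.1, WeakSet.pr γ.1.2 γ.2) :=
    D.sub (fun (γ : (Δ × M) × M) z => P (γ.1.1, z)) inferInstance
  infer_instance

/-! ### Well founded relations -/

lemma WFRel.induction {r X : M} (h : WFRel r X) {P : M → Prop} [D M fun γ : Unit × M => P γ.2]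
    (hP : ∀ x, x ∈ X → (∀ y, y ∈ X → pr y x ∈ r → P y) → P x) : ∀ x, x ∈ X → P x := by
  intro x hx
  by_contra hPx
  obtain ⟨m, hm, hmin⟩ := h.2 (sep X fun z => ¬ P z) ⟨fun w hw => (mem_sep.1 hw).1, x, by simp [*]⟩
  simp only [mem_sep, pairMem_iff] at hm hmin
  exact hm.2 (hP m hm.1 fun y hy hym => by_contra fun hPy => hmin y ⟨hy, hPy⟩ hym)

/-- If `Y` had no minimal element, its complement in `X` would satisfy the induction hypothesis and
therefore be all of `X`. -/
lemma wfRel_of_induction {r X : M} (hr : Sub r (prod X X))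
    (h : ∀ Y : M, (∀ x, x ∈ X → (∀ y, y ∈ X → pr y x ∈ r → y ∈ Y) → x ∈ Y) → Sub X Y) :
    WFRel r X := by
  refine ⟨relBetween_iff_sub.2 hr, fun Y ⟨hYX, w, hw⟩ => ?_⟩
  by_contra hno
  refine absurd (h (sep X fun z => z ∉ Y) (fun x hx hy => ?_) w (hYX w hw)) (by simp [hw])
  simp only [mem_sep]
  refine ⟨hx, fun hxY => hno ⟨x, hxY, fun y hyY hyx => ?_⟩⟩
  have := hy y (hYX y hyY) (by simpa using hyx)
  exact (mem_sep.1 this).2 hyY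

end Models

/-! ### Explicit `Δ₀` formulas -/

section Formulas

variable {α : Type} {n : ℕ}

/-- A variable, seen below one more quantifier. -/
def up (x : α ⊕ Fin n) : α ⊕ Fin (n + 1) := Sum.map id Fin.castSucc x

/-- The variable bound by the innermost quantifier. -/
def lastVar : α ⊕ Fin (n + 1) := Sum.inr (Fin.last n)

def memF (x y : α ⊕ Fin n) : Lset.BoundedFormula α n :=
  Relations.boundedFormula₂ (L := Lset) (MemRel.mem : Lset.Relations 2) (Term.var x) (Term.var y)

def eqF (x y : α ⊕ Fin n) : Lset.BoundedFormula α n := Term.bdEqual (Term.var x) (Term.var y)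

def ballF (x : α ⊕ Fin n) (φ : Lset.BoundedFormula α (n + 1)) : Lset.BoundedFormula α n :=
  ∀' (memF lastVar (up x) ⟹ φ)

def bexF (x : α ⊕ Fin n) (φ : Lset.BoundedFormula α (n + 1)) : Lset.BoundedFormula α n :=
  ∃' (memF lastVar (up x) ⊓ φ)

/-- `z = ⟨x, y⟩` -/
def pairF (z x y : α ⊕ Fin n) : Lset.BoundedFormula α n :=
  bexF z <| bexF (up z) <|
    (ballF (up lastVar) (eqF lastVar (up (up (up x)))) ⊓ memF (up (up x)) (up lastVar)) ⊓
    (ballF lastVar (eqF lastVar (up (up (up x))) ⊔ eqF lastVar (up (up (up y)))) ⊓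
      (memF (up (up x)) lastVar ⊓ memF (up (up y)) lastVar)) ⊓
    ballF (up (up z)) (eqF lastVar (up (up lastVar)) ⊔ eqF lastVar (up lastVar))

/-- `⟨x, y⟩ ∈ r` -/
def pairMemF (x y r : α ⊕ Fin n) : Lset.BoundedFormula α n := bexF r (pairF lastVar (up x) (up y))

/-- `⟨x, y⟩ ∈ q ∩ v` -/
def pairMemInterF (x y q v : α ⊕ Fin n) : Lset.BoundedFormula α n :=
  bexF q (pairF lastVar (up x) (up y) ⊓ memF lastVar (up v))

lemma IsDelta0.not {φ : Lset.BoundedFormula α n} (h : IsDelta0 φ) : IsDelta0 ∼φ :=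
  h.imp .falsum

lemma IsDelta0.inf {φ ψ : Lset.BoundedFormula α n} (h : IsDelta0 φ) (h' : IsDelta0 ψ) :
    IsDelta0 (φ ⊓ ψ) := (h.imp h'.not).not

lemma IsDelta0.sup {φ ψ : Lset.BoundedFormula α n} (h : IsDelta0 φ) (h' : IsDelta0 ψ) :
    IsDelta0 (φ ⊔ ψ) := h.not.imp h'

lemma IsDelta0.memF (x y : α ⊕ Fin n) : IsDelta0 (memF x y) := .rel _ _

lemma IsDelta0.eqF (x y : α ⊕ Fin n) : IsDelta0 (eqF x y) := .equal _ _

lemma IsDelta0.ballF (x : α ⊕ Fin n) {φ : Lset.BoundedFormula α (n + 1)} (h : IsDelta0 φ) :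
    IsDelta0 (ballF x φ) := .ball x h

lemma IsDelta0.bexF (x : α ⊕ Fin n) {φ : Lset.BoundedFormula α (n + 1)} (h : IsDelta0 φ) :
    IsDelta0 (bexF x φ) := .bex x h

lemma IsDelta0.pairF (z x y : α ⊕ Fin n) : IsDelta0 (pairF z x y) :=
  .bexF _ <| .bexF _ <| .inf (.inf (.inf (.ballF _ (.eqF _ _)) (.memF _ _))
    (.inf (.ballF _ (.sup (.eqF _ _) (.eqF _ _))) (.inf (.memF _ _) (.memF _ _))))
    (.ballF _ (.sup (.eqF _ _) (.eqF _ _)))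

lemma IsDelta0.pairMemF (x y r : α ⊕ Fin n) : IsDelta0 (pairMemF x y r) := .bexF _ (.pairF _ _ _)

lemma IsDelta0.pairMemInterF (x y q v : α ⊕ Fin n) : IsDelta0 (pairMemInterF x y q v) :=
  .bexF _ (.inf (.pairF _ _ _) (.memF _ _))

/-! ### Occurrences of the recursion variable -/

section Container

variable (v : α)

@[simp] lemma up_ne_inl {x : α ⊕ Fin n} : up x = Sum.inl v ↔ x = Sum.inl v := by
  cases x <;> simp [up]

@[simp] lemma lastVar_ne_inl : (lastVar : α ⊕ Fin (n + 1)) ≠ Sum.inl v := by simp [lastVar]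

@[simp] lemma container_not {φ : Lset.BoundedFormula α n} :
    OnlyAsContainer v (∼φ) ↔ OnlyAsContainer v φ := (iff_of_eq (and_true _))

@[simp] lemma container_inf {φ ψ : Lset.BoundedFormula α n} :
    OnlyAsContainer v (φ ⊓ ψ) ↔ OnlyAsContainer v φ ∧ OnlyAsContainer v ψ :=
  (iff_of_eq (and_true _)).trans (and_congr Iff.rfl (iff_of_eq (and_true _)))

@[simp] lemma container_sup {φ ψ : Lset.BoundedFormula α n} :
    OnlyAsContainer v (φ ⊔ ψ) ↔ OnlyAsContainer v φ ∧ OnlyAsContainer v ψ :=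
  and_congr (iff_of_eq (and_true _)) Iff.rfl

@[simp] lemma container_imp {φ ψ : Lset.BoundedFormula α n} :
    OnlyAsContainer v (φ ⟹ ψ) ↔ OnlyAsContainer v φ ∧ OnlyAsContainer v ψ := Iff.rfl

@[simp] lemma container_memF {x y : α ⊕ Fin n} :
    OnlyAsContainer v (memF x y) ↔ x ≠ Sum.inl v := by
  have : OnlyAsContainer v (memF x y) ↔ ∀ i : Fin 2, i.val = 0 →
    (![Term.var x, Term.var y] : Fin 2 → Lset.Term (α ⊕ Fin n)) i ≠ Term.var (Sum.inl v) := Iff.rfl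
  rw [this, Fin.forall_fin_two]
  simp

@[simp] lemma container_eqF {x y : α ⊕ Fin n} :
    OnlyAsContainer v (eqF x y) ↔ x ≠ Sum.inl v ∧ y ≠ Sum.inl v := by
  simp [eqF, Term.bdEqual, OnlyAsContainer]

@[simp] lemma container_ballF {x : α ⊕ Fin n} {φ : Lset.BoundedFormula α (n + 1)} :
    OnlyAsContainer v (ballF x φ) ↔ OnlyAsContainer v φ := by
  have : OnlyAsContainer v (ballF x φ) ↔ OnlyAsContainer v (memF lastVar (up x) ⟹ φ) := Iff.rfl
  simp [this]

@[simp] lemma container_bexF {x : α ⊕ Fin n} {φ : Lset.BoundedFormula α (n + 1)} :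
    OnlyAsContainer v (bexF x φ) ↔ OnlyAsContainer v φ := by
  have : OnlyAsContainer v (bexF x φ) ↔ OnlyAsContainer v (∼(∼(memF lastVar (up x) ⊓ φ))) := by
    simp only [container_not]
    exact (iff_of_eq (and_true _)).trans (iff_of_eq (and_true _))
  simp [this]

-- No condition on `z` arises, as it occurs only as the bound of quantifiers, hence to the right of
-- `∈`.
@[simp] lemma container_pairF {x y z : α ⊕ Fin n} :
    OnlyAsContainer v (pairF z x y) ↔ x ≠ Sum.inl v ∧ y ≠ Sum.inl v := by
  simp [pairF]

@[simp] lemma container_pairMemF {x y r : α ⊕ Fin n} :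
    OnlyAsContainer v (pairMemF x y r) ↔ x ≠ Sum.inl v ∧ y ≠ Sum.inl v := by
  simp [pairMemF]

@[simp] lemma container_pairMemInterF {x y q w : α ⊕ Fin n} :
    OnlyAsContainer v (pairMemInterF x y q w) ↔ x ≠ Sum.inl v ∧ y ≠ Sum.inl v := by
  simp [pairMemInterF]

end Container

variable {M : Type} {e : α → M} {xs : Fin n → M}

@[simp] lemma elim_up {a : M} (x : α ⊕ Fin n) :
    Sum.elim e (Fin.snoc xs a : Fin (n + 1) → M) (up x) = Sum.elim e xs x := by
  cases x <;> simp [up]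

@[simp] lemma elim_lastVar {a : M} :
    Sum.elim e (Fin.snoc xs a : Fin (n + 1) → M) lastVar = a := by
  simp [lastVar]

variable [Lset.Structure M]

@[simp] lemma realize_memF (x y : α ⊕ Fin n) :
    (memF x y).Realize e xs ↔ Sum.elim e xs x ∈ Sum.elim e xs y :=
  BoundedFormula.realize_rel₂.trans (relMap_mem _)

@[simp] lemma realize_eqF (x y : α ⊕ Fin n) :
    (eqF x y).Realize e xs ↔ Sum.elim e xs x = Sum.elim e xs y := Iff.rfl

@[simp] lemma realize_ballF (x : α ⊕ Fin n) (φ : Lset.BoundedFormula α (n + 1)) :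
    (ballF x φ).Realize e xs ↔ ∀ z, z ∈ Sum.elim e xs x → φ.Realize e (Fin.snoc xs z) :=
  realize_ball _ _ _ _

@[simp] lemma realize_bexF (x : α ⊕ Fin n) (φ : Lset.BoundedFormula α (n + 1)) :
    (bexF x φ).Realize e xs ↔ ∃ z, z ∈ Sum.elim e xs x ∧ φ.Realize e (Fin.snoc xs z) := by
  simp [bexF]

variable [hB : Theory.Model M B]

@[simp] lemma realize_pairF (z x y : α ⊕ Fin n) :
    (pairF z x y).Realize e xs ↔
      Sum.elim e xs z = pr (Sum.elim e xs x) (Sum.elim e xs y) := by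
  generalize ha : Sum.elim e xs x = a
  generalize hb : Sum.elim e xs y = b
  generalize hc : Sum.elim e xs z = c
  simp only [pairF, realize_bexF, hc, elim_up, BoundedFormula.realize_inf, realize_ballF,
    elim_lastVar, realize_eqF, ha, realize_memF, BoundedFormula.realize_sup, hb]
  constructor
  · rintro ⟨p, hp, q, hq, ⟨⟨h1, h2⟩, h3, h4, h5⟩, h6⟩
    have hp' : p = sing a := ext fun w => ⟨fun hw => by simp [h1 w hw], fun hw => by
      simp only [mem_sing] at hw; rwa [hw]⟩
    have hq' : q = upair a b := ext fun w => ⟨fun hw => by simpa using h3 w hw, fun hw => by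
      simp only [mem_upair] at hw; rcases hw with rfl | rfl <;> assumption⟩
    subst hp' hq'
    exact ext fun w => ⟨fun hw => by simpa [pr] using h6 w hw, fun hw => by
      simp only [pr, mem_upair] at hw; rcases hw with rfl | rfl <;> assumption⟩
  · rintro rfl
    exact ⟨sing a, by simp [pr], upair a b, by simp [pr], by simp [pr]⟩

@[simp] lemma realize_pairMemF (x y r : α ⊕ Fin n) :
    (pairMemF x y r).Realize e xs ↔
      pr (Sum.elim e xs x) (Sum.elim e xs y) ∈ Sum.elim e xs r := by
  simp [pairMemF]

@[simp] lemma realize_pairMemInterF (x y q v : α ⊕ Fin n) :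
    (pairMemInterF x y q v).Realize e xs ↔
      pr (Sum.elim e xs x) (Sum.elim e xs y) ∈ Sum.elim e xs q ∧
      pr (Sum.elim e xs x) (Sum.elim e xs y) ∈ Sum.elim e xs v := by
  simp [pairMemInterF]

end Formulas

/-- The recursion clause for a bisimulation: for the variables `c, v, T, S, Q`, where `S` is the
relation of immediate succession on the tree `T` and `Q = T × T`, it says that every immediate
successor of `c` is related by `v` to something, and that everything in the range of `v` is
related by `v` to some immediate successor of `c`. -/
def bisimF : Lset.Formula (Fin (3 + 2)) :=
  (ballF (Sum.inl 2) (pairMemF lastVar (Sum.inl 0) (Sum.inl 3) ⟹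
    bexF (Sum.inl 2) (pairMemInterF (up lastVar) lastVar (Sum.inl 4) (Sum.inl 1))) ⊓
  ballF (Sum.inl 2) (bexF (Sum.inl 2)
      (pairMemInterF lastVar (up lastVar) (Sum.inl 4) (Sum.inl 1)) ⟹
    bexF (Sum.inl 2) (pairMemF lastVar (Sum.inl 0) (Sum.inl 3) ⊓
      pairMemInterF lastVar (up lastVar) (Sum.inl 4) (Sum.inl 1))) :
  Lset.BoundedFormula (Fin 5) 0)

lemma isDelta0_bisimF : IsDelta0 bisimF :=
  .inf (.ballF _ (.imp (.pairMemF _ _ _) (.bexF _ (.pairMemInterF _ _ _ _))))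
    (.ballF _ (.imp (.bexF _ (.pairMemInterF _ _ _ _))
      (.bexF _ (.inf (.pairMemF _ _ _) (.pairMemInterF _ _ _ _)))))

lemma onlyAsContainer_bisimF : OnlyAsContainer 1 bisimF := by
  have : OnlyAsContainer (1 : Fin 5) bisimF := by
    simp [bisimF]
  exact this

/-! ### The bisimulation clause in a model of `B` -/

section

variable {M : Type} [Lset.Structure M] [hB : Theory.Model M B]

lemma realize_bisimF (c v T S Q : M) :
    bisimF.Realize (Fin.cons c (Fin.cons v ![T, S, Q]) : Fin (3 + 2) → M) ↔
      (∀ s', s' ∈ T → pr s' c ∈ S → ∃ t', t' ∈ T ∧ pr s' t' ∈ Q ∧ pr s' t' ∈ v) ∧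
      (∀ t', t' ∈ T → (∃ s', s' ∈ T ∧ pr s' t' ∈ Q ∧ pr s' t' ∈ v) →
        ∃ s', s' ∈ T ∧ pr s' c ∈ S ∧ pr s' t' ∈ Q ∧ pr s' t' ∈ v) := by
  have h0 : (Fin.cons c (Fin.cons v ![T, S, Q]) : Fin 5 → M) 0 = c := rfl
  have h1 : (Fin.cons c (Fin.cons v ![T, S, Q]) : Fin 5 → M) 1 = v := rfl
  have h2 : (Fin.cons c (Fin.cons v ![T, S, Q]) : Fin 5 → M) 2 = T := rfl
  have h3 : (Fin.cons c (Fin.cons v ![T, S, Q]) : Fin 5 → M) 3 = S := rfl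
  have h4 : (Fin.cons c (Fin.cons v ![T, S, Q]) : Fin 5 → M) 4 = Q := rfl
  rw [Formula.Realize, bisimF]
  simp only [BoundedFormula.realize_inf, realize_ballF, BoundedFormula.realize_imp,
    realize_bexF, realize_pairMemF, realize_pairMemInterF, elim_up, elim_lastVar, Sum.elim_inl,
    h0, h1, h2, h3, h4]

/-! ### Immediate succession in trees -/

/-- `k` is the domain of `s`. -/
def IsDom (k s : M) : Prop := ∀ i, i ∈ k ↔ ∃ y, pr i y ∈ s

lemma left_mem_sUn (x y : M) : x ∈ sUn (pr x y) := by simp [pr]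

lemma right_mem_sUn (x y : M) : y ∈ sUn (pr x y) := by simp [pr]

/-- This bounds quantifiers over the components of pairs in `s`, and provides the sets to which
Separation is applied when ranges or inputs are collected. -/
lemma mem_sUn_sUn {x y s : M} (h : pr x y ∈ s) : x ∈ sUn (sUn s) ∧ y ∈ sUn (sUn s) := by
  constructor
  · exact mem_sUn.2 ⟨_, mem_sUn.2 ⟨_, h, by simp [pr]⟩, mem_sing.2 rfl⟩
  · exact mem_sUn.2 ⟨_, mem_sUn.2 ⟨_, h, mem_upair.2 (Or.inr rfl)⟩, mem_upair.2 (Or.inr rfl)⟩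

instance D.isDom {Γ : Type} [Cx M Γ] (k s : Γ → M) [Tm k] [Tm s] :
    D M fun γ => IsDom (k γ) (s γ) := by
  have h1 : ∀ {Δ : Type} [Cx M Δ] (π : Δ → Γ) [Pr M π], Tm fun δ => k (π δ) :=
    fun π => Tm.weaken k π
  have h2 : ∀ {Δ : Type} [Cx M Δ] (π : Δ → Γ) [Pr M π], Tm fun δ => s (π δ) :=
    fun π => Tm.weaken s π
  have : D M fun γ => (∀ i, i ∈ k γ → ∃ y, y ∈ sUn (sUn (s γ)) ∧ pr i y ∈ s γ) ∧
      ∀ z, z ∈ s γ → ∀ i, i ∈ sUn z → ∀ y, y ∈ sUn z → z = pr i y → i ∈ k γ := inferInstance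
  refine this.congr fun γ => ⟨fun h => ⟨fun i hi => ?_, ?_⟩, fun h i => ⟨fun hi => ?_, ?_⟩⟩
  · obtain ⟨y, hy⟩ := (h i).1 hi
    exact ⟨y, (mem_sUn_sUn hy).2, hy⟩
  · rintro z hz i _ y _ rfl
    exact (h i).2 ⟨y, hz⟩
  · obtain ⟨y, _, hy⟩ := h.1 i hi
    exact ⟨y, hy⟩
  · rintro ⟨y, hy⟩
    exact h.2 _ hy i (left_mem_sUn _ _) y (right_mem_sUn _ _) rfl

lemma immSucc_iff {t s : M} : ImmSucc t s ↔ ∃ k x, IsDom k s ∧ t = un s (sing (pr k x)) := by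
  simp only [ImmSucc, pairMem_iff, isPr_iff, IsDom]
  constructor
  · rintro ⟨k, x, p, ⟨h1, rfl⟩, h2⟩
    exact ⟨k, x, h1, ext fun z => by simp [h2]⟩
  · rintro ⟨k, x, h1, rfl⟩
    exact ⟨k, x, pr k x, ⟨h1, rfl⟩, by simp⟩

instance D.immSucc {Γ : Type} [Cx M Γ] (t s : Γ → M) [Tm t] [Tm s] :
    D M fun γ => ImmSucc (t γ) (s γ) := by
  have h1 : ∀ {Δ : Type} [Cx M Δ] (π : Δ → Γ) [Pr M π], Tm fun δ => t (π δ) :=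
    fun π => Tm.weaken t π
  have h2 : ∀ {Δ : Type} [Cx M Δ] (π : Δ → Γ) [Pr M π], Tm fun δ => s (π δ) :=
    fun π => Tm.weaken s π
  have : D M fun γ => ∃ k, k ∈ sUn (sUn (t γ)) ∧ ∃ x, x ∈ sUn (sUn (t γ)) ∧ IsDom k (s γ) ∧
    t γ = un (s γ) (sing (pr k x)) := inferInstance
  refine this.congr fun γ => immSucc_iff.trans ⟨?_, ?_⟩
  · rintro ⟨k, x, hk, ht⟩
    have := mem_sUn_sUn (x := k) (y := x) (s := t γ) (by simp [ht])
    exact ⟨k, this.1, x, this.2, hk, ht⟩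
  · rintro ⟨k, _, x, _, h⟩
    exact ⟨k, x, h⟩

/-! ### Recursion yields bisimulations -/

/-- The well founded relation is `S`, with `t' ≺ t` when `t'` is an immediate successor of `t`. The
clause for `t` asks that every successor of `s` be related to some successor of `t`, and that every
point in the range of `H` restricted to successors of `t` be matched by a successor of `s`. -/
theorem exists_bisim_of_transRec (h : M ⊨ transRec bisimF) (T : M) (hT : WFTree T) :
    ∃ b, Bisim b T := by
  let S := sep (prod T T) fun z => ∃ t', t' ∈ T ∧ ∃ t, t ∈ T ∧ ImmSucc t' t ∧ z = pr t' t
  have hS : ∀ t' t, pr t' t ∈ S ↔ t' ∈ T ∧ t ∈ T ∧ ImmSucc t' t := by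
    intro t' t
    simp only [S, mem_sep, pr_mem_prod, pr_inj]
    constructor
    · rintro ⟨h1, _, _, _, _, h2, rfl, rfl⟩
      exact ⟨h1.1, h1.2, h2⟩
    · rintro ⟨h1, h2, h3⟩
      exact ⟨⟨h1, h2⟩, t', h1, t, h2, h3, rfl, rfl⟩
  have hwf : WFRel S T := by
    refine ⟨relBetween_iff_sub.2 fun z hz => (mem_sep.1 hz).1, fun Y hY => ?_⟩
    obtain ⟨m, hm, hmin⟩ := hT Y hY
    refine ⟨m, hm, fun y hy hym => hmin y hy ?_⟩
    exact ((hS _ _).1 (pairMem_iff.1 hym)).2.2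
  obtain ⟨H, hH, hrec⟩ := (models_transRec bisimF).1 h ![T, S, prod T T] T T S hwf
  have hrec : ∀ t, t ∈ T → ∀ s, s ∈ T → (pr s t ∈ H ↔
      (∀ s', s' ∈ T → ImmSucc s' s → ∃ t', t' ∈ T ∧ ImmSucc t' t ∧ pr s' t' ∈ H) ∧
      (∀ t', t' ∈ T → (∃ s', s' ∈ T ∧ ImmSucc t' t ∧ pr s' t' ∈ H) →
        ∃ s', s' ∈ T ∧ ImmSucc s' s ∧ ImmSucc t' t ∧ pr s' t' ∈ H)) := by
    intro t ht s hs
    obtain ⟨v, hv, hv'⟩ := hrec t ht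
    have hv : ∀ s' t', t' ∈ T → (pr s' t' ∈ v ↔ ImmSucc t' t ∧ pr s' t' ∈ H) := by
      intro s' t' ht'
      rw [hv]
      simp [hS, ht, ht']
    rw [← pairMem_iff, hv' s hs, realize_bisimF]
    refine and_congr (forall_congr' fun s' => forall_congr' fun hs' => ?_)
      (forall_congr' fun t' => forall_congr' fun ht' => ?_)
    · simp only [hS, hs', hs, true_and]
      refine forall_congr' fun _ => exists_congr fun t' => and_congr_right fun ht' => ?_
      simp [hs', ht', hv]
    · have : ∀ s', s' ∈ T → (pr s' t' ∈ prod T T ∧ pr s' t' ∈ v ↔ ImmSucc t' t ∧ pr s' t' ∈ H) :=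
        fun s' hs' => by simp [hs', ht', hv]
      refine imp_congr ?_ ?_
      · exact exists_congr fun s' => and_congr_right fun hs' => this s' hs'
      · refine exists_congr fun s' => and_congr_right fun hs' => ?_
        rw [this s' hs']
        simp [hS, hs', hs]
  -- By reflexivity every immediate successor of `t` lies in the range of the restriction, so the
  -- clause about the range is the usual back condition.
  have hrefl : ∀ t, t ∈ T → pr t t ∈ H := by
    refine hwf.induction fun t ht ih => (hrec t ht t ht).2 ⟨fun s' hs' h => ?_, ?_⟩
    · exact ⟨s', hs', h, ih s' hs' ((hS _ _).2 ⟨hs', ht, h⟩)⟩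
    · rintro t' ht' ⟨_, _, h, _⟩
      exact ⟨t', ht', h, h, ih t' ht' ((hS _ _).2 ⟨ht', ht, h⟩)⟩
  refine ⟨H, hH, fun s hs t ht => ?_⟩
  simp only [pairMem_iff]
  rw [hrec t ht s hs]
  refine and_congr_right fun _ => forall_congr' fun t' => forall_congr' fun ht' => ?_
  constructor
  · intro h h'
    obtain ⟨s', hs', h1, _, h2⟩ := h ⟨t', ht', h', hrefl t' ht'⟩
    exact ⟨s', hs', h1, h2⟩
  · rintro h ⟨_, _, h', _⟩
    obtain ⟨s', hs', h1, h2⟩ := h h'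
    exact ⟨s', hs', h1, h', h2⟩

end

/-! ### Bisimulations on well founded relations -/

section Graph

variable {M : Type} [Lset.Structure M] [hB : Theory.Model M B]

instance D.fun {Γ : Type} [Cx M Γ] (f x y : Γ → M) [Tm f] [Tm x] [Tm y] :
    D M fun γ => Fun (f γ) (x γ) (y γ) := by
  have h1 : ∀ {Δ : Type} [Cx M Δ] (π : Δ → Γ) [Pr M π], Tm fun δ => f (π δ) :=
    fun π => Tm.weaken f π
  have h2 : ∀ {Δ : Type} [Cx M Δ] (π : Δ → Γ) [Pr M π], Tm fun δ => x (π δ) :=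
    fun π => Tm.weaken x π
  have h3 : ∀ {Δ : Type} [Cx M Δ] (π : Δ → Γ) [Pr M π], Tm fun δ => y (π δ) :=
    fun π => Tm.weaken y π
  simp only [Fun, relBetween_iff, pairMem_iff]
  infer_instance

lemma Fun.isDom {f x y : M} (h : Fun f x y) : IsDom x f := fun _ =>
  ⟨fun hi => h.exists hi, fun ⟨_, hy⟩ => (h.1.mem hy).1⟩

lemma IsDom.unique {k k' s : M} (h : IsDom k s) (h' : IsDom k' s) : k = k' :=
  ext fun i => (h i).trans (h' i).symm

lemma IsDom.snoc {k s y : M} (h : IsDom k s) : IsDom (sc k) (un s (sing (pr k y))) := by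
  intro i
  simp only [mem_sc, h i, mem_un, mem_sing, pr_inj]
  constructor
  · rintro (⟨z, hz⟩ | rfl)
    · exact ⟨z, Or.inl hz⟩
    · exact ⟨y, Or.inr ⟨rfl, rfl⟩⟩
  · rintro ⟨z, hz | ⟨rfl, rfl⟩⟩
    · exact Or.inl ⟨z, hz⟩
    · exact Or.inr rfl

/-- The map `i ↦ ⟨i, s(i)⟩` is a bijection from the length of `s` onto `s`. Hence all finite
sequences in `S` are found among the finite subsets of `ω × S`. -/
lemma FinSeq.fnt {s S : M} (h : FinSeq s S) : Fnt s := by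
  obtain ⟨k, hk, hf⟩ := h
  let f := sep (prod k s) fun z => ∃ i, i ∈ k ∧ ∃ x, x ∈ S ∧ pr i x ∈ s ∧ z = pr i (pr i x)
  have hfm : ∀ i w, pr i w ∈ f ↔ ∃ x, pr i x ∈ s ∧ w = pr i x := by
    intro i w
    simp only [f, mem_sep, pr_mem_prod, pr_inj]
    constructor
    · rintro ⟨_, j, hj, x, hx, h, rfl, rfl⟩
      exact ⟨x, h, rfl⟩
    · rintro ⟨x, h, rfl⟩
      have := hf.1.mem h
      exact ⟨⟨this.1, h⟩, i, this.1, x, this.2, h, rfl, rfl⟩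
  refine ⟨k, hk, f, ⟨Fun.mk (fun z hz => mem_prod.1 (mem_sep.1 hz).1) (fun i hi => ?_) ?_, ?_⟩, ?_⟩
  · obtain ⟨x, hx⟩ := hf.exists hi
    exact ⟨_, (hfm _ _).2 ⟨x, hx, rfl⟩⟩
  · intro i v w hv hw
    obtain ⟨x, hx, rfl⟩ := (hfm _ _).1 hv
    obtain ⟨y, hy, rfl⟩ := (hfm _ _).1 hw
    rw [hf.unique hx hy]
  · simp only [pairMem_iff, hfm]
    rintro i _ j _ v _ ⟨⟨x, _, rfl⟩, y, _, h⟩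
    exact (pr_inj.1 h).1
  · intro v hv
    obtain ⟨i, hi, x, _, rfl⟩ := relBetween_iff.1 hf.1 v hv
    exact ⟨i, hi, pairMem_iff.2 ((hfm _ _).2 ⟨x, hv, rfl⟩)⟩

/-- The tree of finite sequences in `S` that descend along `R`. -/
noncomputable def paths (S R : M) : M :=
  sep (fpow (prod (omega M) S)) fun s => (∃ k, k ∈ omega M ∧ Fun s k S) ∧
    ∀ i, i ∈ omega M → ∀ x, x ∈ S → ∀ y, y ∈ S → pr i x ∈ s → pr (sc i) y ∈ s → pr y x ∈ R

lemma mem_paths {S R s : M} : s ∈ paths S R ↔ FinSeq s S ∧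
    ∀ i x y, pr i x ∈ s → pr (sc i) y ∈ s → pr y x ∈ R := by
  simp only [paths, mem_sep, mem_fpow, mem_omega]
  constructor
  · rintro ⟨_, hs, h⟩
    refine ⟨hs, fun i x y hx hy => ?_⟩
    obtain ⟨k, hk, hf⟩ := hs
    exact h i (hk.mem (hf.1.mem hx).1) x (hf.1.mem hx).2 y (hf.1.mem hy).2 hx hy
  · rintro ⟨hs, h⟩
    refine ⟨⟨?_, hs.fnt⟩, hs, fun i _ x _ y _ hx hy => h i x y hx hy⟩
    obtain ⟨k, hk, hf⟩ := hs
    intro z hz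
    obtain ⟨i, hi, x, hx, rfl⟩ := relBetween_iff.1 hf.1 z hz
    simpa using ⟨hk.mem hi, hx⟩

lemma tree_paths (S R : M) : Tree (paths S R) := by
  refine ⟨S, fun s hs => ⟨(mem_paths.1 hs).1, fun r hr => mem_paths.2 ⟨hr.1, ?_⟩⟩⟩
  exact fun i x y hx hy => (mem_paths.1 hs).2 i x y (hr.2 _ hx) (hr.2 _ hy)

/-- `x` is the last entry of the sequence `s`. -/
def LastIs (s x : M) : Prop := ∃ k, k ∈ omega M ∧ pr k x ∈ s ∧ IsDom (sc k) s

instance D.lastIs {Γ : Type} [Cx M Γ] (s x : Γ → M) [Tm s] [Tm x] :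
    D M fun γ => LastIs (s γ) (x γ) := by
  have h1 : ∀ {Δ : Type} [Cx M Δ] (π : Δ → Γ) [Pr M π], Tm fun δ => s (π δ) :=
    fun π => Tm.weaken s π
  have h2 : ∀ {Δ : Type} [Cx M Δ] (π : Δ → Γ) [Pr M π], Tm fun δ => x (π δ) :=
    fun π => Tm.weaken x π
  simp only [LastIs]
  infer_instance

lemma LastIs.mem {S R s x : M} (hs : s ∈ paths S R) (h : LastIs s x) : x ∈ S := by
  obtain ⟨k, _, hf⟩ := (mem_paths.1 hs).1
  obtain ⟨j, _, hj, _⟩ := h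
  exact (hf.1.mem hj).2

lemma exists_lastIs_of_immSucc {S R s t : M} (hs : s ∈ paths S R) (h : ImmSucc t s) :
    ∃ y, LastIs t y := by
  obtain ⟨k, y, hk, rfl⟩ := immSucc_iff.1 h
  obtain ⟨j, hj, hf⟩ := (mem_paths.1 hs).1
  rw [← hk.unique hf.isDom] at hj
  exact ⟨y, k, by simpa using hj, by simp, hk.snoc⟩

lemma LastIs.of_immSucc {S R s t x : M} (ht : t ∈ paths S R) (hx : LastIs s x)
    (h : ImmSucc t s) : ∃ y, LastIs t y ∧ pr y x ∈ R := by
  obtain ⟨k, y, hk, rfl⟩ := immSucc_iff.1 h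
  obtain ⟨j, hj, hjx, hd⟩ := hx
  obtain rfl := hk.unique hd
  refine ⟨y, ⟨sc j, by simpa using (mem_omega.1 hj).sc, by simp, hk.snoc⟩, ?_⟩
  exact (mem_paths.1 ht).2 j x y (by simp [hjx]) (by simp)

lemma LastIs.exists_immSucc {S R s x y : M} (hs : s ∈ paths S R) (hx : LastIs s x) (hy : y ∈ S)
    (h : pr y x ∈ R) : ∃ t, t ∈ paths S R ∧ ImmSucc t s ∧ LastIs t y := by
  obtain ⟨⟨k, hk, hf⟩, hp⟩ := mem_paths.1 hs
  obtain ⟨j, hj, hjx, hd⟩ := hx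
  obtain rfl := hd.unique hf.isDom
  refine ⟨un s (sing (pr (sc j) y)), mem_paths.2 ⟨?_, ?_⟩, immSucc_iff.2 ⟨sc j, y, hd, rfl⟩,
    sc j, by simpa using hk, by simp, hd.snoc⟩
  · exact ⟨_, hk.sc, hf.snoc (fun _ hw => hw) hy⟩
  · intro i a b ha hb
    simp only [mem_un, mem_sing, pr_inj] at ha hb
    rcases ha with ha | ⟨rfl, rfl⟩
    · rcases hb with hb | ⟨hi, rfl⟩
      · exact hp i a b ha hb
      · obtain rfl := sc_inj hi
        rwa [hf.unique ha hjx]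
    · have hm : sc j ∈ sc (sc j) := by simp
      rcases hb with hb | ⟨hi, _⟩
      · exact absurd (hf.1.mem hb).1 (mem_asymm hm)
      · rw [hi] at hm
        exact absurd hm (mem_irrefl _)

lemma exists_lastIs {S R x : M} (hx : x ∈ S) : ∃ s, s ∈ paths S R ∧ LastIs s x := by
  have h0 : Fun (emp M) (emp M) S := Fun.mk (by simp) (by simp) (by simp)
  refine ⟨un (emp M) (sing (pr (emp M) x)), mem_paths.2 ⟨⟨_, isNum_emp.sc,
    h0.snoc (fun _ hw => hw) hx⟩, fun i a b ha hb => ?_⟩, emp M, by simpa using isNum_emp,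
    by simp, h0.isDom.snoc⟩
  simp only [mem_un, not_mem_emp, mem_sing, pr_inj, false_or] at ha hb
  have hm : i ∈ sc i := by simp
  rw [hb.1] at hm
  simp at hm

/-- Choose a path in `Y` whose last entry is `R`-minimal; a successor in `Y` would end in a smaller
entry. If no path in `Y` has a last entry, none is an immediate successor of a path, so any element
of `Y` will do. -/
lemma wfTree_paths {S R : M} (h : WFRel R S) : WFTree (paths S R) := by
  rintro Y ⟨hY, w, hw⟩
  by_cases hl : ∃ s, s ∈ Y ∧ ∃ x, LastIs s x
  · obtain ⟨s, hs, x, hx⟩ := hl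
    obtain ⟨m, hm, hmin⟩ := h.2 (sep S fun x => ∃ s, s ∈ Y ∧ LastIs s x)
      ⟨fun z hz => (mem_sep.1 hz).1, x, mem_sep.2 ⟨hx.mem (hY s hs), s, hs, hx⟩⟩
    simp only [mem_sep, pairMem_iff] at hm hmin
    obtain ⟨hmS, s, hs, hsm⟩ := hm
    refine ⟨s, hs, fun t ht hts => ?_⟩
    obtain ⟨y, hy, hyR⟩ := hsm.of_immSucc (hY t ht) hts
    exact hmin y ⟨hy.mem (hY t ht), t, ht, hy⟩ hyR
  · refine ⟨w, hw, fun t ht htw => hl ⟨t, ht, exists_lastIs_of_immSucc (hY w hw) htw⟩⟩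

/-- `b` is a bisimulation on the relation `R` on `S`. -/
def GraphBisim (b S R : M) : Prop := ∀ x, x ∈ S → ∀ y, y ∈ S → (pr x y ∈ b ↔
  (∀ x', pr x' x ∈ R → ∃ y', pr y' y ∈ R ∧ pr x' y' ∈ b) ∧
  (∀ y', pr y' y ∈ R → ∃ x', pr x' x ∈ R ∧ pr x' y' ∈ b))

/-- The part of the tree of paths above a nonempty path is determined by its last entry, and every
point of `S` is the last entry of some path. -/
theorem exists_graphBisim (hM : ∀ T : M, Tree T → WFTree T → ∃ b, Bisim b T) {S R : M}
    (h : WFRel R S) : ∃ b, GraphBisim b S R := by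
  obtain ⟨b, _, hb⟩ := hM _ (tree_paths S R) (wfTree_paths h)
  simp only [pairMem_iff] at hb
  let T := paths S R
  have hT : paths S R = T := rfl
  rw [hT] at hb
  -- Paths with the same last entry can be exchanged: every extension of one is mirrored by an
  -- extension of the other with the same new entry, to which the induction hypothesis applies.
  have key : ∀ x, x ∈ S → ∀ y, y ∈ S → ∀ s, s ∈ T → ∀ s', s' ∈ T → ∀ t, t ∈ T → ∀ t', t' ∈ T →
      LastIs s x → LastIs s' x → LastIs t y → LastIs t' y → pr s t ∈ b → pr s' t' ∈ b := by
    refine h.induction fun x hx ih y hy s hs s' hs' t ht t' ht' hsx hsx' hty hty' hst => ?_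
    rw [hb s hs t ht] at hst
    rw [hb s' hs' t' ht']
    constructor
    · intro σ' hσ' hi'
      obtain ⟨z, hz, hzR⟩ := hsx'.of_immSucc hσ' hi'
      have hzS := (h.1.mem hzR).1
      obtain ⟨σ, hσ, hi, hσz⟩ := hsx.exists_immSucc hs hzS hzR
      obtain ⟨τ, hτ, hj, hστ⟩ := hst.1 σ hσ hi
      obtain ⟨w, hw, hwR⟩ := hty.of_immSucc hτ hj
      have hwS := (h.1.mem hwR).1
      obtain ⟨τ', hτ', hj', hτw⟩ := hty'.exists_immSucc ht' hwS hwR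
      exact ⟨τ', hτ', hj', ih z hzS hzR w hwS σ hσ σ' hσ' τ hτ τ' hτ' hσz hz hw hτw hστ⟩
    · intro τ' hτ' hj'
      obtain ⟨w, hw, hwR⟩ := hty'.of_immSucc hτ' hj'
      have hwS := (h.1.mem hwR).1
      obtain ⟨τ, hτ, hj, hτw⟩ := hty.exists_immSucc ht hwS hwR
      obtain ⟨σ, hσ, hi, hστ⟩ := hst.2 τ hτ hj
      obtain ⟨z, hz, hzR⟩ := hsx.of_immSucc hσ hi
      have hzS := (h.1.mem hzR).1
      obtain ⟨σ', hσ', hi', hσz⟩ := hsx'.exists_immSucc hs' hzS hzR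
      exact ⟨σ', hσ', hi', ih z hzS hzR w hwS σ hσ σ' hσ' τ hτ τ' hτ' hz hσz hτw hw hστ⟩
  let c := sep (prod S S) fun z => ∃ x, x ∈ S ∧ ∃ y, y ∈ S ∧ z = pr x y ∧
    ∃ s, s ∈ T ∧ ∃ t, t ∈ T ∧ LastIs s x ∧ LastIs t y ∧ pr s t ∈ b
  have hc : ∀ {x y s t}, s ∈ T → t ∈ T → LastIs s x → LastIs t y →
      (pr x y ∈ c ↔ pr s t ∈ b) := by
    intro x y s t hs ht hsx hty
    have hx := hsx.mem hs
    have hy := hty.mem ht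
    simp only [c, mem_sep, pr_mem_prod, pr_inj]
    constructor
    · rintro ⟨_, _, _, _, _, ⟨rfl, rfl⟩, s', hs', t', ht', hsx', hty', hst⟩
      exact key x hx y hy s' hs' s hs t' ht' t ht hsx' hsx hty' hty hst
    · exact fun hst => ⟨⟨hx, hy⟩, x, hx, y, hy, ⟨rfl, rfl⟩, s, hs, t, ht, hsx, hty, hst⟩
  refine ⟨c, fun x hx y hy => ?_⟩
  obtain ⟨s, hs, hsx⟩ := exists_lastIs (R := R) hx
  obtain ⟨t, ht, hty⟩ := exists_lastIs (R := R) hy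
  rw [hc hs ht hsx hty, hb s hs t ht]
  constructor
  · rintro ⟨h1, h2⟩
    constructor
    · intro z hzR
      obtain ⟨σ, hσ, hi, hσz⟩ := hsx.exists_immSucc hs (h.1.mem hzR).1 hzR
      obtain ⟨τ, hτ, hj, hστ⟩ := h1 σ hσ hi
      obtain ⟨w, hw, hwR⟩ := hty.of_immSucc hτ hj
      exact ⟨w, hwR, (hc hσ hτ hσz hw).2 hστ⟩
    · intro w hwR
      obtain ⟨τ, hτ, hj, hτw⟩ := hty.exists_immSucc ht (h.1.mem hwR).1 hwR
      obtain ⟨σ, hσ, hi, hστ⟩ := h2 τ hτ hj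
      obtain ⟨z, hz, hzR⟩ := hsx.of_immSucc hσ hi
      exact ⟨z, hzR, (hc hσ hτ hz hτw).2 hστ⟩
  · rintro ⟨h1, h2⟩
    constructor
    · intro σ hσ hi
      obtain ⟨z, hz, hzR⟩ := hsx.of_immSucc hσ hi
      obtain ⟨w, hwR, hzw⟩ := h1 z hzR
      obtain ⟨τ, hτ, hj, hτw⟩ := hty.exists_immSucc ht (h.1.mem hwR).1 hwR
      exact ⟨τ, hτ, hj, (hc hσ hτ hz hτw).1 hzw⟩
    · intro τ hτ hj
      obtain ⟨w, hw, hwR⟩ := hty.of_immSucc hτ hj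
      obtain ⟨z, hzR, hzw⟩ := h2 w hwR
      obtain ⟨σ, hσ, hi, hσz⟩ := hsx.exists_immSucc hs (h.1.mem hzR).1 hzR
      exact ⟨σ, hσ, hi, (hc hσ hτ hσz hw).1 hzw⟩

/-! ### Bisimilarity as equality of images -/

/-- A bisimulation on a well founded relation is the kernel of a map into some type such that the
image of a point is determined by the set of images of its predecessors. -/
lemma exists_collapse {b S R : M} (h : WFRel R S) (hb : GraphBisim b S R) :
    ∃ q : M → Set M, (∀ x, x ∈ S → ∀ y, y ∈ S → (pr x y ∈ b ↔ q x = q y)) ∧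
      ∀ x, x ∈ S → ∀ y, y ∈ S →
        (q x = q y ↔ q '' {x' | pr x' x ∈ R} = q '' {y' | pr y' y ∈ R}) := by
  have hS : ∀ {x y}, pr x y ∈ R → x ∈ S := fun hxy => (h.1.mem hxy).1
  -- Since `GraphBisim` is a biconditional, induction along `R` shows that `b` is an equivalence
  -- relation on `S`.
  have hrefl : ∀ x, x ∈ S → pr x x ∈ b := h.induction fun x hx ih =>
    (hb x hx x hx).2 ⟨fun z hz => ⟨z, hz, ih z (hS hz) hz⟩, fun z hz => ⟨z, hz, ih z (hS hz) hz⟩⟩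
  have hsymm : ∀ x, x ∈ S → ∀ y, y ∈ S → pr x y ∈ b → pr y x ∈ b := by
    refine h.induction fun x hx ih y hy hxy => ?_
    rw [hb x hx y hy] at hxy
    refine (hb y hy x hx).2 ⟨fun w hw => ?_, fun z hz => ?_⟩
    · obtain ⟨z, hz, hzw⟩ := hxy.2 w hw
      exact ⟨z, hz, ih z (hS hz) hz w (hS hw) hzw⟩
    · obtain ⟨w, hw, hzw⟩ := hxy.1 z hz
      exact ⟨w, hw, ih z (hS hz) hz w (hS hw) hzw⟩
  have htrans : ∀ x, x ∈ S → ∀ y, y ∈ S → ∀ z, z ∈ S → pr x y ∈ b → pr y z ∈ b → pr x z ∈ b := by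
    refine h.induction fun x hx ih y hy z hz hxy hyz => ?_
    rw [hb x hx y hy] at hxy
    rw [hb y hy z hz] at hyz
    refine (hb x hx z hz).2 ⟨fun u hu => ?_, fun w hw => ?_⟩
    · obtain ⟨v, hv, huv⟩ := hxy.1 u hu
      obtain ⟨w, hw, hvw⟩ := hyz.1 v hv
      exact ⟨w, hw, ih u (hS hu) hu v (hS hv) w (hS hw) huv hvw⟩
    · obtain ⟨v, hv, hvw⟩ := hyz.2 w hw
      obtain ⟨u, hu, huv⟩ := hxy.2 v hv
      exact ⟨u, hu, ih u (hS hu) hu v (hS hv) w (hS hw) huv hvw⟩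
  have hq : ∀ x, x ∈ S → ∀ y, y ∈ S →
      (pr x y ∈ b ↔ {z | z ∈ S ∧ pr x z ∈ b} = {z | z ∈ S ∧ pr y z ∈ b}) := by
    intro x hx y hy
    constructor
    · intro hxy
      refine Set.ext fun z => and_congr_right fun hz => ⟨fun h' => ?_, fun h' => ?_⟩
      · exact htrans y hy x hx z hz (hsymm x hx y hy hxy) h'
      · exact htrans x hx y hy z hz hxy h'
    · intro h'
      have : y ∈ {z | z ∈ S ∧ pr x z ∈ b} := h' ▸ ⟨hy, hrefl y hy⟩
      exact this.2
  -- The equivalence classes are Lean sets outside the model, so no collapse has to exist in `M`.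
  refine ⟨fun x => {z | z ∈ S ∧ pr x z ∈ b}, hq, fun x hx y hy => ?_⟩
  rw [← hq x hx y hy, hb x hx y hy, Set.Subset.antisymm_iff]
  refine and_congr ?_ ?_
  · simp only [Set.image_subset_iff]
    refine forall_congr' fun z => forall_congr' fun hz => ?_
    refine exists_congr fun w => and_congr_right fun hw => ?_
    exact (hq z (hS hz) w (hS hw)).trans eq_comm
  · simp only [Set.image_subset_iff]
    refine forall_congr' fun w => forall_congr' fun hw => ?_
    refine exists_congr fun z => and_congr_right fun hz => ?_
    exact (hq z (hS hz) w (hS hw))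

end Graph

/-! ### Winning positions of well founded games -/

section Kernel

variable {M : Type} [Lset.Structure M] [hB : Theory.Model M B]

variable (M) in
/-- The numerals. -/
noncomputable def num : ℕ → M
  | 0 => emp M
  | n + 1 => sc (num n)

lemma num_isNum (n : ℕ) : IsNum (num M n) := by
  induction n with
  | zero => exact isNum_emp
  | succ n ih => exact ih.sc

lemma num_mem_num {m n : ℕ} (h : m < n) : num M m ∈ num M n := by
  induction n with
  | zero => omega
  | succ n ih =>
    simp only [num, mem_sc]
    rcases Nat.lt_succ_iff_lt_or_eq.1 h with h | rfl
    · exact Or.inl (ih h)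
    · exact Or.inr rfl

@[simp] lemma num_inj {m n : ℕ} : num M m = num M n ↔ m = n := by
  refine ⟨fun h => ?_, fun h => by rw [h]⟩
  rcases lt_trichotomy m n with h' | h' | h'
  · exact absurd (num_mem_num (M := M) h') (h ▸ mem_irrefl _)
  · exact h'
  · exact absurd (num_mem_num (M := M) h') (h ▸ mem_irrefl _)

/-! ### The graph that codes a game -/

namespace Gadget

-- Numerals tag the kinds of nodes. Writing a node as the set of its predecessors, with `i` and `j`
-- ranging over the moves from `n`: `b n = {t n} ∪ {y n i}`, `a n = b n ∪ {z n}`, `v n = b n ∪ {g n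
-- i}`, `z n = {b j}`, `y n i = {b j : j ≠ i} ∪ {a i}`, `g n i = {b j : j ≠ i} ∪ {v i}`. If `v i`
-- equals `a i`, then `g n i` equals `y n i` and adds nothing to `b n`; if `v i` equals `b i`, then
-- `g n i` equals `z n` and turns `b n` into `a n`. So `v n` equals `a n` exactly when some move
-- leads to a losing position. The element `t n` makes nodes for different positions differ.
variable (M) in
noncomputable abbrev o : M := pr (num M 0) (emp M)
noncomputable abbrev t (x : M) : M := pr (num M 1) x
noncomputable abbrev b (n : M) : M := pr (num M 2) n
noncomputable abbrev a (n : M) : M := pr (num M 3) n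
noncomputable abbrev v (n : M) : M := pr (num M 4) n
noncomputable abbrev z (n : M) : M := pr (num M 5) n
noncomputable abbrev y (n i : M) : M := pr (num M 6) (pr n i)
noncomputable abbrev g (n i : M) : M := pr (num M 7) (pr n i)

/-- The edges of a graph in which `v n` will be bisimilar to `a n` or to `b n`, according to
whether the position `n` is winning or losing in the game with moves `R` on `N`. The nodes `t x`
represent the elements of the transitive set `τ` and serve to make everything rigid. -/
def Edge (τ N R c p : M) : Prop :=
  (∃ x, x ∈ τ ∧ p = t x ∧ (c = o M ∨ ∃ y, y ∈ x ∧ c = t y)) ∨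
  (∃ n, n ∈ N ∧ (p = b n ∨ p = a n ∨ p = v n) ∧
    (c = t n ∨ ∃ i, i ∈ N ∧ pr i n ∈ R ∧ c = y n i)) ∨
  (∃ n, n ∈ N ∧ p = a n ∧ c = z n) ∨
  (∃ n, n ∈ N ∧ p = v n ∧ ∃ i, i ∈ N ∧ pr i n ∈ R ∧ c = g n i) ∨
  (∃ n, n ∈ N ∧ p = z n ∧ ∃ j, j ∈ N ∧ pr j n ∈ R ∧ c = b j) ∨
  (∃ n, n ∈ N ∧ ∃ i, i ∈ N ∧ pr i n ∈ R ∧ (p = y n i ∨ p = g n i) ∧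
    ∃ j, j ∈ N ∧ pr j n ∈ R ∧ j ≠ i ∧ c = b j) ∨
  (∃ n, n ∈ N ∧ ∃ i, i ∈ N ∧ pr i n ∈ R ∧ p = y n i ∧ c = a i) ∨
  (∃ n, n ∈ N ∧ ∃ i, i ∈ N ∧ pr i n ∈ R ∧ p = g n i ∧ c = v i)

variable {τ N R : M}

lemma edge_o (c : M) : ¬ Edge τ N R c (o M) := by simp [Edge]

lemma edge_t {x : M} (hx : x ∈ τ) (c : M) :
    Edge τ N R c (t x) ↔ c = o M ∨ ∃ y, y ∈ x ∧ c = t y := by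
  simp [Edge, hx]

instance {Γ : Type} [Cx M Γ] (c p : Γ → M) [Tm c] [Tm p] :
    D M fun γ => Edge τ N R (c γ) (p γ) := by
  have h1 : ∀ {Δ : Type} [Cx M Δ] (π : Δ → Γ) [Pr M π], Tm fun δ => c (π δ) :=
    fun π => Tm.weaken c π
  have h2 : ∀ {Δ : Type} [Cx M Δ] (π : Δ → Γ) [Pr M π], Tm fun δ => p (π δ) :=
    fun π => Tm.weaken p π
  simp only [Edge]
  infer_instance

lemma edge_b (hR : RelBetween R N N) {n : M} (hn : n ∈ N) (c : M) :
    Edge τ N R c (b n) ↔ c = t n ∨ ∃ i, pr i n ∈ R ∧ c = y n i := by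
  have : ∀ i, pr i n ∈ R → i ∈ N := fun i hi => (hR.mem hi).1
  simp [Edge, hn]
  grind

lemma edge_a (hR : RelBetween R N N) {n : M} (hn : n ∈ N) (c : M) :
    Edge τ N R c (a n) ↔ (c = t n ∨ ∃ i, pr i n ∈ R ∧ c = y n i) ∨ c = z n := by
  have : ∀ i, pr i n ∈ R → i ∈ N := fun i hi => (hR.mem hi).1
  simp [Edge, hn]
  grind

lemma edge_v (hR : RelBetween R N N) {n : M} (hn : n ∈ N) (c : M) :
    Edge τ N R c (v n) ↔ (c = t n ∨ ∃ i, pr i n ∈ R ∧ c = y n i) ∨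
      ∃ i, pr i n ∈ R ∧ c = g n i := by
  have : ∀ i, pr i n ∈ R → i ∈ N := fun i hi => (hR.mem hi).1
  simp [Edge, hn]
  grind

lemma edge_z (hR : RelBetween R N N) {n : M} (hn : n ∈ N) (c : M) :
    Edge τ N R c (z n) ↔ ∃ j, pr j n ∈ R ∧ c = b j := by
  have : ∀ i, pr i n ∈ R → i ∈ N := fun i hi => (hR.mem hi).1
  simp [Edge, hn]
  grind

lemma edge_y (hR : RelBetween R N N) {n i : M} (hi : pr i n ∈ R) (c : M) :
    Edge τ N R c (y n i) ↔ (∃ j, pr j n ∈ R ∧ j ≠ i ∧ c = b j) ∨ c = a i := by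
  have : ∀ i, pr i n ∈ R → i ∈ N := fun i hi => (hR.mem hi).1
  have hn := (hR.mem hi).2
  simp [Edge, hn, hi, this i hi]
  grind

lemma edge_g (hR : RelBetween R N N) {n i : M} (hi : pr i n ∈ R) (c : M) :
    Edge τ N R c (g n i) ↔ (∃ j, pr j n ∈ R ∧ j ≠ i ∧ c = b j) ∨ c = v i := by
  have : ∀ i, pr i n ∈ R → i ∈ N := fun i hi => (hR.mem hi).1
  have hn := (hR.mem hi).2
  simp [Edge, hn, hi, this i hi]
  grind

end Gadget

-- Well-foundedness combines `∈`-induction for the nodes `t x` with induction along `R` for `b n`,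
-- `a n`, `v n`; the nodes `z n`, `y n i`, `g n i` only use positions reached by a move from `n`.
open Gadget in
lemma exists_gadget {N R : M} (h : WFRel R N) : ∃ τ S E : M, Sub N τ ∧ Tran τ ∧ WFRel E S ∧
    o M ∈ S ∧ (∀ (k : ℕ) (x : M), x ∈ τ → pr (num M k) x ∈ S) ∧
    (∀ (k : ℕ) (x y : M), pr x y ∈ R → pr (num M k) (pr y x) ∈ S) ∧
    ∀ c p, pr c p ∈ E ↔ Edge τ N R c p := by
  obtain ⟨τ, hNτ, hτ⟩ := exists_tc N
  have hR := h.1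
  have hRN : ∀ {i n}, pr i n ∈ R → i ∈ N ∧ n ∈ N := fun hi => hR.mem hi
  -- A crude set containing all the nodes. Its other points have no predecessors in the graph and do
  -- no harm.
  let S := prod (omega M) (un (sing (emp M)) (un τ (prod τ τ)))
  have hoS : o M ∈ S := by simp [S, num_isNum]
  have hS1 : ∀ (k : ℕ) (x : M), x ∈ τ → pr (num M k) x ∈ S := by
    intro k x hx
    simp [S, num_isNum, hx]
  have hS2 : ∀ (k : ℕ) (x y : M), pr x y ∈ R → pr (num M k) (pr y x) ∈ S := by
    intro k x y hx
    simp [S, num_isNum, hNτ _ (hRN hx).1, hNτ _ (hRN hx).2]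
  let E := sep (prod S S) fun z => ∃ c, c ∈ S ∧ ∃ p, p ∈ S ∧ z = pr c p ∧ Edge τ N R c p
  have hmE : ∀ c p, pr c p ∈ E ↔ (c ∈ S ∧ p ∈ S) ∧ Edge τ N R c p := by
    intro c p
    simp only [E, mem_sep, pr_mem_prod, pr_inj]
    constructor
    · rintro ⟨h1, _, _, _, _, ⟨rfl, rfl⟩, h2⟩
      exact ⟨h1, h2⟩
    · rintro ⟨h1, h2⟩
      exact ⟨h1, c, h1.1, p, h1.2, ⟨rfl, rfl⟩, h2⟩
  have hE : ∀ c p, pr c p ∈ E ↔ Edge τ N R c p := by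
    intro c p
    rw [hmE, and_iff_right_iff_imp]
    rintro (⟨x, hx, rfl, rfl | ⟨y, hy, rfl⟩⟩ | ⟨n, hn, rfl | rfl | rfl, rfl | ⟨i, _, hi, rfl⟩⟩ |
      ⟨n, hn, rfl, rfl⟩ | ⟨n, hn, rfl, i, _, hi, rfl⟩ | ⟨n, hn, rfl, j, hj, _, rfl⟩ |
      ⟨n, hn, i, _, hi, rfl | rfl, j, hj, _, _, rfl⟩ | ⟨n, hn, i, hiN, hi, rfl, rfl⟩ |
      ⟨n, hn, i, hiN, hi, rfl, rfl⟩) <;>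
    constructor <;>
    first
    | exact hoS
    | exact hS2 _ _ _ hi
    | exact hS1 _ _ hx
    | exact hS1 _ _ (hτ _ hx _ hy)
    | exact hS1 _ _ (hNτ _ hn)
    | exact hS1 _ _ (hNτ _ hj)
    | exact hS1 _ _ (hNτ _ hiN)
  have hwf : WFRel E S := by
    refine wfRel_of_induction (fun z hz => (mem_sep.1 hz).1) fun Y hY => ?_
    have hY' : ∀ p, p ∈ S → (∀ c, Edge τ N R c p → c ∈ Y) → p ∈ Y := by
      intro p hp hc
      exact hY p hp fun c _ hcp => hc c ((hE _ _).1 hcp)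
    have ho : o M ∈ Y := hY' _ hoS fun c hc => absurd hc (edge_o c)
    have ht : ∀ x, x ∈ τ → t x ∈ Y := by
      refine mem_induction fun x ih hx => hY' _ (hS1 _ _ hx) fun c hc => ?_
      rcases (edge_t hx c).1 hc with rfl | ⟨y, hy, rfl⟩
      · exact ho
      · exact ih y hy (hτ x hx y hy)
    have hsub : ∀ n, n ∈ N → (∀ i, pr i n ∈ R → b i ∈ Y ∧ a i ∈ Y ∧ v i ∈ Y) →
        z n ∈ Y ∧ ∀ i, pr i n ∈ R → y n i ∈ Y ∧ g n i ∈ Y := by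
      intro n hn ih
      refine ⟨hY' _ (hS1 _ _ (hNτ _ hn)) fun c hc => ?_, fun i hi =>
        ⟨hY' _ (hS2 _ _ _ hi) fun c hc => ?_, hY' _ (hS2 _ _ _ hi) fun c hc => ?_⟩⟩
      · obtain ⟨j, hj, rfl⟩ := (edge_z hR hn c).1 hc
        exact (ih j hj).1
      · rcases (edge_y hR hi c).1 hc with ⟨j, hj, _, rfl⟩ | rfl
        · exact (ih j hj).1
        · exact (ih i hi).2.1
      · rcases (edge_g hR hi c).1 hc with ⟨j, hj, _, rfl⟩ | rfl
        · exact (ih j hj).1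
        · exact (ih i hi).2.2
    have hbav : ∀ n, n ∈ N → b n ∈ Y ∧ a n ∈ Y ∧ v n ∈ Y := by
      refine h.induction fun n hn ih => ?_
      obtain ⟨hz, hyg⟩ := hsub n hn fun i hi => ih i (hRN hi).1 hi
      have htn := ht n (hNτ _ hn)
      have hnS := fun k => hS1 k _ (hNτ _ hn)
      refine ⟨hY' _ (hnS _) fun c hc => ?_, hY' _ (hnS _) fun c hc => ?_,
        hY' _ (hnS _) fun c hc => ?_⟩
      · rcases (edge_b hR hn c).1 hc with rfl | ⟨i, hi, rfl⟩
        · exact htn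
        · exact (hyg i hi).1
      · rcases (edge_a hR hn c).1 hc with (rfl | ⟨i, hi, rfl⟩) | rfl
        · exact htn
        · exact (hyg i hi).1
        · exact hz
      · rcases (edge_v hR hn c).1 hc with (rfl | ⟨i, hi, rfl⟩) | ⟨i, hi, rfl⟩
        · exact htn
        · exact (hyg i hi).1
        · exact (hyg i hi).2
    -- Whatever `p` is, its predecessors are genuine nodes, and these are already known to lie in
    -- `Y`.
    intro p hp
    refine hY' p hp ?_
    have hyg := fun n hn => hsub n hn fun i hi => hbav i (hRN hi).1
    rintro c (⟨x, hx, rfl, rfl | ⟨y, hy, rfl⟩⟩ | ⟨n, hn, _, rfl | ⟨i, _, hi, rfl⟩⟩ |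
      ⟨n, hn, rfl, rfl⟩ | ⟨n, hn, rfl, i, _, hi, rfl⟩ | ⟨n, hn, rfl, j, hj, _, rfl⟩ |
      ⟨n, hn, i, _, hi, _, j, hj, _, _, rfl⟩ | ⟨n, hn, i, hiN, hi, rfl, rfl⟩ |
      ⟨n, hn, i, hiN, hi, rfl, rfl⟩)
    · exact ho
    · exact ht _ (hτ _ hx _ hy)
    · exact ht _ (hNτ _ hn)
    · exact ((hyg n hn).2 i hi).1
    · exact (hyg n hn).1
    · exact ((hyg n hn).2 i hi).2
    · exact (hbav j hj).1
    · exact (hbav j hj).1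
    · exact (hbav i hiN).2.1
    · exact (hbav i hiN).2.2
  exact ⟨τ, S, E, hNτ, hτ, hwf, hoS, hS1, hS2, hE⟩

-- The winning positions are those `n` for which `v n` is not bisimilar to `b n`. What has to be
-- shown is that `v n` always equals `a n` or `b n` up to bisimilarity, and that these two differ.
open Gadget in
theorem exists_kernel (hM : ∀ T : M, Tree T → WFTree T → ∃ b, Bisim b T) {N R : M}
    (h : WFRel R N) :
    ∃ W : M, ∀ n, n ∈ N → (n ∈ W ↔ ∃ m, m ∈ N ∧ pr m n ∈ R ∧ m ∉ W) := by
  have hR := h.1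
  have hRN : ∀ {i n}, pr i n ∈ R → i ∈ N ∧ n ∈ N := fun hi => hR.mem hi
  obtain ⟨τ, S, E, hNτ, hτ, hwf, hoS, hS1, hS2, hE⟩ := exists_gadget h
  obtain ⟨B, hB⟩ := exists_graphBisim hM hwf
  obtain ⟨q, hqB, hq⟩ := exists_collapse hwf hB
  let C : M → Set M → Prop := fun p u => ∃ c, Edge τ N R c p ∧ q c = u
  have hqC : ∀ x, x ∈ S → ∀ y, y ∈ S → (q x = q y ↔ ∀ u, C x u ↔ C y u) := by
    intro x hx y hy
    rw [hq x hx y hy, Set.ext_iff]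
    simp only [Set.mem_image, Set.mem_ofPred_eq, hE, C]
  have hC_o : ∀ u, ¬ C (o M) u := by
    rintro u ⟨c, hc, _⟩
    exact edge_o c hc
  have hC_t : ∀ x, x ∈ τ → ∀ u, C (t x) u ↔ u = q (o M) ∨ ∃ y, y ∈ x ∧ u = q (t y) := by
    intro x hx u
    constructor
    · rintro ⟨c, hc, rfl⟩
      rcases (edge_t hx c).1 hc with rfl | ⟨y, hy, rfl⟩
      exacts [Or.inl rfl, Or.inr ⟨y, hy, rfl⟩]
    · rintro (rfl | ⟨y, hy, rfl⟩)
      exacts [⟨_, (edge_t hx _).2 (Or.inl rfl), rfl⟩,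
        ⟨_, (edge_t hx _).2 (Or.inr ⟨y, hy, rfl⟩), rfl⟩]
  have hC_b : ∀ n, n ∈ N → ∀ u, C (b n) u ↔ u = q (t n) ∨ ∃ i, pr i n ∈ R ∧ u = q (y n i) := by
    intro n hn u
    constructor
    · rintro ⟨c, hc, rfl⟩
      rcases (edge_b hR hn c).1 hc with rfl | ⟨i, hi, rfl⟩
      exacts [Or.inl rfl, Or.inr ⟨i, hi, rfl⟩]
    · rintro (rfl | ⟨i, hi, rfl⟩)
      exacts [⟨_, (edge_b hR hn _).2 (Or.inl rfl), rfl⟩,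
        ⟨_, (edge_b hR hn _).2 (Or.inr ⟨i, hi, rfl⟩), rfl⟩]
  have hC_a : ∀ n, n ∈ N → ∀ u, C (a n) u ↔ C (b n) u ∨ u = q (z n) := by
    intro n hn u
    constructor
    · rintro ⟨c, hc, rfl⟩
      rcases (edge_a hR hn c).1 hc with hc | rfl
      exacts [Or.inl ⟨_, (edge_b hR hn _).2 hc, rfl⟩, Or.inr rfl]
    · rintro (⟨c, hc, rfl⟩ | rfl)
      exacts [⟨_, (edge_a hR hn _).2 (Or.inl ((edge_b hR hn _).1 hc)), rfl⟩,
        ⟨_, (edge_a hR hn _).2 (Or.inr rfl), rfl⟩]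
  have hC_v : ∀ n, n ∈ N → ∀ u, C (v n) u ↔ C (b n) u ∨ ∃ i, pr i n ∈ R ∧ u = q (g n i) := by
    intro n hn u
    constructor
    · rintro ⟨c, hc, rfl⟩
      rcases (edge_v hR hn c).1 hc with hc | ⟨i, hi, rfl⟩
      exacts [Or.inl ⟨_, (edge_b hR hn _).2 hc, rfl⟩, Or.inr ⟨i, hi, rfl⟩]
    · rintro (⟨c, hc, rfl⟩ | ⟨i, hi, rfl⟩)
      exacts [⟨_, (edge_v hR hn _).2 (Or.inl ((edge_b hR hn _).1 hc)), rfl⟩,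
        ⟨_, (edge_v hR hn _).2 (Or.inr ⟨i, hi, rfl⟩), rfl⟩]
  have hC_z : ∀ n, n ∈ N → ∀ u, C (z n) u ↔ ∃ j, pr j n ∈ R ∧ u = q (b j) := by
    intro n hn u
    constructor
    · rintro ⟨c, hc, rfl⟩
      obtain ⟨j, hj, rfl⟩ := (edge_z hR hn c).1 hc
      exact ⟨j, hj, rfl⟩
    · rintro ⟨j, hj, rfl⟩
      exact ⟨_, (edge_z hR hn _).2 ⟨j, hj, rfl⟩, rfl⟩
  have hC_y : ∀ n i, pr i n ∈ R → ∀ u, C (y n i) u ↔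
      (∃ j, pr j n ∈ R ∧ j ≠ i ∧ u = q (b j)) ∨ u = q (a i) := by
    intro n i hi u
    constructor
    · rintro ⟨c, hc, rfl⟩
      rcases (edge_y hR hi c).1 hc with ⟨j, hj, hji, rfl⟩ | rfl
      exacts [Or.inl ⟨j, hj, hji, rfl⟩, Or.inr rfl]
    · rintro (⟨j, hj, hji, rfl⟩ | rfl)
      exacts [⟨_, (edge_y hR hi _).2 (Or.inl ⟨j, hj, hji, rfl⟩), rfl⟩,
        ⟨_, (edge_y hR hi _).2 (Or.inr rfl), rfl⟩]
  have hC_g : ∀ n i, pr i n ∈ R → ∀ u, C (g n i) u ↔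
      (∃ j, pr j n ∈ R ∧ j ≠ i ∧ u = q (b j)) ∨ u = q (v i) := by
    intro n i hi u
    constructor
    · rintro ⟨c, hc, rfl⟩
      rcases (edge_g hR hi c).1 hc with ⟨j, hj, hji, rfl⟩ | rfl
      exacts [Or.inl ⟨j, hj, hji, rfl⟩, Or.inr rfl]
    · rintro (⟨j, hj, hji, rfl⟩ | rfl)
      exacts [⟨_, (edge_g hR hi _).2 (Or.inl ⟨j, hj, hji, rfl⟩), rfl⟩,
        ⟨_, (edge_g hR hi _).2 (Or.inr rfl), rfl⟩]
  clear_value C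
  have hbS : ∀ n, n ∈ N → b n ∈ S := fun n hn => hS1 _ _ (hNτ _ hn)
  have haS : ∀ n, n ∈ N → a n ∈ S := fun n hn => hS1 _ _ (hNτ _ hn)
  have hvS : ∀ n, n ∈ N → v n ∈ S := fun n hn => hS1 _ _ (hNτ _ hn)
  have hzS : ∀ n, n ∈ N → z n ∈ S := fun n hn => hS1 _ _ (hNτ _ hn)
  have hyS : ∀ n i, pr i n ∈ R → y n i ∈ S := fun n i hi => hS2 _ _ _ hi
  have hgS : ∀ n i, pr i n ∈ R → g n i ∈ S := fun n i hi => hS2 _ _ _ hi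
  have htS : ∀ x, x ∈ τ → t x ∈ S := fun x hx => hS1 _ _ hx
  -- nodes with a predecessor are not bisimilar to the node without predecessors
  have hne_o : ∀ p, p ∈ S → (∃ u, C p u) → q (o M) ≠ q p := by
    rintro p hp ⟨u, hu⟩ he
    exact hC_o u (((hqC _ hoS _ hp).1 he u).2 hu)
  have hCb : ∀ n, n ∈ N → C (b n) (q (t n)) := fun n hn => (hC_b n hn _).2 (Or.inl rfl)
  have hCa : ∀ n, n ∈ N → C (a n) (q (t n)) := fun n hn => (hC_a n hn _).2 (Or.inl (hCb n hn))
  have hCv : ∀ n, n ∈ N → C (v n) (q (t n)) := fun n hn => (hC_v n hn _).2 (Or.inl (hCb n hn))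
  have hot : ∀ x, x ∈ τ → q (o M) ≠ q (t x) := fun x hx =>
    hne_o _ (htS x hx) ⟨_, (hC_t x hx _).2 (Or.inl rfl)⟩
  have hob : ∀ n, n ∈ N → q (o M) ≠ q (b n) := fun n hn => hne_o _ (hbS n hn) ⟨_, hCb n hn⟩
  have hoa : ∀ n, n ∈ N → q (o M) ≠ q (a n) := fun n hn => hne_o _ (haS n hn) ⟨_, hCa n hn⟩
  have hov : ∀ n, n ∈ N → q (o M) ≠ q (v n) := fun n hn => hne_o _ (hvS n hn) ⟨_, hCv n hn⟩
  -- the nodes `t x` are rigid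
  have ht_inj : ∀ x, x ∈ τ → ∀ y, y ∈ τ → q (t x) = q (t y) → x = y := by
    -- The induction is stated with `B` because `q` lives outside the model and may not occur in a
    -- `Δ₀` condition. The same device recurs below.
    have : ∀ x, x ∈ τ → ∀ y, y ∈ τ → pr (t x) (t y) ∈ B → x = y := by
      refine mem_induction fun x ih hx y hy hxy => ?_
      rw [hqB _ (htS x hx) _ (htS y hy), hqC _ (htS x hx) _ (htS y hy)] at hxy
      have ih : ∀ w, w ∈ x → ∀ w', w' ∈ y → q (t w) = q (t w') → w = w' := fun w hw w' hw' hww' =>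
        ih w hw (hτ x hx w hw) w' (hτ y hy w' hw')
          ((hqB _ (htS _ (hτ x hx w hw)) _ (htS _ (hτ y hy w' hw'))).2 hww')
      refine ext fun w => ⟨fun hw => ?_, fun hw => ?_⟩
      · have := (hxy (q (t w))).1 ((hC_t x hx _).2 (Or.inr ⟨w, hw, rfl⟩))
        rcases (hC_t y hy _).1 this with h1 | ⟨w', hw', h1⟩
        · exact absurd h1.symm (hot w (hτ x hx w hw))
        · rwa [ih w hw w' hw' h1]
      · have := (hxy (q (t w))).2 ((hC_t y hy _).2 (Or.inr ⟨w, hw, rfl⟩))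
        rcases (hC_t x hx _).1 this with h1 | ⟨w', hw', h1⟩
        · exact absurd h1.symm (hot w (hτ y hy w hw))
        · rwa [← ih w' hw' w hw h1.symm]
    exact fun x hx y hy hxy => this x hx y hy ((hqB _ (htS x hx) _ (htS y hy)).2 hxy)
  have ht_ne : ∀ x, x ∈ τ → ∀ p, p ∈ S → ¬ C p (q (o M)) → q (t x) ≠ q p := by
    intro x hx p hp hpo he
    exact hpo (((hqC _ (htS x hx) _ hp).1 he _).1 ((hC_t x hx _).2 (Or.inl rfl)))
  have htz : ∀ x, x ∈ τ → ∀ n, n ∈ N → q (t x) ≠ q (z n) := by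
    refine fun x hx n hn => ht_ne x hx _ (hzS n hn) fun hc => ?_
    obtain ⟨j, hj, he⟩ := (hC_z n hn _).1 hc
    exact hob j (hRN hj).1 he
  have hty : ∀ x, x ∈ τ → ∀ n i, pr i n ∈ R → q (t x) ≠ q (y n i) := by
    refine fun x hx n i hi => ht_ne x hx _ (hyS n i hi) fun hc => ?_
    rcases (hC_y n i hi _).1 hc with ⟨j, hj, _, he⟩ | he
    · exact hob j (hRN hj).1 he
    · exact hoa i (hRN hi).1 he
  -- the nodes `a n`, `b n` determine `n`
  have hab_inj : ∀ n, n ∈ N → ∀ m, m ∈ N → ∀ p, (p = a n ∨ p = b n) → q p = q (b m) → n = m := by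
    intro n hn m hm p hp he
    have hpS : p ∈ S := by
      rcases hp with rfl | rfl
      exacts [haS n hn, hbS n hn]
    have hpC : C p (q (t n)) := by
      rcases hp with rfl | rfl
      exacts [hCa n hn, hCb n hn]
    have := ((hqC _ hpS _ (hbS m hm)).1 he _).1 hpC
    rcases (hC_b m hm _).1 this with h1 | ⟨i, hi, h1⟩
    · exact ht_inj _ (hNτ _ hn) _ (hNτ _ hm) h1
    · exact absurd h1 (hty _ (hNτ _ hn) _ _ hi)
  -- If `z n` were equivalent to some `y n i`, then `a i` would be equivalent to some `b j`; the
  -- rigid nodes give `j = i`, and the induction hypothesis refutes this.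
  have hab : ∀ n, n ∈ N → q (a n) ≠ q (b n) := by
    have : ∀ n, n ∈ N → pr (a n) (b n) ∉ B := by
      refine h.induction fun n hn ih hab => ?_
      rw [hqB _ (haS n hn) _ (hbS n hn), hqC _ (haS n hn) _ (hbS n hn)] at hab
      have := (hab (q (z n))).1 ((hC_a n hn _).2 (Or.inr rfl))
      rcases (hC_b n hn _).1 this with h1 | ⟨i, hi, h1⟩
      · exact htz _ (hNτ _ hn) n hn h1.symm
      · have hiN := (hRN hi).1
        have := ((hqC _ (hzS n hn) _ (hyS n i hi)).1 h1 _).2 ((hC_y n i hi _).2 (Or.inr rfl))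
        obtain ⟨j, hj, h2⟩ := (hC_z n hn _).1 this
        obtain rfl := hab_inj i hiN j (hRN hj).1 _ (Or.inl rfl) h2
        exact ih i hiN hi ((hqB _ (haS i hiN) _ (hbS i hiN)).2 h2)
    exact fun n hn he => this n hn ((hqB _ (haS n hn) _ (hbS n hn)).2 he)
  -- the gates
  have hgy : ∀ n i, pr i n ∈ R → q (v i) = q (a i) → q (g n i) = q (y n i) := by
    intro n i hi he
    rw [hqC _ (hgS n i hi) _ (hyS n i hi)]
    intro u
    rw [hC_g n i hi, hC_y n i hi, he]
  have hgz : ∀ n i, pr i n ∈ R → q (v i) = q (b i) → q (g n i) = q (z n) := by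
    intro n i hi he
    rw [hqC _ (hgS n i hi) _ (hzS n (hRN hi).2)]
    intro u
    rw [hC_g n i hi, hC_z n (hRN hi).2, he]
    constructor
    · rintro (⟨j, hj, _, rfl⟩ | rfl)
      exacts [⟨j, hj, rfl⟩, ⟨i, hi, rfl⟩]
    · rintro ⟨j, hj, rfl⟩
      by_cases hji : j = i
      · exact Or.inr (by rw [hji])
      · exact Or.inl ⟨j, hj, hji, rfl⟩
  have hlose : ∀ n, n ∈ N → (∀ i, pr i n ∈ R → q (v i) = q (a i)) → q (v n) = q (b n) := by
    intro n hn hall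
    rw [hqC _ (hvS n hn) _ (hbS n hn)]
    intro u
    rw [hC_v n hn, or_iff_left_iff_imp]
    rintro ⟨i, hi, rfl⟩
    exact (hC_b n hn _).2 (Or.inr ⟨i, hi, hgy n i hi (hall i hi)⟩)
  -- A losing move contributes the class of `z n`; the remaining gates repeat that class or some `y
  -- n j`.
  have hwin : ∀ n, n ∈ N → (∀ i, pr i n ∈ R → q (v i) = q (a i) ∨ q (v i) = q (b i)) →
      (∃ i, pr i n ∈ R ∧ q (v i) = q (b i)) → q (v n) = q (a n) := by
    rintro n hn hall ⟨i, hi, he⟩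
    rw [hqC _ (hvS n hn) _ (haS n hn)]
    intro u
    rw [hC_v n hn, hC_a n hn]
    constructor
    · rintro (h1 | ⟨j, hj, rfl⟩)
      · exact Or.inl h1
      · rcases hall j hj with h1 | h1
        · exact Or.inl ((hC_b n hn _).2 (Or.inr ⟨j, hj, hgy n j hj h1⟩))
        · exact Or.inr (hgz n j hj h1)
    · rintro (h1 | rfl)
      · exact Or.inl h1
      · exact Or.inr ⟨i, hi, (hgz n i hi he).symm⟩
  have hdich : ∀ n, n ∈ N → q (v n) = q (a n) ∨ q (v n) = q (b n) := by
    have : ∀ n, n ∈ N → pr (v n) (a n) ∈ B ∨ pr (v n) (b n) ∈ B := by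
      refine h.induction fun n hn ih => ?_
      rw [hqB _ (hvS n hn) _ (haS n hn), hqB _ (hvS n hn) _ (hbS n hn)]
      have ih : ∀ i, pr i n ∈ R → q (v i) = q (a i) ∨ q (v i) = q (b i) := by
        intro i hi
        have hiN := (hRN hi).1
        rw [← hqB _ (hvS i hiN) _ (haS i hiN), ← hqB _ (hvS i hiN) _ (hbS i hiN)]
        exact ih i hiN hi
      by_cases he : ∃ i, pr i n ∈ R ∧ q (v i) = q (b i)
      · exact Or.inl (hwin n hn ih he)
      · refine Or.inr (hlose n hn fun i hi => (ih i hi).resolve_right fun h1 => he ⟨i, hi, h1⟩)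
    intro n hn
    rw [← hqB _ (hvS n hn) _ (haS n hn), ← hqB _ (hvS n hn) _ (hbS n hn)]
    exact this n hn
  refine ⟨sep N fun n => pr (v n) (b n) ∉ B, fun n hn => ?_⟩
  have hW : ∀ m, m ∈ N → (m ∈ sep N (fun n => pr (v n) (b n) ∉ B) ↔ q (v m) ≠ q (b m)) := by
    intro m hm
    rw [mem_sep, hqB _ (hvS m hm) _ (hbS m hm)]
    exact and_iff_right hm
  rw [hW n hn]
  constructor
  · intro hne
    by_contra hno
    refine hne (hlose n hn fun i hi => (hdich i (hRN hi).1).resolve_right fun h1 => hno ?_)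
    exact ⟨i, (hRN hi).1, hi, fun h2 => (hW i (hRN hi).1).1 h2 h1⟩
  · rintro ⟨m, hm, hmn, hmW⟩ he
    rw [hW m hm, not_not] at hmW
    have := hwin n hn (fun i hi => hdich i (hRN hi).1) ⟨m, hmn, hmW⟩
    exact hab n hn (this.symm.trans he)

end Kernel

/-! ### Circuits -/

section Circuits

variable {M : Type} [Lset.Structure M]

variable (M) in
/-- A well founded circuit of NAND gates: a gate `n ∈ N` fires iff one of its `R`-predecessors does
not fire, or one of the inputs `q` with `⟨n, q⟩ ∈ I` is on. -/
structure Circuit where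
  N : M
  R : M
  I : M

/-- `W` is the set of gates that fire when the inputs in `v` are on. -/
def Circuit.Sol [hB : Theory.Model M B] (C : Circuit M) (v : M) (W : M → Prop) : Prop :=
  ∀ n, n ∈ C.N → (W n ↔ (∃ m, m ∈ C.N ∧ pr m n ∈ C.R ∧ ¬ W m) ∨ ∃ q, q ∈ v ∧ pr n q ∈ C.I)

variable [hB : Theory.Model M B]

/-- The circuit `C'` extends `C` by further gates. -/
structure Circuit.Extends (C' C : Circuit M) : Prop where
  wf : WFRel C.R C.N → WFRel C'.R C'.N
  sub : Sub C.N C'.N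
  sol : ∀ v W, C'.Sol v W → C.Sol v W

lemma Circuit.Extends.trans {C C' C'' : Circuit M} (h' : C''.Extends C') (h : C'.Extends C) :
    C''.Extends C :=
  ⟨fun hw => h'.wf (h.wf hw), fun n hn => h'.sub n (h.sub n hn),
    fun v W hs => h.sol v W (h'.sol v W hs)⟩

/-- Otherwise `x ∈ {x} ∈ ⟨x, y⟩ ∈ x` is a cycle, against Regularity. Thus the pairs `⟨N, g⟩` are
fresh names for gates to be added to `N`. -/
lemma pr_not_mem_left (x y : M) : pr x y ∉ x := by
  intro h
  obtain ⟨w, hw, hmin⟩ := exists_min' (un (upair x (sing x)) (sing (pr x y))) ⟨x, by simp⟩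
  simp only [mem_un, mem_upair, mem_sing] at hw hmin
  rcases hw with (rfl | rfl) | rfl
  · exact hmin _ (Or.inr rfl) h
  · exact hmin x (Or.inl (Or.inl rfl)) (by simp)
  · exact hmin (sing x) (Or.inl (Or.inr rfl)) (by simp [pr])

/-- For all `g ∈ K` one can add a gate with given predecessors among the old gates and with given
inputs. -/
lemma Circuit.exists_layer (C : Circuit M) (hC : WFRel C.R C.N) (K E J : M) :
    ∃ C' : Circuit M, C'.Extends C ∧ ∃ f : M → M, (∀ g, g ∈ K → f g ∈ C'.N) ∧
      (∃ O : M, ∀ g, g ∈ K → ∀ m, pr g m ∈ O ↔ m = f g) ∧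
      ∀ v W, C'.Sol v W → ∀ g, g ∈ K → (W (f g) ↔
        (∃ m, m ∈ C.N ∧ pr m g ∈ E ∧ ¬ W m) ∨ ∃ q, q ∈ v ∧ pr g q ∈ J) := by
  obtain ⟨N, R, I⟩ := C
  let N' := un N (prod (sing N) K)
  have hnew : ∀ g, pr N g ∉ N := pr_not_mem_left N
  have hN' : ∀ n, n ∈ N' ↔ n ∈ N ∨ ∃ g, g ∈ K ∧ n = pr N g := by
    intro n
    simp [N', mem_prod]
  let R' := un R (sep (prod N' N') fun z => ∃ m, m ∈ N ∧ ∃ g, g ∈ K ∧ pr m g ∈ E ∧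
    z = pr m (pr N g))
  have hR : ∀ {m n}, pr m n ∈ R → m ∈ N ∧ n ∈ N := fun h => hC.1.mem h
  have hR' : ∀ m n, pr m n ∈ R' ↔ pr m n ∈ R ∨ m ∈ N ∧ ∃ g, g ∈ K ∧ pr m g ∈ E ∧ n = pr N g := by
    intro m n
    simp only [R', mem_un, mem_sep, pr_mem_prod, pr_inj, hN']
    refine or_congr_right ⟨?_, ?_⟩
    · rintro ⟨_, _, hm, g, hg, he, rfl, rfl⟩
      exact ⟨hm, g, hg, he, rfl⟩
    · rintro ⟨hm, g, hg, he, rfl⟩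
      exact ⟨⟨Or.inl hm, Or.inr ⟨g, hg, rfl⟩⟩, m, hm, g, hg, he, rfl, rfl⟩
  let Q := un (sUn (sUn I)) (sUn (sUn J))
  let I' := sep (prod N' Q) fun z => ∃ n, n ∈ N' ∧ ∃ q, q ∈ Q ∧ z = pr n q ∧
    ((n ∈ N ∧ z ∈ I) ∨ ∃ g, g ∈ K ∧ n = pr N g ∧ pr g q ∈ J)
  have hI' : ∀ n q, pr n q ∈ I' ↔ (n ∈ N ∧ pr n q ∈ I) ∨ ∃ g, g ∈ K ∧ n = pr N g ∧ pr g q ∈ J := by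
    intro n q
    simp only [I', mem_sep, pr_mem_prod, pr_inj]
    constructor
    · rintro ⟨_, _, _, _, _, ⟨rfl, rfl⟩, h⟩
      exact h
    · intro h
      have h' : n ∈ N' ∧ q ∈ Q := by
        rcases h with ⟨hn, hq⟩ | ⟨g, hg, rfl, hq⟩
        · exact ⟨(hN' _).2 (Or.inl hn), mem_un.2 (Or.inl (mem_sUn_sUn hq).2)⟩
        · exact ⟨(hN' _).2 (Or.inr ⟨g, hg, rfl⟩), mem_un.2 (Or.inr (mem_sUn_sUn hq).2)⟩
      exact ⟨h', n, h'.1, q, h'.2, ⟨rfl, rfl⟩, h⟩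
  -- The graph of the naming function as an element of `M`: the Lean function itself may not occur
  -- in later instances of Separation.
  let O := sep (prod K N') fun z => ∃ g, g ∈ K ∧ z = pr g (pr N g)
  refine ⟨⟨N', R', I'⟩, ⟨fun _ => ?_, fun n hn => (hN' n).2 (Or.inl hn), fun v W hs n hn => ?_⟩,
    pr N, fun g hg => (hN' _).2 (Or.inr ⟨g, hg, rfl⟩), ⟨O, fun g hg m => ?_⟩, ?_⟩
  · refine wfRel_of_induction (fun z hz => ?_) fun Y hY => ?_
    · rcases mem_un.1 hz with hz | hz
      · obtain ⟨m, hm, n, hn, rfl⟩ := relBetween_iff.1 hC.1 z hz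
        exact pr_mem_prod.2 ⟨(hN' _).2 (Or.inl hm), (hN' _).2 (Or.inl hn)⟩
      · exact (mem_sep.1 hz).1
    · have hold : ∀ n, n ∈ N → n ∈ Y := hC.induction fun n hn ih =>
        hY n ((hN' _).2 (Or.inl hn)) fun m hm hmn => by
          rcases (hR' _ _).1 hmn with h | ⟨_, g, _, _, rfl⟩
          · exact ih m (hR h).1 h
          · exact absurd hn (hnew g)
      intro n hn
      refine hY n hn fun m hm hmn => ?_
      rcases (hR' _ _).1 hmn with h | ⟨h, _⟩
      exacts [hold m (hR h).1, hold m h]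
  · rw [hs n ((hN' _).2 (Or.inl hn))]
    refine or_congr (exists_congr fun m => ?_) (exists_congr fun q => and_congr_right fun _ => ?_)
    · simp only [hR']
      constructor
      · rintro ⟨_, h | ⟨_, g, _, _, rfl⟩, hW⟩
        · exact ⟨(hR h).1, h, hW⟩
        · exact absurd hn (hnew g)
      · rintro ⟨hm, h, hW⟩
        exact ⟨(hN' _).2 (Or.inl hm), Or.inl h, hW⟩
    · simp only [hI']
      constructor
      · rintro (h | ⟨g, _, rfl, _⟩)
        · exact h.2
        · exact absurd hn (hnew g)
      · exact fun h => Or.inl ⟨hn, h⟩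
  · simp only [O, mem_sep, pr_mem_prod, pr_inj]
    constructor
    · rintro ⟨_, _, _, rfl, h⟩
      exact h
    · rintro rfl
      exact ⟨⟨hg, (hN' _).2 (Or.inr ⟨g, hg, rfl⟩)⟩, g, hg, rfl, rfl⟩
  · intro v W hs g hg
    rw [hs _ ((hN' _).2 (Or.inr ⟨g, hg, rfl⟩))]
    refine or_congr (exists_congr fun m => ?_) (exists_congr fun q => and_congr_right fun _ => ?_)
    · simp only [hR']
      constructor
      · rintro ⟨_, h | ⟨hm, g', _, he, h⟩, hW⟩
        · exact absurd (hR h).2 (hnew g)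
        · obtain rfl := (pr_inj.1 h).2
          exact ⟨hm, he, hW⟩
      · rintro ⟨hm, he, hW⟩
        exact ⟨(hN' _).2 (Or.inl hm), Or.inr ⟨hm, g, hg, he, rfl⟩, hW⟩
    · simp only [hI']
      constructor
      · rintro (h | ⟨g', _, h, hq⟩)
        · exact absurd h.1 (hnew g)
        · obtain rfl := (pr_inj.1 h).2
          exact hq
      · exact fun h => Or.inr ⟨g, hg, rfl, h⟩

/-! ### Codes for assignments -/

/-- A code for the tuple `(c, x₀, …, xₙ₋₁)`. -/
noncomputable def enc (c : M) : (n : ℕ) → (Fin n → M) → M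
  | 0, _ => c
  | n + 1, xs => pr (enc c n (Fin.init xs)) (xs (Fin.last n))

/-- The set of codes for tuples with entries in `A`. -/
noncomputable def tup (A : M) : ℕ → M
  | 0 => A
  | n + 1 => prod (tup A n) A

lemma enc_snoc (c : M) {n : ℕ} (xs : Fin n → M) (x : M) :
    enc c (n + 1) (Fin.snoc xs x) = pr (enc c n xs) x := by
  simp [enc]

lemma mem_tup {A g : M} {n : ℕ} :
    g ∈ tup A n ↔ ∃ c, c ∈ A ∧ ∃ xs : Fin n → M, (∀ i, xs i ∈ A) ∧ g = enc c n xs := by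
  induction n generalizing g with
  | zero =>
    simp only [tup, enc]
    constructor
    · exact fun h => ⟨g, h, default, fun i => i.elim0, rfl⟩
    · rintro ⟨c, hc, _, _, rfl⟩
      exact hc
  | succ n ih =>
    simp only [tup, mem_prod, ih]
    constructor
    · rintro ⟨_, ⟨c, hc, xs, hxs, rfl⟩, x, hx, rfl⟩
      refine ⟨c, hc, Fin.snoc xs x, fun i => ?_, (enc_snoc c xs x).symm⟩
      refine Fin.lastCases ?_ (fun i => ?_) i
      · simpa using hx
      · simpa using hxs i
    · rintro ⟨c, hc, xs, hxs, rfl⟩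
      exact ⟨_, ⟨c, hc, Fin.init xs, fun i => hxs _, rfl⟩, xs (Fin.last n), hxs _, rfl⟩

/-- The function `f` on tuples from `A` is represented by a set. -/
def Rep (A : M) {n : ℕ} (f : M → (Fin n → M) → M) : Prop :=
  ∃ π : M, ∀ c, c ∈ A → ∀ xs : Fin n → M, (∀ i, xs i ∈ A) →
    ∀ y, pr (enc c n xs) y ∈ π ↔ y = f c xs

lemma rep_const (A : M) {n : ℕ} (d : M) : Rep A fun _ (_ : Fin n → M) => d := by
  refine ⟨prod (tup A n) (sing d), fun c hc xs hxs y => ?_⟩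
  simp only [pr_mem_prod, mem_sing, and_iff_right_iff_imp]
  exact fun _ => mem_tup.2 ⟨c, hc, xs, hxs, rfl⟩

lemma Rep.init {A : M} {n : ℕ} {f : M → (Fin n → M) → M} (h : Rep A f) :
    Rep A fun c (xs : Fin (n + 1) → M) => f c (Fin.init xs) := by
  obtain ⟨π, hπ⟩ := h
  refine ⟨sep (prod (prod (tup A n) A) (sUn (sUn π))) fun z => ∃ g, g ∈ tup A n ∧ ∃ x, x ∈ A ∧
    ∃ y, y ∈ sUn (sUn π) ∧ z = pr (pr g x) y ∧ pr g y ∈ π, fun c hc xs hxs y => ?_⟩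
  have hg : enc c n (Fin.init xs) ∈ tup A n := mem_tup.2 ⟨c, hc, _, fun i => hxs _, rfl⟩
  have h0 := hπ c hc (Fin.init xs) (fun i => hxs _)
  show _ ↔ y = f c (Fin.init xs)
  rw [← h0 y]
  simp only [enc, mem_sep, pr_mem_prod, pr_inj]
  constructor
  · rintro ⟨_, _, _, _, _, _, _, ⟨⟨rfl, rfl⟩, rfl⟩, h⟩
    exact h
  · intro h
    have hy := (mem_sUn_sUn h).2
    exact ⟨⟨⟨hg, hxs _⟩, hy⟩, _, hg, _, hxs _, y, hy, ⟨⟨rfl, rfl⟩, rfl⟩, h⟩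

lemma rep_last (A : M) {n : ℕ} : Rep A fun _ (xs : Fin (n + 1) → M) => xs (Fin.last n) := by
  refine ⟨sep (prod (prod (tup A n) A) A) fun z => ∃ g, g ∈ tup A n ∧ ∃ x, x ∈ A ∧
    z = pr (pr g x) x, fun c hc xs hxs y => ?_⟩
  have hg : enc c n (Fin.init xs) ∈ tup A n := mem_tup.2 ⟨c, hc, _, fun i => hxs _, rfl⟩
  simp only [enc, mem_sep, pr_mem_prod, pr_inj]
  constructor
  · rintro ⟨_, _, _, _, _, ⟨_, rfl⟩, h⟩
    exact h
  · rintro rfl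
    exact ⟨⟨⟨hg, hxs _⟩, hxs _⟩, _, hg, _, hxs _, ⟨rfl, rfl⟩, rfl⟩

lemma rep_var (A : M) {n : ℕ} (i : Fin n) : Rep A fun _ (xs : Fin n → M) => xs i := by
  induction n with
  | zero => exact i.elim0
  | succ n ih =>
    refine Fin.lastCases (rep_last A) (fun i => ?_) i
    exact (ih i).init

lemma rep_first (A : M) {n : ℕ} : Rep A fun c (_ : Fin n → M) => c := by
  induction n with
  | zero =>
    refine ⟨sep (prod A A) fun z => ∃ c, c ∈ A ∧ z = pr c c, fun c hc xs hxs y => ?_⟩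
    simp only [enc, mem_sep, pr_mem_prod, pr_inj]
    constructor
    · rintro ⟨_, _, _, rfl, h⟩
      exact h
    · rintro rfl
      exact ⟨⟨hc, hc⟩, y, hc, rfl, rfl⟩
  | succ n ih => exact ih.init

/-! ### Circuits for formulas -/

/-- The circuit `C` computes `P c xs v` for all tuples from `A` and all `v ⊆ A`. -/
def Computes (C : Circuit M) (A : M) {n : ℕ} (P : M → (Fin n → M) → M → Prop) : Prop :=
  ∃ f : M → M, (∀ g, g ∈ tup A n → f g ∈ C.N) ∧
    (∃ O : M, ∀ g, g ∈ tup A n → ∀ m, pr g m ∈ O ↔ m = f g) ∧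
    ∀ v W, Sub v A → C.Sol v W → ∀ c, c ∈ A → ∀ xs : Fin n → M, (∀ i, xs i ∈ A) →
      (W (f (enc c n xs)) ↔ P c xs v)

variable {A : M} {C : Circuit M}

lemma Computes.mono {n : ℕ} {P : M → (Fin n → M) → M → Prop} (h : Computes C A P)
    {C' : Circuit M} (hC : C'.Extends C) : Computes C' A P := by
  obtain ⟨f, hf, hO, hP⟩ := h
  exact ⟨f, fun g hg => hC.sub _ (hf g hg), hO, fun v W hv hs => hP v W hv (hC.sol v W hs)⟩

lemma Computes.congr {n : ℕ} {P Q : M → (Fin n → M) → M → Prop} (h : Computes C A P)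
    (hPQ : ∀ c, c ∈ A → ∀ xs : Fin n → M, (∀ i, xs i ∈ A) → ∀ v, Sub v A → (P c xs v ↔ Q c xs v)) :
    Computes C A Q := by
  obtain ⟨f, hf, hO, hP⟩ := h
  exact ⟨f, hf, hO, fun v W hv hs c hc xs hxs =>
    (hP v W hv hs c hc xs hxs).trans (hPQ c hc xs hxs v hv)⟩

/-- The basic step: a gate for the disjunction of some negated computed predicates and some
inputs. -/
lemma exists_computes (hC : WFRel C.R C.N) {n : ℕ} (E J : M)
    (P : M → (Fin n → M) → M → Prop)
    (hP : ∀ v W, Sub v A → C.Sol v W → ∀ c, c ∈ A → ∀ xs : Fin n → M, (∀ i, xs i ∈ A) →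
      ((∃ m, m ∈ C.N ∧ pr m (enc c n xs) ∈ E ∧ ¬ W m) ∨ (∃ q, q ∈ v ∧ pr (enc c n xs) q ∈ J) ↔
        P c xs v)) :
    ∃ C' : Circuit M, C'.Extends C ∧ Computes C' A P := by
  obtain ⟨C', hC', f, hf, hO, hW⟩ := C.exists_layer hC (tup A n) E J
  refine ⟨C', hC', f, hf, hO, fun v W hv hs c hc xs hxs => ?_⟩
  rw [hW v W hs _ (mem_tup.2 ⟨c, hc, xs, hxs, rfl⟩)]
  exact hP v W hv (hC'.sol v W hs) c hc xs hxs

lemma exists_computes_false (A : M) (hC : WFRel C.R C.N) (n : ℕ) :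
    ∃ C' : Circuit M, C'.Extends C ∧ Computes C' A fun _ (_ : Fin n → M) _ => False :=
  exists_computes hC (emp M) (emp M) _ fun v W _ _ c _ xs _ => by simp

lemma exists_computes_mem (hC : WFRel C.R C.N) {n : ℕ} {f : M → (Fin n → M) → M}
    (hf : Rep A f) :
    ∃ C' : Circuit M, C'.Extends C ∧ Computes C' A fun c xs v => f c xs ∈ v := by
  obtain ⟨π, hπ⟩ := hf
  refine exists_computes hC (emp M) π _ fun v W _ _ c hc xs hxs => ?_
  simp [hπ c hc xs hxs]

/-- One NAND gate per tuple, whose predecessors are the two gates already assigned to that tuple. -/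
lemma Computes.not_or_not (hC : WFRel C.R C.N) {n : ℕ} {P Q : M → (Fin n → M) → M → Prop}
    (hP : Computes C A P) (hQ : Computes C A Q) :
    ∃ C' : Circuit M, C'.Extends C ∧ Computes C' A fun c xs v => ¬ P c xs v ∨ ¬ Q c xs v := by
  obtain ⟨f, hf, ⟨O, hO⟩, hP⟩ := hP
  obtain ⟨f', hf', ⟨O', hO'⟩, hQ⟩ := hQ
  let E := sep (prod C.N (tup A n)) fun z => ∃ m, m ∈ C.N ∧ ∃ g, g ∈ tup A n ∧ z = pr m g ∧
    (pr g m ∈ O ∨ pr g m ∈ O')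
  refine exists_computes hC E (emp M) _ fun v W hv hs c hc xs hxs => ?_
  have hg := mem_tup.2 ⟨c, hc, xs, hxs, rfl⟩
  have hE : ∀ m, m ∈ C.N → (pr m (enc c n xs) ∈ E ↔
      m = f (enc c n xs) ∨ m = f' (enc c n xs)) := by
    intro m hm
    rw [← hO _ hg, ← hO' _ hg]
    simp only [E, mem_sep, pr_mem_prod, pr_inj]
    constructor
    · rintro ⟨_, _, _, _, _, ⟨rfl, rfl⟩, h⟩
      exact h
    · exact fun h => ⟨⟨hm, hg⟩, m, hm, _, hg, ⟨rfl, rfl⟩, h⟩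
  rw [← hP v W hv hs c hc xs hxs, ← hQ v W hv hs c hc xs hxs]
  constructor
  · rintro (⟨m, hm, he, hW⟩ | ⟨q, _, h⟩)
    · rcases (hE m hm).1 he with rfl | rfl
      exacts [Or.inl hW, Or.inr hW]
    · exact absurd h (not_mem_emp _)
  · rintro (h | h)
    · exact Or.inl ⟨_, hf _ hg, (hE _ (hf _ hg)).2 (Or.inl rfl), h⟩
    · exact Or.inl ⟨_, hf' _ hg, (hE _ (hf' _ hg)).2 (Or.inr rfl), h⟩

lemma Computes.not (hC : WFRel C.R C.N) {n : ℕ} {P : M → (Fin n → M) → M → Prop}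
    (hP : Computes C A P) :
    ∃ C' : Circuit M, C'.Extends C ∧ Computes C' A fun c xs v => ¬ P c xs v := by
  obtain ⟨C', h1, h2⟩ := hP.not_or_not hC hP
  exact ⟨C', h1, h2.congr fun c _ xs _ v _ => by simp⟩

lemma Computes.imp (hC : WFRel C.R C.N) {n : ℕ} {P Q : M → (Fin n → M) → M → Prop}
    (hP : Computes C A P) (hQ : Computes C A Q) :
    ∃ C' : Circuit M, C'.Extends C ∧ Computes C' A fun c xs v => P c xs v → Q c xs v := by
  obtain ⟨C₁, h1, hQ⟩ := hQ.not hC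
  obtain ⟨C₂, h2, h3⟩ := (hP.mono h1).not_or_not (h1.wf hC) hQ
  exact ⟨C₂, h2.trans h1, h3.congr fun c _ xs _ v _ => by tauto⟩

/-- The gate of a tuple has as predecessors the gates of all its extensions by an element of `A`.
Gates may have any set of predecessors, but not a proper class, so quantifiers range over `A`. -/
lemma Computes.exists_not (hC : WFRel C.R C.N) {n : ℕ} {P : M → (Fin (n + 1) → M) → M → Prop}
    (hP : Computes C A P) :
    ∃ C' : Circuit M, C'.Extends C ∧
      Computes C' A fun c (xs : Fin n → M) v => ∃ x, x ∈ A ∧ ¬ P c (Fin.snoc xs x) v := by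
  obtain ⟨f, hf, ⟨O, hO⟩, hP⟩ := hP
  let E := sep (prod C.N (tup A n)) fun z => ∃ m, m ∈ C.N ∧ ∃ g, g ∈ tup A n ∧ z = pr m g ∧
    ∃ x, x ∈ A ∧ pr (pr g x) m ∈ O
  refine exists_computes hC E (emp M) _ fun v W hv hs c hc xs hxs => ?_
  have hg := mem_tup.2 ⟨c, hc, xs, hxs, rfl⟩
  have hxs' : ∀ x, x ∈ A → ∀ i, (Fin.snoc xs x : Fin (n + 1) → M) i ∈ A := by
    intro x hx i
    refine Fin.lastCases ?_ (fun i => ?_) i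
    · simpa using hx
    · simpa using hxs i
  have hg' : ∀ x, x ∈ A → pr (enc c n xs) x ∈ tup A (n + 1) := fun x hx =>
    mem_tup.2 ⟨c, hc, Fin.snoc xs x, hxs' x hx, (enc_snoc c xs x).symm⟩
  have hE : ∀ m, m ∈ C.N → (pr m (enc c n xs) ∈ E ↔
      ∃ x, x ∈ A ∧ m = f (pr (enc c n xs) x)) := by
    intro m hm
    simp only [E, mem_sep, pr_mem_prod, pr_inj]
    constructor
    · rintro ⟨_, _, _, _, _, ⟨rfl, rfl⟩, x, hx, h⟩
      exact ⟨x, hx, (hO _ (hg' x hx) _).1 h⟩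
    · rintro ⟨x, hx, h⟩
      exact ⟨⟨hm, hg⟩, m, hm, _, hg, ⟨rfl, rfl⟩, x, hx, (hO _ (hg' x hx) _).2 h⟩
  have hP' : ∀ x, x ∈ A → (W (f (pr (enc c n xs) x)) ↔ P c (Fin.snoc xs x) v) := by
    intro x hx
    rw [← enc_snoc]
    exact hP v W hv hs c hc _ (hxs' x hx)
  constructor
  · rintro (⟨m, hm, he, hW⟩ | ⟨q, _, h⟩)
    · obtain ⟨x, hx, rfl⟩ := (hE m hm).1 he
      exact ⟨x, hx, fun h => hW ((hP' x hx).2 h)⟩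
    · exact absurd h (not_mem_emp _)
  · rintro ⟨x, hx, h⟩
    have hm := hf _ (hg' x hx)
    exact Or.inl ⟨_, hm, (hE _ hm).2 ⟨x, hx, rfl⟩, fun hW => h ((hP' x hx).1 hW)⟩

lemma Computes.forall (hC : WFRel C.R C.N) {n : ℕ} {P : M → (Fin (n + 1) → M) → M → Prop}
    (hP : Computes C A P) :
    ∃ C' : Circuit M, C'.Extends C ∧
      Computes C' A fun c (xs : Fin n → M) v => ∀ x, x ∈ A → P c (Fin.snoc xs x) v := by
  obtain ⟨C₁, h1, hP⟩ := hP.exists_not hC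
  obtain ⟨C₂, h2, h3⟩ := hP.not (h1.wf hC)
  exact ⟨C₂, h2.trans h1, h3.congr fun c _ xs _ v _ => by simp⟩

/-- A gate that never fires serves as a constant: the gate of a tuple fires exactly if it has such a
predecessor, and it is given one when the code of the tuple is in `Θ`. -/
lemma exists_computes_set (hC : WFRel C.R C.N) (Θ : M) (n : ℕ) :
    ∃ C' : Circuit M, C'.Extends C ∧
      Computes C' A fun c (xs : Fin n → M) _ => enc c n xs ∈ Θ := by
  obtain ⟨C₁, h1, f, hf, ⟨O, hO⟩, hW⟩ := exists_computes_false A hC n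
  let E := sep (prod C₁.N (tup A n)) fun z => ∃ m, m ∈ C₁.N ∧ ∃ g, g ∈ tup A n ∧ z = pr m g ∧
    (pr g m ∈ O ∧ g ∈ Θ)
  obtain ⟨C₂, h2, h3⟩ := exists_computes (h1.wf hC) E (emp M)
    (fun c (xs : Fin n → M) _ => enc c n xs ∈ Θ) fun v W hv hs c hc xs hxs => by
      have hg := mem_tup.2 ⟨c, hc, xs, hxs, rfl⟩
      constructor
      · rintro (⟨m, hm, he, _⟩ | ⟨q, _, h⟩)
        · simp only [E, mem_sep, pr_inj] at he
          obtain ⟨_, _, _, _, _, ⟨rfl, rfl⟩, _, h⟩ := he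
          exact h
        · exact absurd h (not_mem_emp _)
      · intro h
        refine Or.inl ⟨f (enc c n xs), hf _ hg, ?_, fun h => (hW v W hv hs c hc xs hxs).1 h⟩
        simp only [E, mem_sep, pr_mem_prod, pr_inj]
        exact ⟨⟨hf _ hg, hg⟩, _, hf _ hg, _, hg, ⟨rfl, rfl⟩, (hO _ hg _).2 rfl, h⟩
  exact ⟨C₂, h2.trans h1, h3⟩

/-- A `Δ₀` relation that does not involve `v` is decided in advance, by separating the set of codes
of the tuples that satisfy it. -/
lemma exists_computes_rel (hC : WFRel C.R C.N) {n : ℕ} {f f' : M → (Fin n → M) → M}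
    (hf : Rep A f) (hf' : Rep A f') (P : M → M → Prop)
    [D M fun γ : (Unit × M) × M => P γ.1.2 γ.2] :
    ∃ C' : Circuit M, C'.Extends C ∧ Computes C' A fun c xs _ => P (f c xs) (f' c xs) := by
  obtain ⟨π, hπ⟩ := hf
  obtain ⟨π', hπ'⟩ := hf'
  have : D M fun γ : (((Unit × M) × M) × M) => P γ.1.2 γ.2 := by
    have h := ‹D M fun γ : (Unit × M) × M => P γ.1.2 γ.2›
    refine h.comp (π := fun γ : (((Unit × M) × M) × M) => (((), γ.1.2), γ.2)) ⟨![1, 2], ?_⟩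
    intro γ i
    fin_cases i <;> rfl
  let Θ := sep (tup A n) fun g => ∃ y, y ∈ sUn (sUn π) ∧ ∃ y', y' ∈ sUn (sUn π') ∧
    P y y' ∧ pr g y ∈ π ∧ pr g y' ∈ π'
  obtain ⟨C', h1, h2⟩ := exists_computes_set (A := A) hC Θ n
  refine ⟨C', h1, h2.congr fun c hc xs hxs v hv => ?_⟩
  have hg := mem_tup.2 ⟨c, hc, xs, hxs, rfl⟩
  have h3 := hπ c hc xs hxs
  have h4 := hπ' c hc xs hxs
  simp only [Θ, mem_sep, h3, h4]
  constructor
  · rintro ⟨_, _, _, _, _, h, rfl, rfl⟩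
    exact h
  · exact fun h => ⟨hg, _, (mem_sUn_sUn ((h3 _).2 rfl)).2, _, (mem_sUn_sUn ((h4 _).2 rfl)).2,
      h, rfl, rfl⟩

end Circuits

/-! ### Relativization -/

section Relativization

variable {M : Type} [Lset.Structure M] {α : Type}

/-- The truth value of a formula when the quantifiers range over the elements of `A`. -/
def RealizeIn (A : M) (e : α → M) : ∀ {n : ℕ}, Lset.BoundedFormula α n → (Fin n → M) → Prop
  | _, .falsum, _ => False
  | _, .equal t s, xs => t.realize (Sum.elim e xs) = s.realize (Sum.elim e xs)
  | _, .rel R ts, xs => Structure.RelMap R fun i => (ts i).realize (Sum.elim e xs)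
  | _, .imp φ ψ, xs => RealizeIn A e φ xs → RealizeIn A e ψ xs
  | _, .all φ, xs => ∀ x, x ∈ A → RealizeIn A e φ (Fin.snoc xs x)

/-- `Δ₀` formulas are absolute for transitive sets. -/
lemma realizeIn_iff {A : M} (hA : Tran A) {e : α → M} (he : ∀ i, Sub (e i) A) {n : ℕ}
    {φ : Lset.BoundedFormula α n} (hφ : IsDelta0 φ) :
    ∀ xs : Fin n → M, (∀ i, xs i ∈ A) → (RealizeIn A e φ xs ↔ φ.Realize e xs) := by
  have hsub : ∀ {n : ℕ} (x : α ⊕ Fin n) (xs : Fin n → M), (∀ i, xs i ∈ A) →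
      Sub (Sum.elim e xs x) A := by
    intro n x xs hxs
    cases x with
    | inl i => exact he i
    | inr i => exact hA _ (hxs i)
  have hsnoc : ∀ {n : ℕ} (xs : Fin n → M), (∀ i, xs i ∈ A) → ∀ z, z ∈ A →
      ∀ i, (Fin.snoc xs z : Fin (n + 1) → M) i ∈ A := by
    intro n xs hxs z hz i
    refine Fin.lastCases ?_ (fun i => ?_) i
    · simpa using hz
    · simpa using hxs i
  have hmem : ∀ {n : ℕ} (x : α ⊕ Fin n) (xs : Fin n → M) (z : M),
      RealizeIn A e (memF lastVar (up x)) (Fin.snoc xs z) ↔ z ∈ Sum.elim e xs x := by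
    intro n x xs z
    have : RealizeIn A e (memF lastVar (up x)) (Fin.snoc xs z) ↔
      (memF lastVar (up x)).Realize e (Fin.snoc xs z) := Iff.rfl
    simp [this]
  induction hφ with
  | falsum => exact fun _ _ => Iff.rfl
  | equal t s => exact fun _ _ => Iff.rfl
  | rel R ts => exact fun _ _ => Iff.rfl
  | imp _ _ h1 h2 => exact fun xs hxs => imp_congr (h1 xs hxs) (h2 xs hxs)
  | @ball n x φ _ ih =>
    intro xs hxs
    refine Iff.trans ?_ (realize_ball x φ e xs).symm
    have : RealizeIn A e (ballF x φ) xs ↔ ∀ z, z ∈ A →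
      RealizeIn A e (memF lastVar (up x)) (Fin.snoc xs z) → RealizeIn A e φ (Fin.snoc xs z) :=
      Iff.rfl
    refine this.trans ?_
    simp only [hmem]
    exact ⟨fun h z hz => (ih _ (hsnoc xs hxs z (hsub x xs hxs z hz))).1
        (h z (hsub x xs hxs z hz) hz),
      fun h z hz hz' => (ih _ (hsnoc xs hxs z hz)).2 (h z hz')⟩
  | @bex n x φ _ ih =>
    intro xs hxs
    refine Iff.trans ?_ (realize_bexF x φ).symm
    have : RealizeIn A e (bexF x φ) xs ↔ ¬ ∀ z, z ∈ A →
      ¬ ¬ (RealizeIn A e (memF lastVar (up x)) (Fin.snoc xs z) →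
        ¬ RealizeIn A e φ (Fin.snoc xs z)) :=
      Iff.rfl
    refine this.trans ?_
    simp only [hmem, not_not, not_forall, exists_prop]
    constructor
    · rintro ⟨z, hzA, hz, h⟩
      exact ⟨z, hz, (ih _ (hsnoc xs hxs z hzA)).1 h⟩
    · rintro ⟨z, hz, h⟩
      have hzA := hsub x xs hxs z hz
      exact ⟨z, hzA, hz, (ih _ (hsnoc xs hxs z hzA)).2 h⟩

variable [hB : Theory.Model M B]

/-- Terms are variables, and the value of any variable other than `v` is a function of the tuple
alone. -/
lemma rep_term {A : M} {m n : ℕ} (p : Fin m → M) (t : Lset.Term (Fin (m + 2) ⊕ Fin n))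
    (ht : t ≠ Term.var (Sum.inl 1)) : ∃ f : M → (Fin n → M) → M, Rep A f ∧ ∀ c xs v,
      t.realize (Sum.elim (Fin.cons c (Fin.cons v p) : Fin (m + 2) → M) xs) = f c xs := by
  obtain ⟨x, rfl⟩ := term_eq_var t
  rcases x with i | i
  · refine Fin.cases (fun _ => ?_) (fun i => ?_) i ht
    · exact ⟨_, rep_first A, fun _ _ _ => rfl⟩
    · refine Fin.cases (fun h => absurd rfl h) (fun i _ => ?_) i
      exact ⟨_, rep_const A (p i), fun _ _ _ => rfl⟩
  · exact ⟨_, rep_var A i, fun _ _ _ => rfl⟩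

/-- Induction on the formula, extending the circuit at each step. By the condition on occurrences of
`v`, an atomic formula either has the form `x ∈ v`, which becomes an input, or does not depend on
`v`. -/
theorem exists_computes_formula {A : M} {m : ℕ} (p : Fin m → M) {n : ℕ}
    (φ : Lset.BoundedFormula (Fin (m + 2)) n) (hφ : OnlyAsContainer 1 φ) :
    ∀ C : Circuit M, WFRel C.R C.N → ∃ C' : Circuit M, C'.Extends C ∧
      Computes C' A fun c xs v => RealizeIn A (Fin.cons c (Fin.cons v p)) φ xs := by
  induction φ with
  | falsum => exact fun C hC => exists_computes_false A hC _
  | equal t s =>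
    intro C hC
    obtain ⟨f, hf, hft⟩ := rep_term (A := A) p t hφ.1
    obtain ⟨g, hg, hgs⟩ := rep_term (A := A) p s hφ.2
    obtain ⟨C', h1, h2⟩ := exists_computes_rel hC hf hg fun x y => x = y
    refine ⟨C', h1, h2.congr fun c _ xs _ v _ => ?_⟩
    simp only [RealizeIn, hft, hgs]
  | @rel n l R ts =>
    intro C hC
    cases R
    obtain ⟨f, hf, hft⟩ := rep_term (A := A) p (ts 0) (hφ 0 rfl)
    have key : ∀ c xs v, RealizeIn A (Fin.cons c (Fin.cons v p)) (.rel (MemRel.mem) ts) xs ↔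
        (ts 0).realize (Sum.elim (Fin.cons c (Fin.cons v p) : Fin (m + 2) → M) xs) ∈
        (ts 1).realize (Sum.elim (Fin.cons c (Fin.cons v p) : Fin (m + 2) → M) xs) :=
      fun c xs v => relMap_mem _
    by_cases ht : ts 1 = Term.var (Sum.inl 1)
    · obtain ⟨C', h1, h2⟩ := exists_computes_mem hC hf
      refine ⟨C', h1, h2.congr fun c _ xs _ v _ => ?_⟩
      refine Iff.trans ?_ (key c xs v).symm
      rw [hft, ht]
      exact Iff.rfl
    · obtain ⟨g, hg, hgs⟩ := rep_term (A := A) p (ts 1) ht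
      obtain ⟨C', h1, h2⟩ := exists_computes_rel hC hf hg fun x y => x ∈ y
      refine ⟨C', h1, h2.congr fun c _ xs _ v _ => ?_⟩
      refine Iff.trans ?_ (key c xs v).symm
      rw [hft, hgs]
  | imp _ _ ih1 ih2 =>
    intro C hC
    obtain ⟨C₁, h1, hP⟩ := ih1 hφ.1 C hC
    obtain ⟨C₂, h2, hQ⟩ := ih2 hφ.2 C₁ (h1.wf hC)
    obtain ⟨C₃, h3, h⟩ := (hP.mono h2).imp (h2.wf (h1.wf hC)) hQ
    exact ⟨C₃, h3.trans (h2.trans h1), h⟩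
  | all _ ih =>
    intro C hC
    obtain ⟨C₁, h1, hP⟩ := ih hφ C hC
    obtain ⟨C₂, h2, h⟩ := hP.forall (h1.wf hC)
    exact ⟨C₂, h2.trans h1, h⟩

end Relativization

/-! ### Transfinite recursion -/

section Recursion

variable {M : Type} [Lset.Structure M] [hB : Theory.Model M B]

lemma exists_mem_all {m : ℕ} (p : Fin m → M) : ∃ P : M, ∀ i, p i ∈ P := by
  induction m with
  | zero => exact ⟨emp M, fun i => i.elim0⟩
  | succ m ih =>
    obtain ⟨P, hP⟩ := ih fun i => p i.castSucc
    refine ⟨un P (sing (p (Fin.last m))), fun i => ?_⟩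
    rw [mem_un, mem_sing]
    exact Fin.lastCases (Or.inr rfl) (fun i => Or.inl (hP i)) i

/-- One can iterate a circuit along a well founded relation, feeding the negated outputs `f u` at
`t ≺ s` to the copy of the circuit at `s` as the inputs `⟨u, t⟩`. -/
lemma Circuit.exists_iterate (hM : ∀ T : M, Tree T → WFTree T → ∃ b, Bisim b T) (C : Circuit M)
    (hC : WFRel C.R C.N) {a X r : M} (hr : WFRel r X) {f : M → M} (hf : ∀ u, u ∈ a → f u ∈ C.N)
    {O : M} (hO : ∀ u, u ∈ a → ∀ m, pr u m ∈ O ↔ m = f u) :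
    ∃ H, RelBetween H a X ∧ ∀ s, s ∈ X → ∃ h W, IsRestr h H r s ∧ Sub h (prod a X) ∧
      C.Sol h W ∧ ∀ c, c ∈ a → (pr c s ∈ H ↔ ¬ W (f c)) := by
  obtain ⟨N, R, I⟩ := C
  let NN := prod X N
  -- The gate `⟨s, n⟩` is the copy of `n` at `s`. An input `⟨u, t⟩` is on when the output `f u` at
  -- `t` does not fire, and a NAND gate reacts to such an input just as to a predecessor that does
  -- not fire. So inputs can be replaced by wires from `⟨t, f u⟩`, and a solution is the kernel of a
  -- single relation.
  let RR := sep (prod NN NN) fun z => ∃ t, t ∈ X ∧ ∃ m, m ∈ N ∧ ∃ s, s ∈ X ∧ ∃ n, n ∈ N ∧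
    z = pr (pr t m) (pr s n) ∧ ((t = s ∧ pr m n ∈ R) ∨
      (pr t s ∈ r ∧ ∃ u, u ∈ a ∧ pr u m ∈ O ∧ pr n (pr u t) ∈ I))
  have hRR : ∀ t m s n, pr (pr t m) (pr s n) ∈ RR ↔ ((t ∈ X ∧ m ∈ N) ∧ (s ∈ X ∧ n ∈ N)) ∧
      ((t = s ∧ pr m n ∈ R) ∨ (pr t s ∈ r ∧ ∃ u, u ∈ a ∧ m = f u ∧ pr n (pr u t) ∈ I)) := by
    intro t m s n
    have hO' : (∃ u, u ∈ a ∧ m = f u ∧ pr n (pr u t) ∈ I) ↔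
        ∃ u, u ∈ a ∧ pr u m ∈ O ∧ pr n (pr u t) ∈ I :=
      exists_congr fun u => and_congr_right fun hu => and_congr_left' (hO u hu m).symm
    rw [hO']
    simp only [RR, NN, mem_sep, pr_mem_prod, pr_inj]
    refine and_congr_right fun h => ⟨?_, ?_⟩
    · rintro ⟨_, _, _, _, _, _, _, _, ⟨⟨rfl, rfl⟩, rfl, rfl⟩, h⟩
      exact h
    · exact fun h' => ⟨t, h.1.1, m, h.1.2, s, h.2.1, n, h.2.2, ⟨⟨rfl, rfl⟩, rfl, rfl⟩, h'⟩
  have hwf : WFRel RR NN := by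
    refine wfRel_of_induction (fun z hz => (mem_sep.1 hz).1) fun Y hY => ?_
    have key : ∀ s, s ∈ X → ∀ n, n ∈ N → pr s n ∈ Y := by
      -- Lexicographic induction: along `r` between copies, and along `R` within a copy.
      refine hr.induction fun s hs ih => hC.induction fun n hn ih' => ?_
      refine hY _ (pr_mem_prod.2 ⟨hs, hn⟩) fun z hz hzn => ?_
      obtain ⟨t, ht, m, hm, rfl⟩ := mem_prod.1 hz
      rcases ((hRR _ _ _ _).1 hzn).2 with ⟨rfl, h⟩ | ⟨h, _⟩
      · exact ih' m hm h
      · exact ih t ht h m hm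
    intro z hz
    obtain ⟨t, ht, m, hm, rfl⟩ := mem_prod.1 hz
    exact key t ht m hm
  obtain ⟨W, hW⟩ := exists_kernel hM hwf
  let H := sep (prod a X) fun z => ∃ u, u ∈ a ∧ ∃ t, t ∈ X ∧ z = pr u t ∧
    ∃ m, m ∈ N ∧ pr u m ∈ O ∧ pr t m ∉ W
  have hH : ∀ u t, pr u t ∈ H ↔ (u ∈ a ∧ t ∈ X) ∧ pr t (f u) ∉ W := by
    intro u t
    simp only [H, mem_sep, pr_mem_prod, pr_inj]
    refine and_congr_right fun h => ⟨?_, fun h' => ?_⟩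
    · rintro ⟨_, hu, _, _, ⟨rfl, rfl⟩, m, _, h1, h2⟩
      rwa [(hO _ hu _).1 h1] at h2
    · exact ⟨u, h.1, t, h.2, ⟨rfl, rfl⟩, f u, hf u h.1, (hO u h.1 _).2 rfl, h'⟩
  refine ⟨H, relBetween_iff_sub.2 fun z hz => (mem_sep.1 hz).1, fun s hs => ?_⟩
  let h := sep H fun z => ∃ u, u ∈ a ∧ ∃ t, t ∈ X ∧ z = pr u t ∧ pr t s ∈ r
  have hh : ∀ u t, pr u t ∈ h ↔ pr u t ∈ H ∧ pr t s ∈ r := by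
    intro u t
    simp only [h, mem_sep, pr_inj]
    refine and_congr_right fun h1 => ⟨?_, fun h2 => ?_⟩
    · rintro ⟨_, _, _, _, ⟨rfl, rfl⟩, h2⟩
      exact h2
    · exact ⟨u, ((hH _ _).1 h1).1.1, t, ((hH _ _).1 h1).1.2, ⟨rfl, rfl⟩, h2⟩
  have hhs : Sub h (prod a X) := fun z hz => (mem_sep.1 (mem_sep.1 hz).1).1
  refine ⟨h, fun n => pr s n ∈ W, fun z => ?_, hhs, fun n hn => ?_, fun c hc => ?_⟩
  · simp only [pairMem_iff, isPr_iff]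
    constructor
    · intro hz
      obtain ⟨u, _, t, _, rfl⟩ := mem_prod.1 (hhs z hz)
      exact ⟨t, ((hh _ _).1 hz).2, u, ((hh _ _).1 hz).1, rfl⟩
    · rintro ⟨t, hts, u, hu, rfl⟩
      exact (hh _ _).2 ⟨hu, hts⟩
  · show pr s n ∈ W ↔ _
    rw [hW _ (pr_mem_prod.2 ⟨hs, hn⟩)]
    constructor
    · rintro ⟨z, hz, hzn, hzW⟩
      obtain ⟨t, ht, m, hm, rfl⟩ := mem_prod.1 hz
      rcases ((hRR _ _ _ _).1 hzn).2 with ⟨rfl, h1⟩ | ⟨h1, u, hu, rfl, h2⟩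
      · exact Or.inl ⟨m, hm, h1, hzW⟩
      · exact Or.inr ⟨pr u t, (hh _ _).2 ⟨(hH _ _).2 ⟨⟨hu, ht⟩, hzW⟩, h1⟩, h2⟩
    · rintro (⟨m, hm, h1, h2⟩ | ⟨q, hq, h1⟩)
      · exact ⟨pr s m, pr_mem_prod.2 ⟨hs, hm⟩,
          (hRR _ _ _ _).2 ⟨⟨⟨hs, hm⟩, hs, hn⟩, Or.inl ⟨rfl, h1⟩⟩, h2⟩
      · obtain ⟨u, hu, t, ht, rfl⟩ := mem_prod.1 (hhs q hq)
        obtain ⟨h2, h3⟩ := (hh _ _).1 hq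
        exact ⟨pr t (f u), pr_mem_prod.2 ⟨ht, hf u hu⟩,
          (hRR _ _ _ _).2 ⟨⟨⟨ht, hf u hu⟩, hs, hn⟩, Or.inr ⟨h3, u, hu, rfl, h1⟩⟩,
          ((hH _ _).1 h2).2⟩
  · rw [hH]
    exact and_iff_right ⟨hc, hs⟩

theorem models_transRec_of_exists_bisim (hM : ∀ T : M, Tree T → WFTree T → ∃ b, Bisim b T) {m : ℕ}
    {ψ : Lset.Formula (Fin (m + 2))} (hψ : IsDelta0 ψ) (hv : OnlyAsContainer 1 ψ) :
    M ⊨ transRec ψ := by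
  rw [models_transRec]
  intro p a X r hr
  obtain ⟨P, hP⟩ := exists_mem_all p
  -- The set `A` has `a` and `a × X` as subsets and the parameters as elements. By transitivity
  -- every set bounding a quantifier is then a subset of `A`, including the restrictions of `H`, so
  -- relativizing to `A` does not change the truth value of `ψ`.
  obtain ⟨A, hsub, hA⟩ := exists_tc (un a (un (prod a X) P))
  have ha : Sub a A := fun u hu => hsub u (mem_un.2 (Or.inl hu))
  have hprod : Sub (prod a X) A := fun u hu =>
    hsub u (mem_un.2 (Or.inr (mem_un.2 (Or.inl hu))))
  have hp : ∀ i, p i ∈ A := fun i => hsub _ (mem_un.2 (Or.inr (mem_un.2 (Or.inr (hP i)))))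
  have hemp : WFRel (emp M) (emp M) :=
    wfRel_of_induction (fun z hz => absurd hz (not_mem_emp z)) fun Y _ z hz =>
      absurd hz (not_mem_emp z)
  obtain ⟨C₁, h1, hC₁⟩ := exists_computes_formula (A := A) p ψ hv ⟨emp M, emp M, emp M⟩ hemp
  -- The circuit is made to compute the negation of `ψ`, because the iteration puts `⟨c, s⟩` into
  -- `H` when the output does not fire. There are no bound variables yet, so codes of tuples are
  -- just the elements `c` of `A`.
  obtain ⟨C, h2, f, hf, ⟨O, hO⟩, hC⟩ := hC₁.not (h1.wf hemp)
  obtain ⟨H, hH, hrec⟩ := C.exists_iterate hM (h2.wf (h1.wf hemp)) hr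
    (fun u hu => hf u (ha u hu)) (fun u hu => hO u (ha u hu))
  refine ⟨H, hH, fun s hs => ?_⟩
  obtain ⟨h, W, hh, hsub', hW, hHW⟩ := hrec s hs
  refine ⟨h, hh, fun c hc => ?_⟩
  have hhA : Sub h A := fun z hz => hprod z (hsub' z hz)
  have he : ∀ i, Sub ((Fin.cons c (Fin.cons h p) : Fin (m + 2) → M) i) A := by
    intro i
    refine Fin.cases (hA _ (ha c hc)) (fun i => ?_) i
    exact Fin.cases hhA (fun i => hA _ (hp i)) i
  rw [pairMem_iff, hHW c hc]
  refine (not_congr (hC h W hhA hW c (ha c hc) default fun i => i.elim0)).trans ?_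
  rw [not_not]
  exact realizeIn_iff hA he hψ default fun i => i.elim0

end Recursion

end WeakSet

theorem mainTheorem7 :
    (∀ φ ∈ WeakSet.Delta0TR, (WeakSet.B ∪ {WeakSet.bisimulationAxiom}) ⊨ᵇ φ) ∧
      (WeakSet.B ∪ WeakSet.Delta0TR) ⊨ᵇ WeakSet.bisimulationAxiom := by
  simp only [FirstOrder.Language.Theory.models_sentence_iff]
  constructor
  · rintro _ ⟨m, ψ, hψ, hv, rfl⟩ M
    have hB : M ⊨ WeakSet.B := FirstOrder.Language.Theory.Model.mono M.is_model
      Set.subset_union_left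
    exact WeakSet.models_transRec_of_exists_bisim (WeakSet.models_bisimulationAxiom.1
      (FirstOrder.Language.Theory.realize_sentence_of_mem (WeakSet.B ∪ {WeakSet.bisimulationAxiom})
        (Or.inr rfl))) hψ hv
  · intro M
    have hB : M ⊨ WeakSet.B := FirstOrder.Language.Theory.Model.mono M.is_model
      Set.subset_union_left
    refine WeakSet.models_bisimulationAxiom.2 fun T _ hT =>
      WeakSet.exists_bisim_of_transRec ?_ T hT
    exact FirstOrder.Language.Theory.realize_sentence_of_mem (WeakSet.B ∪ WeakSet.Delta0TR)
      (Or.inr ⟨3, WeakSet.bisimF, WeakSet.isDelta0_bisimF, WeakSet.onlyAsContainer_bisimF, rfl⟩)
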